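/- **Setting.** Let $\mathcal M=(\mathcal S,\mathcal A,\mathbb P^\star,r,H,s_0)$ be an episodic Markov decision process with finite state and action sets, transition probabilities $\mathbb P^\star(\cdot\mid s,a)$, known rewards $r(s,a)\in[0,1]$, decision steps $h=0,\dots,H-1$ and initial state $s_0$. Assume that the sets of states reachable at distinct decision steps are disjoint, and write $h(s)$ for the step at which a reachable state $s$ is reachable. Let $V^\pi_h$ be the value functions of a policy $\pi$ (expected total reward over the steps $h,\dots,H-1$) and $V^\star_h=\max_\pi V^\pi_h$, so $V^\star_H=0$. Let $\beta\ge 1$ and let $\widetilde V_h:\mathcal S\to\mathbb R$, $0\le h\le H$, satisfy $V^\star_h(s)\le\beta\widetilde V_h(s)$ for all $s,h$. Put $\widetilde V^{\max}=\max_{s,h}\widetilde V_h(s)$, and let $\delta\in(0,1)$. **Algorithm (UCBVI-Shaped).** In episode $t=1,2,\dots$, let $N_h^t(s,a)$, $N_h^t(s,a,s')$ be the visit counts over the episodes before $t$, let $\widehat{\mathbb P}_t(s'\mid s,a)=N_h^t(s,a,s')/N_h^t(s,a)$ (zero if $N_h^t(s,a)=0$), and let $$b_h^t(s,a)=\min\Big(16\beta\sqrt{\tfrac{\widehat{\mathbb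 E}_{s'\sim\widehat{\mathbb P}_t(\cdot\mid s,a)}[\widetilde V_{h+1}(s')^2]\,\ln\frac{2|\mathcal S||\mathcal A|t}{\delta}}{N_h^t(s,a)}}+\tfrac{12\beta\widetilde V^{\max}}{N_h^t(s,a)}\ln\tfrac{2|\mathcal S||\mathcal A|t}{\delta},\;2\beta\widetilde V^{\max}\Big)$$ (equal to $2\beta\widetilde V^{\max}$ if $N_h^t(s,a)=0$). Starting from $\widehat V_H^t=0$, for $h=H-1,\dots,0$ let $\widehat Q_h^t(s,a)=\min\{r(s,a)+b_h^t(s,a)+\widehat{\mathbb P}_t(\cdot\mid s,a)\cdot\widehat V_{h+1}^t,\,H\}$ and $\widehat V_h^t(s)=\min\{\max_a\widehat Q_h^t(s,a),\,\beta\widetilde V_h(s)\}$. Episode $t$ is played with $\pi_t$, where $\pi^t_h(s)\in\arg\max_a\widehat Q^t_h(s,a)$ (arbitrary non-anticipating tie-breaking). **Pruned sets.** Let $\widetilde Q^u_h(s,a)=\mathbb E_{s'\sim\mathbb P^\star(\cdot\mid s,a)}[r(s,a)+\beta\widetilde V_{h+1}(s')]$. For $\Delta>0$ let $\mathrm{PseudoSub}_\Delta$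 be the set of pairs $(s,a)$, $s$ reachable at the decision step $h=h(s)$, with $V^\star_h(s)\ge\Delta+\widetilde Q^u_h(s,a)$; let $\mathrm{PathPseudoSub}_\Delta$ be the set of states $s$ such that all paths of positive probability from $s_0$ to $s$ (at a decision step of the episode) traverse a pair of $\mathrm{PseudoSub}_\Delta$; and let $\mathrm{BoundaryPseudoSub}_\Delta=\{(s,a)\in\mathrm{PseudoSub}_\Delta: s\notin\mathrm{PathPseudoSub}_\Delta\}$. **Theorem.** There is an absolute constant $C>0$ such that the following holds in every such setting. Let $\kappa=\beta$; or, if moreover $\widetilde V_h(s)\le V_h^\star(s)$ for all $s$ and all $h<H$, let $\kappa$ be either of $\beta$ and $\beta-1$. With probability at least $1-6\delta$, simultaneously for all integers $T\ge1$, $$\sum_{t=1}^T\big(V_0^\star(s_0)-V_0^{\pi_t}(s_0)\big)\le C\inf_{\Delta>0}\Big(H\beta\widetilde V^{\max}\sqrt{|\mathcal S\setminus\mathrm{PathPseudoSub}_\Delta|\,|\mathcal A|\,T\,L_T}+\beta\widetilde V^{\max}L_T\min\{\bar A(\Delta),\bar B(\Delta)\}\Big),$$ where $L_T=\ln\frac{\max(1,\widetilde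 V^{\max})|\mathcal S||\mathcal A|T}{\delta}$, $$\bar A(\Delta)=\frac{\beta\widetilde V^{\max}H^{1/2}|\mathcal S|^{1/2}|\mathcal A|^{1/2}|\mathrm{BoundaryPseudoSub}_\Delta|^{1/2}}{\Delta}+\frac{\kappa}{\beta}|\mathcal S|^2|\mathcal A|H^2\ln(T+1)+|\mathcal S||\mathcal A|\ln(T+1),$$ $$\bar B(\Delta)=\frac{\beta^2(\widetilde V^{\max})^2H|\mathrm{BoundaryPseudoSub}_\Delta|}{\Delta^2}+\frac{\kappa}{\beta}|\mathcal S\setminus\mathrm{PathPseudoSub}_\Delta|^2|\mathcal A|H^2\ln(T+1)+|\mathcal S\setminus\mathrm{PathPseudoSub}_\Delta||\mathcal A|\ln(T+1).$$ -/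

import Mathlib

noncomputable section

namespace ShapedUCBVI

/-- A finite episodic Markov decision process with stationary transition probabilities `P`, known
rewards in `[0,1]`, `H` decision steps `0, …, H - 1` per episode, and initial state `s0`. -/
structure EpisodicMDP (S A : Type*) [Fintype S] where
  P : S → A → S → ℝ
  P_nonneg : ∀ s a s', 0 ≤ P s a s'
  P_sum : ∀ s a, ∑ s', P s a s' = 1
  r : S → A → ℝ
  r_nonneg : ∀ s a, 0 ≤ r s a
  r_le_one : ∀ s a, r s a ≤ 1
  H : ℕ
  s0 : S

variable {S A : Type*} [Fintype S] [Fintype A]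

namespace EpisodicMDP

/-! ### Values -/

open Classical in
/-- `M.stateDist π h s k x`: the probability that the policy `π` (step, state ↦ action), started in
state `s` at step `h`, is in state `x` at step `h + k`. -/
def stateDist (M : EpisodicMDP S A) (π : ℕ → S → A) (h : ℕ) (s : S) : ℕ → S → ℝ
  | 0 => fun x => if x = s then 1 else 0
  | k + 1 => fun y => ∑ x, M.stateDist π h s k x * M.P x (π (h + k) x) y

/-- `V^π_h(s)`: the expected total reward of `π` over the steps `h, …, H - 1`, started in `s`. -/
def value (M : EpisodicMDP S A) (π : ℕ → S → A) (h : ℕ) (s : S) : ℝ :=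
  ∑ k ∈ Finset.range (M.H - h), ∑ x, M.stateDist π h s k x * M.r x (π (h + k) x)

/-- `V*_h(s)`: the optimal value. It is zero at `h = H`. -/
def optValue (M : EpisodicMDP S A) (h : ℕ) (s : S) : ℝ := ⨆ π : ℕ → S → A, M.value π h s

/-! ### Paths, pseudo-suboptimal pairs, pruned states -/

/-- The states `x 0, …, x n` and actions `a 0, …, a (n - 1)` form a path of positive probability
from the initial state. -/
def IsFeasiblePath (M : EpisodicMDP S A) (n : ℕ) (x : ℕ → S) (a : ℕ → A) : Prop :=
  x 0 = M.s0 ∧ ∀ i < n, 0 < M.P (x i) (a i) (x (i + 1))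

/-- The states reachable at step `h`. -/
def reachable (M : EpisodicMDP S A) (h : ℕ) : Set S :=
  {s | ∃ x a, M.IsFeasiblePath h x a ∧ x h = s}

/-- The states are step-indexed: those reachable at distinct decision steps are disjoint. -/
def StepIndexed (M : EpisodicMDP S A) : Prop :=
  ∀ h < M.H, ∀ h' < M.H, h ≠ h' → Disjoint (M.reachable h) (M.reachable h')

/-- The surrogate `Q̃^u_h(s,a) = r(s,a) + β E_{s' ~ P(·|s,a)} Ṽ_{h+1}(s')`. -/
def Qup (M : EpisodicMDP S A) (β : ℝ) (V : ℕ → S → ℝ) (h : ℕ) (s : S) (a : A) : ℝ :=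
  ∑ s', M.P s a s' * (M.r s a + β * V (h + 1) s')

/-- `PseudoSub_Δ`. The step `h` of a state is the one at which it is reachable (unreachable states
are irrelevant: they all lie in `pathPseudoSub`). -/
def pseudoSub (M : EpisodicMDP S A) (β : ℝ) (V : ℕ → S → ℝ) (Δ : ℝ) : Set (S × A) :=
  {p | ∃ h < M.H, p.1 ∈ M.reachable h ∧ Δ + M.Qup β V h p.1 p.2 ≤ M.optValue h p.1}

/-- `PathPseudoSub_Δ`: the states all of whose feasible paths, from the initial state to a decision
step of the episode, traverse a pair of `PseudoSub_Δ`. -/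
def pathPseudoSub (M : EpisodicMDP S A) (β : ℝ) (V : ℕ → S → ℝ) (Δ : ℝ) : Set S :=
  {s | ∀ n < M.H, ∀ x a, M.IsFeasiblePath n x a → x n = s →
    ∃ i < n, (x i, a i) ∈ M.pseudoSub β V Δ}

/-- `BoundaryPseudoSub_Δ`. -/
def boundaryPseudoSub (M : EpisodicMDP S A) (β : ℝ) (V : ℕ → S → ℝ) (Δ : ℝ) : Set (S × A) :=
  {p | p ∈ M.pseudoSub β V Δ ∧ p.1 ∉ M.pathPseudoSub β V Δ}

/-- `Ṽ^max`: the maximum of `Ṽ_h(s)` over all states and `0 ≤ h ≤ H`. -/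
def shapeMax (M : EpisodicMDP S A) (V : ℕ → S → ℝ) : ℝ :=
  ⨆ p : Fin (M.H + 1) × S, V p.1 p.2

/-! ### The algorithm

The data are the states `st i h` and actions `ac i h` of episode `i ≥ 1`, step `h`. -/

open Classical in
/-- `N_h^t(s,a)`: visits of `(s,a)` at step `h` in the episodes before `t`. -/
def visits (st : ℕ → ℕ → S) (ac : ℕ → ℕ → A) (t h : ℕ) (s : S) (a : A) : ℕ :=
  ((Finset.Ico 1 t).filter fun i => st i h = s ∧ ac i h = a).card

open Classical in
/-- `N_h^t(s,a,s')`. -/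
def visitsNext (st : ℕ → ℕ → S) (ac : ℕ → ℕ → A) (t h : ℕ) (s : S) (a : A) (s' : S) : ℕ :=
  ((Finset.Ico 1 t).filter fun i => st i h = s ∧ ac i h = a ∧ st i (h + 1) = s').card

/-- The empirical transition probabilities (zero for a pair that has not been visited). -/
def empP (st : ℕ → ℕ → S) (ac : ℕ → ℕ → A) (t h : ℕ) (s : S) (a : A) (s' : S) : ℝ :=
  (visitsNext st ac t h s a s' : ℝ) / (visits st ac t h s a : ℝ)

/-- The bonus `b_h^t(s,a)`. The first branch is the value of the minimum when the count is zero,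
where the first argument of the minimum is infinite. -/
def bonus (M : EpisodicMDP S A) (β : ℝ) (V : ℕ → S → ℝ) (δ : ℝ)
    (st : ℕ → ℕ → S) (ac : ℕ → ℕ → A) (t h : ℕ) (s : S) (a : A) : ℝ :=
  if visits st ac t h s a = 0 then 2 * β * M.shapeMax V
  else
    min
      (16 * β * Real.sqrt ((∑ s', empP st ac t h s a s' * V (h + 1) s' ^ 2) *
            Real.log (2 * Fintype.card S * Fintype.card A * t / δ) / visits st ac t h s a)
        + 12 * β * M.shapeMax V / visits st ac t h s a *
            Real.log (2 * Fintype.card S * Fintype.card A * t / δ))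
      (2 * β * M.shapeMax V)

/-- One backward step of value iteration: `min (r + b_h^t + P̂_t · W, H)`, with `W` the empirical
value function at the next step. -/
def qStep (M : EpisodicMDP S A) (β : ℝ) (V : ℕ → S → ℝ) (δ : ℝ)
    (st : ℕ → ℕ → S) (ac : ℕ → ℕ → A) (t h : ℕ) (W : S → ℝ) (s : S) (a : A) : ℝ :=
  min (M.r s a + M.bonus β V δ st ac t h s a + ∑ s', empP st ac t h s a s' * W s') M.H

/-- Value iteration with projection, indexed by the number of remaining steps:
`vAux n` is the empirical value function at step `H - n`. -/
def vAux (M : EpisodicMDP S A) (β : ℝ) (V : ℕ → S → ℝ) (δ : ℝ)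
    (st : ℕ → ℕ → S) (ac : ℕ → ℕ → A) (t : ℕ) : ℕ → S → ℝ
  | 0 => fun _ => 0
  | n + 1 => fun s =>
      min (⨆ a, M.qStep β V δ st ac t (M.H - (n + 1)) (M.vAux β V δ st ac t n) s a)
        (β * V (M.H - (n + 1)) s)

/-- The empirical value function at step `h ≤ H` in episode `t`. -/
def Vhat (M : EpisodicMDP S A) (β : ℝ) (V : ℕ → S → ℝ) (δ : ℝ)
    (st : ℕ → ℕ → S) (ac : ℕ → ℕ → A) (t h : ℕ) : S → ℝ :=
  M.vAux β V δ st ac t (M.H - h)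

/-- The empirical `Q`-function at step `h < H` in episode `t`. -/
def Qhat (M : EpisodicMDP S A) (β : ℝ) (V : ℕ → S → ℝ) (δ : ℝ)
    (st : ℕ → ℕ → S) (ac : ℕ → ℕ → A) (t h : ℕ) : S → A → ℝ :=
  M.qStep β V δ st ac t h (M.Vhat β V δ st ac t (h + 1))

/-- The actions taken when episode `i` follows the policy `pol i`. -/
def actions (st : ℕ → ℕ → S) (pol : ℕ → ℕ → S → A) : ℕ → ℕ → A :=
  fun i h => pol i h (st i h)

/-- The event that the history up to step `h` of episode `t`, namely the states of the episodes
before `t`, the policies of the episodes up to `t`, and the states of episode `t` up to step `h`,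
is the one given by `x` and `p`. -/
def history {Ω : Type*} (M : EpisodicMDP S A) (st : Ω → ℕ → ℕ → S) (pol : Ω → ℕ → ℕ → S → A)
    (t h : ℕ) (x : ℕ → ℕ → S) (p : ℕ → ℕ → S → A) : Set Ω :=
  {ω | (∀ i, 1 ≤ i → i < t → ∀ k ≤ M.H, st ω i k = x i k) ∧
    (∀ i, 1 ≤ i → i ≤ t → ∀ k < M.H, ∀ s, pol ω i k s = p i k s) ∧
    (∀ k ≤ h, st ω t k = x t k)}

/-- The states `st` and the policies `pol` of the episodes `1, 2, …` form a run of the algorithm on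
`M`: each episode starts in `s0`; its policy is greedy for the empirical `Q`-function of the data
of the earlier episodes (ties broken in any way, possibly at random, that does not look into the
future); and the next state is drawn from `P(·|s,a)` given the history. -/
structure IsRun {Ω : Type*} [MeasurableSpace Ω] (μ : MeasureTheory.Measure Ω)
    (M : EpisodicMDP S A) (β : ℝ) (V : ℕ → S → ℝ) (δ : ℝ)
    (st : Ω → ℕ → ℕ → S) (pol : Ω → ℕ → ℕ → S → A) : Prop where
  measurable_st : ∀ t h s, MeasurableSet {ω | st ω t h = s}
  measurable_pol : ∀ t h s a, MeasurableSet {ω | pol ω t h s = a}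
  start : ∀ ω t, 1 ≤ t → st ω t 0 = M.s0
  greedy : ∀ ω t, 1 ≤ t → ∀ h < M.H, ∀ s a,
    M.Qhat β V δ (st ω) (actions (st ω) (pol ω)) t h s a ≤
      M.Qhat β V δ (st ω) (actions (st ω) (pol ω)) t h s (pol ω t h s)
  transition : ∀ t, 1 ≤ t → ∀ h < M.H, ∀ x p y,
    μ.real (M.history st pol t h x p ∩ {ω | st ω t (h + 1) = y}) =
      μ.real (M.history st pol t h x p) * M.P (x t h) (p t h (x t h)) y

/-! ### The bound -/

/-- The logarithmic factor `ln (max(1, Ṽ^max) |S| |A| T / δ)`. -/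
def logFactor (M : EpisodicMDP S A) (V : ℕ → S → ℝ) (δ : ℝ) (T : ℕ) : ℝ :=
  Real.log (max 1 (M.shapeMax V) * Fintype.card S * Fintype.card A * T / δ)

/-- `Ā(Δ)`, with `κ` the coefficient of the lower-order term. -/
def Abar (M : EpisodicMDP S A) (β : ℝ) (V : ℕ → S → ℝ) (κ : ℝ) (T : ℕ) (Δ : ℝ) : ℝ :=
  β * M.shapeMax V * Real.sqrt M.H * Real.sqrt (Fintype.card S) * Real.sqrt (Fintype.card A) *
      Real.sqrt (M.boundaryPseudoSub β V Δ).ncard / Δ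
    + κ / β * (Fintype.card S : ℝ) ^ 2 * Fintype.card A * (M.H : ℝ) ^ 2 * Real.log (T + 1)
    + Fintype.card S * Fintype.card A * Real.log (T + 1)

/-- `B̄(Δ)`, with `κ` the coefficient of the lower-order term. -/
def Bbar (M : EpisodicMDP S A) (β : ℝ) (V : ℕ → S → ℝ) (κ : ℝ) (T : ℕ) (Δ : ℝ) : ℝ :=
  β ^ 2 * M.shapeMax V ^ 2 * M.H * (M.boundaryPseudoSub β V Δ).ncard / Δ ^ 2
    + κ / β * ((M.pathPseudoSub β V Δ)ᶜ.ncard : ℝ) ^ 2 * Fintype.card A * (M.H : ℝ) ^ 2 *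
        Real.log (T + 1)
    + (M.pathPseudoSub β V Δ)ᶜ.ncard * Fintype.card A * Real.log (T + 1)

/-- The regret bound at `Δ`, without the absolute constant. -/
def regretBound (M : EpisodicMDP S A) (β : ℝ) (V : ℕ → S → ℝ) (δ κ : ℝ) (T : ℕ) (Δ : ℝ) : ℝ :=
  M.H * β * M.shapeMax V *
      Real.sqrt ((M.pathPseudoSub β V Δ)ᶜ.ncard * Fintype.card A * T * M.logFactor V δ T)
    + β * M.shapeMax V * M.logFactor V δ T *
        min (M.Abar β V κ T Δ) (M.Bbar β V κ T Δ)

end EpisodicMDP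

end ShapedUCBVI

end

/-!
Fix a set `D` of pairs and stop every trajectory at its first pair of `D`. On a good event the
empirical value function `V̂` is optimistic, so the regret of an episode is at most
`V̂_0(s_0) - V^π_0(s_0)`, and this difference obeys a backward recursion. In one step it grows by at
most the bonus, plus `(P̂ - P) V*`, plus `(P̂ - P)(V̂ - V*)`, and it is multiplied by `1 + 1 / H`. The
last factor comes from `(P̂ - P)(V̂ - V*) ≤ P (V̂ - V*) / H + O(n H W ln(·) / N)`, where `n` counts the
states reached while avoiding `D` and `W = κ Ṽ^max` bounds `V̂ - V*`: by the projection `V̂ ≤ β Ṽ`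
this holds both for `κ = β` and, if `Ṽ ≤ V*`, for `κ = β - 1`
(`GoodEvent.Vhat_sub_value_le_stoppedValue`). Since all differences are at most `B = β Ṽ^max`, a step
costs at most `B`, and so does a stop.

The expected costs of the episodes are compared with the realized ones by an exponential
supermartingale (`IsRun.measureReal_stopped_le`). Realized costs are widths of order
`B √(ln(·) / N)` and `1 / N` at the visited pairs, and these are summed by the pigeonhole bound
`sum_width_le`. Optimism and the widths rest on Bernstein bounds for the empirical means
(`IsRun.measureReal_not_concentrated_le`), proved from an exponential moment of the sum over the
visits of a pair and a union bound over the number of visits. The optimism of the bonus uses only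
second moments: `V* ≤ β Ṽ` bounds the second moment of `V*` by that of `β Ṽ`, which is at most twice
the empirical one up to a lower order term (`GoodEvent.deviation_le_bonus`).

A pair of `PseudoSub_Δ` is chosen only while its width exceeds `Δ`, hence `O(B² ln(·) / Δ²)` times
(`GoodEvent.visits_le_of_gap`), and the first such pair of a trajectory lies in
`BoundaryPseudoSub_Δ`. The bound with `B̄` is the case `D = PseudoSub_Δ`, where each stop costs `B`.
For `Ā` one takes `D = ∅`: steps at pruned states occur only in episodes that traverse a boundary
pair, and the pigeonhole bound is applied to them separately. Uniformity in `Δ` costs nothing, as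
the sets `PseudoSub_Δ` form a chain and so take at most `|S| |A| + 1` values. Optimal actions are
never pseudo-suboptimal, so `H` is at most the number of surviving states, which absorbs the
remaining terms.
-/

noncomputable section

namespace ShapedUCBVI

namespace EpisodicMDP

open MeasureTheory

section

variable {S A : Type*} [Fintype S]

/-! ### Values -/

theorem stateDist_succ_left (M : EpisodicMDP S A) (π : ℕ → S → A) (h : ℕ) (s : S) (k : ℕ) (y : S) :
    M.stateDist π h s (k + 1) y =
      ∑ x, M.P s (π h s) x * M.stateDist π (h + 1) x k y := by
  classical
  induction k generalizing y with
  | zero => simp [stateDist]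
  | succ k ih =>
    rw [stateDist]
    simp_rw [ih, Finset.sum_mul]
    rw [Finset.sum_comm]
    refine Finset.sum_congr rfl fun x _ => ?_
    rw [stateDist, Finset.mul_sum]
    refine Finset.sum_congr rfl fun z _ => ?_
    rw [show h + (k + 1) = h + 1 + k by ring]
    ring

theorem value_of_le (M : EpisodicMDP S A) (π : ℕ → S → A) {h : ℕ} (hh : M.H ≤ h) (s : S) :
    M.value π h s = 0 := by
  simp [value, Nat.sub_eq_zero_of_le hh]

/-- The Bellman equation of a policy. -/
theorem value_eq (M : EpisodicMDP S A) (π : ℕ → S → A) {h : ℕ} (hh : h < M.H) (s : S) :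
    M.value π h s = M.r s (π h s) + ∑ x, M.P s (π h s) x * M.value π (h + 1) x := by
  classical
  unfold value
  obtain ⟨n, hn⟩ : ∃ n, M.H - h = n + 1 := ⟨M.H - h - 1, by omega⟩
  have hn' : M.H - (h + 1) = n := by omega
  rw [hn, hn', Finset.sum_range_succ', add_comm]
  congr 1
  · simp [stateDist]
  · simp_rw [stateDist_succ_left, Finset.mul_sum, Finset.sum_mul]
    rw [Finset.sum_comm (s := Finset.univ)]
    refine Finset.sum_congr rfl fun k _ => ?_
    rw [Finset.sum_comm]
    refine Finset.sum_congr rfl fun x _ => Finset.sum_congr rfl fun y _ => ?_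
    rw [show h + (k + 1) = h + 1 + k by ring]
    ring

theorem expect_mono (M : EpisodicMDP S A) (s : S) (a : A) {f g : S → ℝ}
    (hfg : ∀ y, 0 < M.P s a y → f y ≤ g y) :
    ∑ y, M.P s a y * f y ≤ ∑ y, M.P s a y * g y := by
  refine Finset.sum_le_sum fun y _ => ?_
  rcases (M.P_nonneg s a y).eq_or_lt with h | h
  · simp [← h]
  · exact mul_le_mul_of_nonneg_left (hfg y h) h.le

theorem expect_const (M : EpisodicMDP S A) (s : S) (a : A) (c : ℝ) :
    ∑ y, M.P s a y * c = c := by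
  rw [← Finset.sum_mul, M.P_sum, one_mul]

theorem expect_le (M : EpisodicMDP S A) (s : S) (a : A) {f : S → ℝ} {c : ℝ}
    (hf : ∀ y, f y ≤ c) : ∑ y, M.P s a y * f y ≤ c :=
  (M.expect_mono s a fun y _ => hf y).trans_eq (M.expect_const s a c)

theorem expect_nonneg (M : EpisodicMDP S A) (s : S) (a : A) {f : S → ℝ}
    (hf : ∀ y, 0 ≤ f y) : 0 ≤ ∑ y, M.P s a y * f y :=
  Finset.sum_nonneg fun y _ => mul_nonneg (M.P_nonneg s a y) (hf y)

theorem value_mem (M : EpisodicMDP S A) (π : ℕ → S → A) (n h : ℕ) (hn : M.H ≤ h + n) (s : S) :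
    0 ≤ M.value π h s ∧ M.value π h s ≤ n := by
  induction n generalizing h s with
  | zero => rw [value_of_le M π (by omega)]; simp
  | succ n ih =>
    rcases lt_or_ge h M.H with hh | hh
    · rw [M.value_eq π hh]
      have h1 := M.r_nonneg s (π h s)
      have h2 := M.r_le_one s (π h s)
      have h3 := M.expect_nonneg s (π h s) fun y => (ih (h + 1) (by omega) y).1
      have h4 := M.expect_le s (π h s) fun y => (ih (h + 1) (by omega) y).2
      push_cast
      constructor <;> linarith
    · rw [M.value_of_le π hh]
      exact ⟨le_rfl, by positivity⟩

theorem value_nonneg (M : EpisodicMDP S A) (π : ℕ → S → A) (h : ℕ) (s : S) :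
    0 ≤ M.value π h s :=
  (M.value_mem π M.H h (by omega) s).1

theorem value_le_optValue (M : EpisodicMDP S A) (π : ℕ → S → A) (h : ℕ) (s : S) :
    M.value π h s ≤ M.optValue h s :=
  le_ciSup (f := fun π => M.value π h s)
    ⟨M.H, by rintro _ ⟨π, rfl⟩; exact (M.value_mem π M.H h (by omega) s).2⟩ π

section
variable [Nonempty A]

theorem optValue_le (M : EpisodicMDP S A) (h : ℕ) (s : S) : M.optValue h s ≤ M.H :=
  ciSup_le fun π => (M.value_mem π M.H h (by omega) s).2

theorem optValue_nonneg (M : EpisodicMDP S A) (h : ℕ) (s : S) : 0 ≤ M.optValue h s :=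
  (M.value_nonneg (fun _ _ => Classical.arbitrary A) h s).trans (M.value_le_optValue _ h s)

theorem optValue_of_le (M : EpisodicMDP S A) {h : ℕ} (hh : M.H ≤ h) (s : S) :
    M.optValue h s = 0 := by
  simp [optValue, M.value_of_le _ hh]

/-- The half of the Bellman optimality equation that the analysis needs: some action is at least
as good as the optimal value. -/
theorem exists_optValue_le [Fintype A] (M : EpisodicMDP S A) {h : ℕ} (hh : h < M.H) (s : S) :
    ∃ a, M.optValue h s ≤ M.r s a + ∑ y, M.P s a y * M.optValue (h + 1) y := by
  obtain ⟨a, ha⟩ := Finite.exists_max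
    fun a => M.r s a + ∑ y, M.P s a y * M.optValue (h + 1) y
  refine ⟨a, ciSup_le fun π => ?_⟩
  rw [M.value_eq π hh]
  refine le_trans ?_ (ha (π h s))
  gcongr with y
  · exact M.P_nonneg _ _ _
  · exact M.value_le_optValue π (h + 1) y

end

theorem le_shapeMax (M : EpisodicMDP S A) (V : ℕ → S → ℝ) {h : ℕ} (hh : h ≤ M.H) (s : S) :
    V h s ≤ M.shapeMax V :=
  le_ciSup (f := fun p : Fin (M.H + 1) × S => V p.1 p.2) (Set.finite_range _).bddAbove
    (⟨h, by omega⟩, s)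

theorem Qup_eq (M : EpisodicMDP S A) (β : ℝ) (V : ℕ → S → ℝ) (h : ℕ) (s : S) (a : A) :
    M.Qup β V h s a = M.r s a + β * ∑ y, M.P s a y * V (h + 1) y := by
  unfold Qup
  simp_rw [mul_add]
  rw [Finset.sum_add_distrib, M.expect_const, Finset.mul_sum]
  congr 1
  exact Finset.sum_congr rfl fun y _ => by ring

/-! ### States reached along paths that avoid a set of pairs -/

/-- The states that some feasible path of length `h` reaches without traversing a pair of `D`. For
`D = ∅` these are the states reachable at step `h`, and for `D = PseudoSub_Δ` the states at
decision steps that are not pruned. -/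
def avoidReach (M : EpisodicMDP S A) (D : Set (S × A)) (h : ℕ) : Set S :=
  {s | ∃ x a, M.IsFeasiblePath h x a ∧ x h = s ∧ ∀ i < h, (x i, a i) ∉ D}

/-- All states that can be reached at a decision step without traversing a pair of `D`. -/
def avoidStates (M : EpisodicMDP S A) (D : Set (S × A)) : Set S :=
  {s | ∃ h < M.H, s ∈ M.avoidReach D h}

theorem avoidReach_subset_reachable (M : EpisodicMDP S A) (D : Set (S × A)) (h : ℕ) :
    M.avoidReach D h ⊆ M.reachable h := by
  rintro s ⟨x, a, hx, rfl, -⟩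
  exact ⟨x, a, hx, rfl⟩

theorem compl_pathPseudoSub (M : EpisodicMDP S A) (β : ℝ) (V : ℕ → S → ℝ) (Δ : ℝ) :
    (M.pathPseudoSub β V Δ)ᶜ = M.avoidStates (M.pseudoSub β V Δ) := by
  ext s
  simp only [pathPseudoSub, avoidStates, avoidReach, Set.mem_compl_iff, Set.mem_ofPred_eq]
  push Not
  rfl

theorem start_mem_avoidReach [Nonempty A] (M : EpisodicMDP S A) (D : Set (S × A)) :
    M.s0 ∈ M.avoidReach D 0 :=
  ⟨fun _ => M.s0, fun _ => Classical.arbitrary A, ⟨rfl, by simp⟩, rfl, by simp⟩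

theorem avoidReach_succ (M : EpisodicMDP S A) {D : Set (S × A)} {h : ℕ} {s y : S} {a : A}
    (hs : s ∈ M.avoidReach D h) (ha : (s, a) ∉ D) (hy : 0 < M.P s a y) :
    y ∈ M.avoidReach D (h + 1) := by
  classical
  obtain ⟨x, b, ⟨hx0, hx⟩, rfl, hD⟩ := hs
  have key : ∀ i < h + 1,
      (Function.update x (h + 1) y) i = x i ∧
      ((Function.update x (h + 1) y) (i + 1) = if i = h then y else x (i + 1)) ∧
      (Function.update b h a) i = if i = h then a else b i := by
    intro i hi
    refine ⟨by simp [Function.update, show i ≠ h + 1 by omega], ?_, ?_⟩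
    · simp [Function.update]
    · simp [Function.update]
  refine ⟨Function.update x (h + 1) y, Function.update b h a, ⟨?_, ?_⟩, by simp, ?_⟩
  · rw [(key 0 (by omega)).1, hx0]
  · intro i hi
    obtain ⟨h1, h2, h3⟩ := key i hi
    rw [h1, h2, h3]
    rcases eq_or_ne i h with rfl | hne
    · simpa using hy
    · simpa [hne] using hx i (by omega)
  · intro i hi
    obtain ⟨h1, h2, h3⟩ := key i hi
    rw [h1, h3]
    rcases eq_or_ne i h with rfl | hne
    · simpa using ha
    · simpa [hne] using hD i (by omega)

/-- Under step-indexing, the step at which a state is reached is unique. -/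
theorem StepIndexed.eq {M : EpisodicMDP S A} (hM : M.StepIndexed) {h h' : ℕ} (hh : h < M.H)
    (hh' : h' < M.H) {s : S} (hs : s ∈ M.reachable h) (hs' : s ∈ M.reachable h') : h = h' := by
  by_contra hne
  exact Set.disjoint_left.1 (hM h hh h' hh' hne) hs hs'

/-- Paths that follow optimal actions never traverse a pseudo-suboptimal pair, so at every step
some state survives the pruning. -/
theorem avoidReach_pseudoSub_nonempty [Fintype A] [Nonempty A] (M : EpisodicMDP S A) (hM : M.StepIndexed)
    {β : ℝ} {V : ℕ → S → ℝ} (hV : ∀ h ≤ M.H, ∀ s, M.optValue h s ≤ β * V h s)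
    {Δ : ℝ} (hΔ : 0 < Δ) (h : ℕ) (hh : h < M.H) :
    (M.avoidReach (M.pseudoSub β V Δ) h).Nonempty := by
  induction h with
  | zero => exact ⟨_, M.start_mem_avoidReach _⟩
  | succ h ih =>
    obtain ⟨s, hs⟩ := ih (by omega)
    obtain ⟨a, ha⟩ := M.exists_optValue_le (by omega : h < M.H) s
    have hnot : (s, a) ∉ M.pseudoSub β V Δ := by
      rintro ⟨h', hh', hr, hle⟩
      have : h' = h := hM.eq hh' (by omega) hr (M.avoidReach_subset_reachable _ _ hs)
      subst this
      rw [Qup_eq, Finset.mul_sum] at hle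
      have : ∑ y, M.P s a y * M.optValue (h' + 1) y ≤
          ∑ y, β * (M.P s a y * V (h' + 1) y) := by
        refine Finset.sum_le_sum fun y _ => ?_
        rw [mul_left_comm]
        exact mul_le_mul_of_nonneg_left (hV _ (by omega) y) (M.P_nonneg _ _ _)
      simp only at hle
      linarith
    obtain ⟨y, -, hy⟩ : ∃ y ∈ Finset.univ, 0 < M.P s a y := by
      by_contra hcon
      push Not at hcon
      have := Finset.sum_nonpos hcon
      rw [M.P_sum] at this
      linarith
    exact ⟨y, M.avoidReach_succ hs hnot hy⟩

theorem H_le_ncard_avoidStates (M : EpisodicMDP S A) (hM : M.StepIndexed) {D : Set (S × A)}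
    (hD : ∀ h < M.H, (M.avoidReach D h).Nonempty) : M.H ≤ (M.avoidStates D).ncard := by
  choose f hf using hD
  have hinj : Function.Injective fun i : Fin M.H => f i i.2 := by
    intro i j hij
    exact Fin.ext (hM.eq i.2 j.2 (M.avoidReach_subset_reachable _ _ (hf i i.2))
      (by simpa [hij] using M.avoidReach_subset_reachable _ _ (hf j j.2)))
  have := Set.ncard_le_ncard (s := Set.range fun i : Fin M.H => f i i.2) (t := M.avoidStates D)
    (by rintro _ ⟨i, rfl⟩; exact ⟨i, i.2, hf i i.2⟩)
  rwa [← Set.image_univ, Set.ncard_image_of_injective _ hinj, Set.ncard_univ, Nat.card_fin] at this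

end

section

variable {S A : Type*} [Fintype S]

/-! ### Functions of the history -/

/-- `g` depends only on the history up to step `h` of episode `t`. -/
def HistDet {Ω X : Type*} (M : EpisodicMDP S A) (st : Ω → ℕ → ℕ → S) (pol : Ω → ℕ → ℕ → S → A)
    (t h : ℕ) (g : Ω → X) : Prop :=
  ∀ ω ω', ω' ∈ M.history st pol t h (st ω) (pol ω) → g ω' = g ω

/-- The finite type of the histories up to step `h` of episode `t`. -/
abbrev HistType (M : EpisodicMDP S A) (t h : ℕ) : Type _ :=
  (Finset.Ico 1 t → Fin (M.H + 1) → S) × (Finset.Icc 1 t → Fin M.H → S → A) × (Fin (h + 1) → S)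

/-- The history up to step `h` of episode `t`. -/
def histData {Ω : Type*} (M : EpisodicMDP S A) (st : Ω → ℕ → ℕ → S) (pol : Ω → ℕ → ℕ → S → A)
    (t h : ℕ) (ω : Ω) : M.HistType t h :=
  (fun i k => st ω i k, fun i k => pol ω i k, fun k => st ω t k)

section

variable {Ω : Type*} {M : EpisodicMDP S A} {st : Ω → ℕ → ℕ → S} {pol : Ω → ℕ → ℕ → S → A}

theorem histData_eq_iff (t h : ℕ) (ω ω' : Ω) :
    M.histData st pol t h ω' = M.histData st pol t h ω ↔
      ω' ∈ M.history st pol t h (st ω) (pol ω) := by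
  simp only [histData, history, Prod.mk.injEq, funext_iff, Subtype.forall, Finset.mem_Ico,
    Finset.mem_Icc, Set.mem_ofPred_eq, Fin.forall_iff, Nat.lt_succ_iff, and_imp]

theorem HistDet.exists_eq {X : Type*} [Nonempty X] {t h : ℕ} {g : Ω → X}
    (hg : M.HistDet st pol t h g) : ∃ e : M.HistType t h → X, ∀ ω, g ω = e (M.histData st pol t h ω) := by
  have hf : g.FactorsThrough (M.histData st pol t h) := fun a b hab =>
    hg b a ((histData_eq_iff t h b a).1 hab)
  obtain ⟨e, he⟩ := (Function.factorsThrough_iff _).1 hf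
  exact ⟨e, fun ω => congrFun he ω⟩

theorem HistDet.mono {X : Type*} {t h h' : ℕ} {g : Ω → X} (hg : M.HistDet st pol t h g)
    (hh : h ≤ h') : M.HistDet st pol t h' g :=
  fun ω ω' hω => hg ω ω' ⟨hω.1, hω.2.1, fun k hk => hω.2.2 k (hk.trans hh)⟩

theorem HistDet.succ {X : Type*} {t h : ℕ} {g : Ω → X} (hg : M.HistDet st pol t h g)
    (ht : 1 ≤ t) (hh : h ≤ M.H) (h' : ℕ) : M.HistDet st pol (t + 1) h' g :=
  fun ω ω' hω => hg ω ω' ⟨fun i hi hit => hω.1 i hi (by omega),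
    fun i hi hit => hω.2.1 i hi (by omega), fun k hk => hω.1 t ht (by omega) k (by omega)⟩

theorem HistDet.comp {X Y : Type*} {t h : ℕ} {g : Ω → X} (hg : M.HistDet st pol t h g)
    (f : X → Y) : M.HistDet st pol t h fun ω => f (g ω) :=
  fun ω ω' hω => congrArg f (hg ω ω' hω)

theorem HistDet.comp₂ {X Y Z : Type*} {t h : ℕ} {g : Ω → X} {g' : Ω → Y}
    (hg : M.HistDet st pol t h g) (hg' : M.HistDet st pol t h g') (f : X → Y → Z) :
    M.HistDet st pol t h fun ω => f (g ω) (g' ω) :=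
  fun ω ω' hω => congrArg₂ f (hg ω ω' hω) (hg' ω ω' hω)

theorem histDet_st {t h k : ℕ} (hk : k ≤ h) : M.HistDet st pol t h fun ω => st ω t k :=
  fun _ _ hω => hω.2.2 k hk

theorem histDet_pol {t h k : ℕ} (ht : 1 ≤ t) (hk : k < M.H) :
    M.HistDet st pol t h fun ω => pol ω t k :=
  fun _ _ hω => funext fun s => hω.2.1 t ht le_rfl k hk s

theorem histDet_ac {t h k : ℕ} (ht : 1 ≤ t) (hk : k < M.H) (hkh : k ≤ h) :
    M.HistDet st pol t h fun ω => actions (st ω) (pol ω) t k :=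
  (histDet_pol ht hk).comp₂ (histDet_st hkh) fun p s => p s

theorem histDet_visits {t h k : ℕ} (hk : k < M.H) (s : S) (a : A) :
    M.HistDet st pol t h fun ω => visits (st ω) (actions (st ω) (pol ω)) t k s a := by
  classical
  intro ω ω' hω
  unfold visits
  refine congrArg Finset.card (Finset.filter_congr fun i hi => ?_)
  obtain ⟨h1, h2⟩ := Finset.mem_Ico.1 hi
  have hac : actions (st ω') (pol ω') i k = actions (st ω) (pol ω) i k := by
    simp only [actions]
    rw [hω.1 i h1 h2 k hk.le, hω.2.1 i h1 h2.le k hk]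
  rw [hω.1 i h1 h2 k hk.le, hac]

/-- The sum `∑ g (s')` over the transitions out of `(s,a)` at step `h` in
the episodes before `t`. -/
def visitSum (st : ℕ → ℕ → S) (ac : ℕ → ℕ → A) (t h : ℕ) (s : S) (a : A) (g : S → ℝ) : ℝ :=
  open Classical in
  ∑ i ∈ Finset.Ico 1 t, if st i h = s ∧ ac i h = a then g (st i (h + 1)) else 0

theorem histDet_visitSum {t h k : ℕ} (hk : k < M.H) (s : S) (a : A) (g : S → ℝ) :
    M.HistDet st pol t h fun ω => visitSum (st ω) (actions (st ω) (pol ω)) t k s a g := by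
  classical
  intro ω ω' hω
  unfold visitSum
  refine Finset.sum_congr rfl fun i hi => ?_
  obtain ⟨h1, h2⟩ := Finset.mem_Ico.1 hi
  have hac : actions (st ω') (pol ω') i k = actions (st ω) (pol ω) i k := by
    simp only [actions]
    rw [hω.1 i h1 h2 k hk.le, hω.2.1 i h1 h2.le k hk]
  rw [hω.1 i h1 h2 k hk.le, hac, hω.1 i h1 h2 (k + 1) hk]

/-! ### Integration over the history -/

variable [Fintype A] [MeasurableSpace Ω] {μ : Measure Ω} [IsProbabilityMeasure μ]
  {β : ℝ} {V : ℕ → S → ℝ} {δ : ℝ}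

theorem integrable_of_finite {T : Type*} [Finite T] {X : Ω → T}
    (hX : ∀ v, MeasurableSet (X ⁻¹' {v})) (f : T → ℝ) :
    Integrable (fun ω => f (X ω)) μ := by
  let : MeasurableSpace T := ⊤
  have : Nonempty Ω := nonempty_of_isProbabilityMeasure μ
  have hm : Measurable X := measurable_to_countable' hX
  obtain ⟨C, hC⟩ := (Set.finite_range fun v => |f v|).bddAbove
  refine Integrable.of_bound ((measurable_from_top.comp hm).aestronglyMeasurable) C ?_
  exact Filter.Eventually.of_forall fun ω => hC ⟨X ω, rfl⟩

theorem integral_of_finite {T : Type*} [Fintype T] {X : Ω → T}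
    (hX : ∀ v, MeasurableSet (X ⁻¹' {v})) (f : T → ℝ) :
    ∫ ω, f (X ω) ∂μ = ∑ v, μ.real (X ⁻¹' {v}) * f v := by
  let : MeasurableSpace T := ⊤
  have hm : Measurable X := measurable_to_countable' hX
  have : IsProbabilityMeasure (μ.map X) := Measure.isProbabilityMeasure_map hm.aemeasurable
  rw [← integral_map (φ := X) (f := f) hm.aemeasurable measurable_from_top.aestronglyMeasurable,
    integral_fintype .of_finite]
  refine Finset.sum_congr rfl fun v _ => ?_
  rw [map_measureReal_apply hm (measurableSet_singleton v), smul_eq_mul]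

omit [IsProbabilityMeasure μ] in
theorem IsRun.measurableSet_histData (hrun : IsRun μ M β V δ st pol) (t h : ℕ)
    (v : M.HistType t h) : MeasurableSet (M.histData st pol t h ⁻¹' {v}) := by
  have : M.histData st pol t h ⁻¹' {v} =
      (⋂ i, ⋂ k, {ω | st ω (i : Finset.Ico 1 t) (k : Fin (M.H + 1)) = v.1 i k}) ∩
      ((⋂ i, ⋂ k, ⋂ s, {ω | pol ω (i : Finset.Icc 1 t) (k : Fin M.H) s = v.2.1 i k s}) ∩
      ⋂ k, {ω | st ω t (k : Fin (h + 1)) = v.2.2 k}) := by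
    ext ω
    simp [histData, Prod.ext_iff, funext_iff]
  rw [this]
  refine (MeasurableSet.iInter fun i => MeasurableSet.iInter fun k => hrun.measurable_st _ _ _).inter
    ((MeasurableSet.iInter fun i => MeasurableSet.iInter fun k => MeasurableSet.iInter fun s =>
      hrun.measurable_pol _ _ _ _).inter (MeasurableSet.iInter fun k => hrun.measurable_st _ _ _))

theorem IsRun.integrable (hrun : IsRun μ M β V δ st pol) {t h : ℕ} {g : Ω → ℝ}
    (hg : M.HistDet st pol t h g) : Integrable g μ := by
  obtain ⟨e, he⟩ := hg.exists_eq
  rw [funext he]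
  exact integrable_of_finite (hrun.measurableSet_histData t h) e

/-- The law of the next state given the history, in integrated form. -/
theorem IsRun.integral_next (hrun : IsRun μ M β V δ st pol) {t h : ℕ} (ht : 1 ≤ t) (hh : h < M.H)
    {g : Ω → S → ℝ} (hg : M.HistDet st pol t h g) :
    ∫ ω, g ω (st ω t (h + 1)) ∂μ =
      ∫ ω, ∑ y, M.P (st ω t h) (pol ω t h (st ω t h)) y * g ω y ∂μ := by
  classical
  let : Fintype (M.HistType t h) := Fintype.ofFinite _
  obtain ⟨e, he⟩ := hg.exists_eq
  have hΦ := hrun.measurableSet_histData t h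
  have hp : M.HistDet st pol t h fun ω => M.P (st ω t h) (pol ω t h (st ω t h)) :=
    (histDet_st le_rfl).comp₂ (histDet_ac ht hh le_rfl) M.P
  obtain ⟨q, hq⟩ := hp.exists_eq
  simp_rw [he, hq]
  rw [integral_of_finite hΦ (fun v => ∑ y, q v y * e v y),
    integral_of_finite (X := fun ω => (M.histData st pol t h ω, st ω t (h + 1)))
      (fun v => by
        have : (fun ω => (M.histData st pol t h ω, st ω t (h + 1))) ⁻¹' {v} =
            M.histData st pol t h ⁻¹' {v.1} ∩ {ω | st ω t (h + 1) = v.2} := by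
          ext ω; simp [Prod.ext_iff]
        rw [this]
        exact (hΦ _).inter (hrun.measurable_st _ _ _)) (fun v => e v.1 v.2),
    Fintype.sum_prod_type]
  refine Finset.sum_congr rfl fun v _ => ?_
  rw [Finset.mul_sum]
  refine Finset.sum_congr rfl fun y _ => ?_
  have hset : (fun ω => (M.histData st pol t h ω, st ω t (h + 1))) ⁻¹' {(v, y)} =
      M.histData st pol t h ⁻¹' {v} ∩ {ω | st ω t (h + 1) = y} := by
    ext ω; simp
  rw [hset]
  rcases Set.eq_empty_or_nonempty (M.histData st pol t h ⁻¹' {v}) with hv | ⟨ω0, h0⟩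
  · simp [hv]
  · have hv : M.histData st pol t h ⁻¹' {v} = M.history st pol t h (st ω0) (pol ω0) := by
      ext ω
      rw [← histData_eq_iff, h0]
      simp
    rw [hv, hrun.transition t ht h hh, ← mul_assoc]
    congr 2
    have := congrFun (hq ω0) y
    rw [this, h0]

/-- Almost surely every transition that occurs has positive probability. -/
theorem IsRun.ae_pos (hrun : IsRun μ M β V δ st pol) :
    ∀ᵐ ω ∂μ, ∀ t, 1 ≤ t → ∀ h < M.H,
      0 < M.P (st ω t h) (actions (st ω) (pol ω) t h) (st ω t (h + 1)) := by
  classical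
  refine ae_all_iff.2 fun t => ?_
  by_cases ht : 1 ≤ t
  swap
  · exact Filter.Eventually.of_forall fun ω h1 => absurd h1 ht
  refine Filter.Eventually.mono (ae_all_iff.2 fun h => ?_) fun ω hω _ => hω
  by_cases hh : h < M.H
  swap
  · exact Filter.Eventually.of_forall fun ω h1 => absurd h1 hh
  set f : S → A → S → ℝ := fun s a y => if M.P s a y = 0 then 1 else 0 with hf
  set g : Ω → S → ℝ := fun ω => f (st ω t h) (actions (st ω) (pol ω) t h) with hgdef
  have hg : M.HistDet st pol t h g :=
    (histDet_st le_rfl).comp₂ (histDet_ac ht hh le_rfl) f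
  have hint := hrun.integral_next ht hh hg
  have hzero : ∀ ω, ∑ y, M.P (st ω t h) (pol ω t h (st ω t h)) y * g ω y = 0 := by
    intro ω
    refine Finset.sum_eq_zero fun y _ => ?_
    simp only [hgdef, hf, actions]
    split_ifs with h0
    · simp [h0]
    · simp
  simp_rw [hzero, integral_zero] at hint
  have hint' : Integrable (fun ω => g ω (st ω t (h + 1))) μ := by
    refine hrun.integrable (t := t) (h := h + 1) ?_
    exact (hg.mono (by omega)).comp₂ (histDet_st le_rfl) fun f y => f y
  rw [integral_eq_zero_iff_of_nonneg (fun ω => by simp only [hgdef, hf]; split_ifs <;> simp) hint']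
    at hint
  filter_upwards [hint] with ω hω _
  simp only [hgdef, hf, Pi.zero_apply, ite_eq_right_iff, one_ne_zero, imp_false] at hω
  exact lt_of_le_of_ne (M.P_nonneg _ _ _) (Ne.symm hω)

/-! ### Concentration of the empirical transition probabilities -/

theorem IsRun.integral_exp_visitSum_le (hrun : IsRun μ M β V δ st pol) {h : ℕ} (hh : h < M.H)
    (s : S) (a : A) {g : S → ℝ} (hg : ∑ y, M.P s a y * Real.exp (g y) ≤ 1) (t : ℕ) :
    ∫ ω, Real.exp (visitSum (st ω) (actions (st ω) (pol ω)) t h s a g) ∂μ ≤ 1 := by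
  classical
  rcases Nat.eq_zero_or_pos t with rfl | ht
  · simp [visitSum]
  induction t, ht using Nat.le_induction with
  | base => simp [visitSum]
  | succ t ht ih =>
    refine le_trans ?_ ih
    set Z : Ω → ℝ := fun ω => Real.exp (visitSum (st ω) (actions (st ω) (pol ω)) t h s a g)
    have hZ : M.HistDet st pol t h Z := (histDet_visitSum hh s a g).comp Real.exp
    set F : Ω → S → ℝ := fun ω y => Z ω *
      if st ω t h = s ∧ actions (st ω) (pol ω) t h = a then Real.exp (g y) else 1 with hF
    have hFd : M.HistDet st pol t h F :=
      hZ.comp₂ ((histDet_st le_rfl).comp₂ (histDet_ac ht hh le_rfl) fun x b => (x, b))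
        fun z p y => z * if p.1 = s ∧ p.2 = a then Real.exp (g y) else 1
    have hsucc : ∀ ω, Real.exp (visitSum (st ω) (actions (st ω) (pol ω)) (t + 1) h s a g) =
        F ω (st ω t (h + 1)) := by
      intro ω
      simp only [hF, Z, visitSum]
      rw [Finset.sum_Ico_succ_top ht, Real.exp_add]
      congr 1
      split_ifs <;> simp
    simp_rw [hsucc]
    rw [hrun.integral_next ht hh hFd]
    refine integral_mono ?_ (hrun.integrable hZ) fun ω => ?_
    · refine hrun.integrable (t := t) (h := h) ?_
      exact ((histDet_st le_rfl).comp₂ (histDet_ac ht hh le_rfl) M.P).comp₂ hFd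
        fun p f => ∑ y, p y * f y
    · simp only [hF]
      have hZ0 : 0 ≤ Z ω := (Real.exp_pos _).le
      split_ifs with hv
      · obtain ⟨h1, h2⟩ := hv
        simp only [actions] at h2
        rw [h2, h1]
        simp_rw [mul_left_comm _ (Z ω)]
        rw [← Finset.mul_sum]
        exact mul_le_of_le_one_right hZ0 hg
      · simp_rw [mul_one]
        rw [M.expect_const]

/-- The Chernoff bound that `integral_exp_visitSum_le` gives. -/
theorem IsRun.measureReal_visitSum_ge_le (hrun : IsRun μ M β V δ st pol) {h : ℕ} (hh : h < M.H)
    (s : S) (a : A) {g : S → ℝ} (hg : ∑ y, M.P s a y * Real.exp (g y) ≤ 1) (t : ℕ) (x : ℝ) :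
    μ.real {ω | x ≤ visitSum (st ω) (actions (st ω) (pol ω)) t h s a g} ≤ Real.exp (-x) := by
  have h1 := hrun.integral_exp_visitSum_le hh s a hg t
  have h2 := mul_meas_ge_le_integral_of_nonneg (μ := μ)
    (f := fun ω => Real.exp (visitSum (st ω) (actions (st ω) (pol ω)) t h s a g))
    (Filter.Eventually.of_forall fun ω => (Real.exp_pos _).le)
    (hrun.integrable ((histDet_visitSum (t := t) (h := 0) hh s a g).comp Real.exp)) (Real.exp x)
  simp only [Real.exp_le_exp] at h2
  rw [Real.exp_neg, ← one_div, le_div_iff₀ (Real.exp_pos x), mul_comm]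
  exact h2.trans h1

end

end

section

theorem exp_neg_le_quadratic {u : ℝ} (hu : 0 ≤ u) : Real.exp (-u) ≤ 1 - u + u ^ 2 / 2 := by
  have h := Real.quadratic_le_exp_of_nonneg hu
  have hpos : 0 < 1 - u + u ^ 2 / 2 := by nlinarith [sq_nonneg (u - 1)]
  rw [Real.exp_neg, inv_le_comm₀ (Real.exp_pos u) hpos]
  refine le_trans ?_ h
  rw [inv_eq_one_div, div_le_iff₀ hpos]
  nlinarith [sq_nonneg (u ^ 2)]

theorem exp_le_quadratic {u : ℝ} (hu : 0 ≤ u) (hu1 : u ≤ 1) : Real.exp u ≤ 1 + u + u ^ 2 := by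
  have h := Real.abs_exp_sub_one_sub_id_le (abs_le.2 ⟨by linarith, hu1⟩)
  linarith [(abs_le.1 h).2]

section

variable {S A : Type*}

theorem visitSum_affine (st : ℕ → ℕ → S) (ac : ℕ → ℕ → A) (t h : ℕ) (s : S) (a : A) (f : S → ℝ)
    (α c : ℝ) : visitSum st ac t h s a (fun y => α * f y + c) =
      α * visitSum st ac t h s a f + visits st ac t h s a * c := by
  classical
  unfold visitSum visits
  rw [Finset.card_filter, Finset.mul_sum, Nat.cast_sum, Finset.sum_mul, ← Finset.sum_add_distrib]
  refine Finset.sum_congr rfl fun i _ => ?_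
  by_cases hi : st i h = s ∧ ac i h = a <;> simp [hi]

theorem sum_empP_mul [Fintype S] (st : ℕ → ℕ → S) (ac : ℕ → ℕ → A) (t h : ℕ) (s : S) (a : A)
    (f : S → ℝ) : ∑ y, empP st ac t h s a y * f y =
      visitSum st ac t h s a f / visits st ac t h s a := by
  classical
  unfold empP
  simp_rw [div_mul_eq_mul_div]
  rw [← Finset.sum_div]
  congr 1
  unfold visitSum visitsNext
  simp_rw [Finset.card_filter, Nat.cast_sum, Finset.sum_mul]
  rw [Finset.sum_comm]
  refine Finset.sum_congr rfl fun i _ => ?_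
  by_cases hi : st i h = s ∧ ac i h = a
  · simp [hi.1, hi.2]
  · rw [if_neg hi]
    refine Finset.sum_eq_zero fun y _ => ?_
    rw [if_neg (fun hh => hi ⟨hh.1, hh.2.1⟩)]
    simp

theorem visits_lt (st : ℕ → ℕ → S) (ac : ℕ → ℕ → A) {t : ℕ} (ht : 1 ≤ t) (h : ℕ) (s : S) (a : A) :
    visits st ac t h s a < t := by
  classical
  have := Finset.card_filter_le (Finset.Ico 1 t) fun i => st i h = s ∧ ac i h = a
  rw [Nat.card_Ico] at this
  unfold visits
  omega

end

variable {S A : Type*} [Fintype S]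

/-- The empirical mean of `f` after the pair `(s,a)` at step `h` satisfies Bernstein-type
deviation bounds at confidence level `x`, in terms of the true second moment of `f`. The lower
deviation has no term of order `1 / N`, because `f` is nonnegative. -/
def Concentrated (M : EpisodicMDP S A) (st : ℕ → ℕ → S) (ac : ℕ → ℕ → A) (t h : ℕ) (s : S) (a : A)
    (x B : ℝ) (f : S → ℝ) : Prop :=
  0 < visits st ac t h s a →
    ∑ y, M.P s a y * f y - ∑ y, empP st ac t h s a y * f y ≤
        Real.sqrt (2 * x * (∑ y, M.P s a y * f y ^ 2) / visits st ac t h s a) ∧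
    ∑ y, empP st ac t h s a y * f y - ∑ y, M.P s a y * f y ≤
        2 * Real.sqrt (x * (∑ y, M.P s a y * f y ^ 2) / visits st ac t h s a) +
          B * x / visits st ac t h s a

variable {Ω : Type*} {M : EpisodicMDP S A} {st : Ω → ℕ → ℕ → S} {pol : Ω → ℕ → ℕ → S → A}
  [Fintype A] [MeasurableSpace Ω] {μ : Measure Ω} [IsProbabilityMeasure μ]
  {β : ℝ} {V : ℕ → S → ℝ} {δ : ℝ}

theorem IsRun.measureReal_lower_le (hrun : IsRun μ M β V δ st pol) {h : ℕ} (hh : h < M.H)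
    (s : S) (a : A) {f : S → ℝ} (hf : ∀ y, 0 ≤ f y) {n : ℕ} (hn : 0 < n) (t : ℕ) {x : ℝ}
    (hx : 0 < x) :
    μ.real {ω | visits (st ω) (actions (st ω) (pol ω)) t h s a = n ∧
      Real.sqrt (2 * x * (∑ y, M.P s a y * f y ^ 2) / n) < ∑ y, M.P s a y * f y -
        ∑ y, empP (st ω) (actions (st ω) (pol ω)) t h s a y * f y} ≤ Real.exp (-x) := by
  have hn' : (0 : ℝ) < n := by exact_mod_cast hn
  set v := ∑ y, M.P s a y * f y ^ 2 with hv
  set m := ∑ y, M.P s a y * f y with hm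
  have hv0 : 0 ≤ v := M.expect_nonneg s a fun y => sq_nonneg _
  rcases hv0.eq_or_lt with hv1 | hv1
  · have hm0 : m = 0 := by
      refine Finset.sum_eq_zero fun y hy => ?_
      have := (Finset.sum_eq_zero_iff_of_nonneg
        (fun y _ => mul_nonneg (M.P_nonneg s a y) (sq_nonneg (f y)))).1 hv1.symm y hy
      rcases mul_eq_zero.1 this with h0 | h0
      · simp [h0]
      · simp [pow_eq_zero_iff two_ne_zero |>.1 h0]
    refine le_of_eq_of_le ?_ (Real.exp_pos _).le
    convert measureReal_empty (μ := μ) using 2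
    rw [Set.eq_empty_iff_forall_notMem]
    rintro ω ⟨-, h2⟩
    have h3 : 0 ≤ ∑ y, empP (st ω) (actions (st ω) (pol ω)) t h s a y * f y :=
      Finset.sum_nonneg fun y _ => mul_nonneg (by unfold empP; positivity) (hf y)
    have h4 := Real.sqrt_nonneg (2 * x * v / n)
    linarith
  set d := Real.sqrt (2 * x * v / n) with hd
  have hd2 : d ^ 2 = 2 * x * v / n := Real.sq_sqrt (by positivity)
  have hd0 : 0 < d := Real.sqrt_pos.2 (by positivity)
  set lam := d / v with hlam
  have hlam0 : 0 < lam := by positivity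
  have hg : ∑ y, M.P s a y * Real.exp (-lam * f y + (lam * m - lam ^ 2 * v / 2)) ≤ 1 := by
    simp_rw [Real.exp_add, ← mul_assoc]
    rw [← Finset.sum_mul]
    have h1 : ∑ y, M.P s a y * Real.exp (-lam * f y) ≤ 1 - lam * m + lam ^ 2 * v / 2 := by
      calc _ ≤ ∑ y, M.P s a y * (1 - lam * f y + (lam * f y) ^ 2 / 2) := by
            refine M.expect_mono s a fun y _ => ?_
            rw [neg_mul]
            exact exp_neg_le_quadratic (mul_nonneg hlam0.le (hf y))
        _ = ∑ y, (M.P s a y - lam * (M.P s a y * f y) +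
              lam ^ 2 / 2 * (M.P s a y * f y ^ 2)) :=
            Finset.sum_congr rfl fun y _ => by ring
        _ = _ := by
            rw [Finset.sum_add_distrib, Finset.sum_sub_distrib, ← Finset.mul_sum,
              ← Finset.mul_sum, M.P_sum]
            ring
    have h2 := Real.add_one_le_exp (-(lam * m - lam ^ 2 * v / 2))
    calc _ ≤ Real.exp (-(lam * m - lam ^ 2 * v / 2)) * Real.exp (lam * m - lam ^ 2 * v / 2) := by
          gcongr; linarith
      _ = 1 := by rw [← Real.exp_add]; simp
  refine le_trans (measureReal_mono ?_) (hrun.measureReal_visitSum_ge_le hh s a hg t x)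
  rintro ω ⟨h1, h2⟩
  simp only [Set.mem_ofPred_eq]
  rw [visitSum_affine, h1]
  rw [sum_empP_mul, h1, lt_sub_iff_add_lt, ← lt_sub_iff_add_lt', div_lt_iff₀ hn'] at h2
  have h3 : lam * visitSum (st ω) (actions (st ω) (pol ω)) t h s a f ≤ lam * ((m - d) * n) :=
    mul_le_mul_of_nonneg_left h2.le hlam0.le
  have h4 : lam * d * n = 2 * x := by
    rw [hlam, div_mul_eq_mul_div, ← sq, hd2]
    field_simp
  have h5 : lam ^ 2 * v * n = 2 * x := by
    rw [hlam, div_pow, hd2]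
    field_simp
  linarith

theorem IsRun.measureReal_upper_le (hrun : IsRun μ M β V δ st pol) {h : ℕ} (hh : h < M.H)
    (s : S) (a : A) {f : S → ℝ} {B : ℝ} (hB : 0 < B) (hf : ∀ y, 0 ≤ f y) (hfB : ∀ y, f y ≤ B)
    {n : ℕ} (hn : 0 < n) (t : ℕ) {x : ℝ} (hx : 0 < x) :
    μ.real {ω | visits (st ω) (actions (st ω) (pol ω)) t h s a = n ∧
      2 * Real.sqrt (x * (∑ y, M.P s a y * f y ^ 2) / n) + B * x / n <
        ∑ y, empP (st ω) (actions (st ω) (pol ω)) t h s a y * f y -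
          ∑ y, M.P s a y * f y} ≤ Real.exp (-x) := by
  have hn' : (0 : ℝ) < n := by exact_mod_cast hn
  set v := ∑ y, M.P s a y * f y ^ 2 with hv
  set m := ∑ y, M.P s a y * f y with hm
  have hv0 : 0 ≤ v := M.expect_nonneg s a fun y => sq_nonneg _
  set q := Real.sqrt (x * v / n) with hq
  have hq2 : q ^ 2 = x * v / n := Real.sq_sqrt (by positivity)
  have hq0 : 0 ≤ q := Real.sqrt_nonneg _
  have hq3 : n * q ^ 2 = x * v := by rw [hq2]; field_simp
  -- The exponent: `1 / B` when the second moment is small, its unconstrained optimum otherwise.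
  obtain ⟨lam, hlam0, hlamB, hlam⟩ : ∃ lam : ℝ, 0 ≤ lam ∧ lam * B ≤ 1 ∧
      x ≤ lam * (n * (2 * q) + B * x) - n * (lam ^ 2 * v) := by
    rcases le_or_gt (n * v) (x * B ^ 2) with hcase | hcase
    · refine ⟨1 / B, by positivity, by field_simp; rfl, ?_⟩
      have h1 : v ≤ 2 * q * B := by
        have h2 : v ≤ q * B := by
          refine abs_le_of_sq_le_sq' ?_ (by positivity) |>.2
          rw [mul_pow, hq2, div_mul_eq_mul_div, le_div_iff₀ hn']
          nlinarith
        nlinarith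
      have h3 : 1 / B * (n * (2 * q) + B * x) - n * ((1 / B) ^ 2 * v) =
          x + n * (2 * q * B - v) / B ^ 2 := by field_simp; ring
      rw [h3]
      have : 0 ≤ n * (2 * q * B - v) / B ^ 2 := by
        have := sub_nonneg.2 h1
        positivity
      linarith
    · have hv1 : 0 < v := by
        by_contra hcon
        have : v = 0 := le_antisymm (not_lt.1 hcon) hv0
        rw [this] at hcase
        have : 0 < x * B ^ 2 := by positivity
        linarith
      have hq1 : 0 < q := Real.sqrt_pos.2 (by positivity)
      refine ⟨x / (n * q), by positivity, ?_, ?_⟩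
      · rw [div_mul_eq_mul_div, div_le_one (by positivity)]
        refine abs_le_of_sq_le_sq' ?_ (by positivity) |>.2
        rw [mul_pow, mul_pow, hq2]
        have : (n : ℝ) ^ 2 * (x * v / n) = x * (n * v) := by field_simp
        rw [this]
        nlinarith
      · have h1 : n * ((x / (n * q)) ^ 2 * v) = x := by
          rw [div_pow, mul_pow, hq2]
          field_simp
        have h2 : x / (n * q) * (n * (2 * q) + B * x) = 2 * x + x / (n * q) * (B * x) := by
          field_simp
        rw [h1, h2]
        have : 0 ≤ x / (n * q) * (B * x) := by positivity
        linarith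
  have hg : ∑ y, M.P s a y * Real.exp (lam * f y + (-(lam * m) - lam ^ 2 * v)) ≤ 1 := by
    simp_rw [Real.exp_add, ← mul_assoc]
    rw [← Finset.sum_mul]
    have h1 : ∑ y, M.P s a y * Real.exp (lam * f y) ≤ 1 + lam * m + lam ^ 2 * v := by
      calc _ ≤ ∑ y, M.P s a y * (1 + lam * f y + (lam * f y) ^ 2) := by
            refine M.expect_mono s a fun y _ => ?_
            exact exp_le_quadratic (mul_nonneg hlam0 (hf y))
              ((mul_le_mul_of_nonneg_left (hfB y) hlam0).trans hlamB)
        _ = ∑ y, (M.P s a y + lam * (M.P s a y * f y) + lam ^ 2 * (M.P s a y * f y ^ 2)) :=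
            Finset.sum_congr rfl fun y _ => by ring
        _ = _ := by
            rw [Finset.sum_add_distrib, Finset.sum_add_distrib, ← Finset.mul_sum,
              ← Finset.mul_sum, M.P_sum]
    have h2 := Real.add_one_le_exp (lam * m + lam ^ 2 * v)
    calc _ ≤ Real.exp (lam * m + lam ^ 2 * v) * Real.exp (-(lam * m) - lam ^ 2 * v) := by
          gcongr; linarith
      _ = 1 := by
          rw [← Real.exp_add, show lam * m + lam ^ 2 * v + (-(lam * m) - lam ^ 2 * v) = 0 by ring,
            Real.exp_zero]
  refine le_trans (measureReal_mono ?_) (hrun.measureReal_visitSum_ge_le hh s a hg t x)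
  rintro ω ⟨h1, h2⟩
  simp only [Set.mem_ofPred_eq]
  rw [visitSum_affine, h1]
  rw [sum_empP_mul, h1, lt_sub_iff_add_lt, lt_div_iff₀ hn'] at h2
  have h3 := mul_le_mul_of_nonneg_left h2.le hlam0
  have h4 : (2 * q + B * x / n + m) * n = n * (2 * q) + B * x + m * n := by
    field_simp
  rw [h4] at h3
  linarith

/-- The union over the possible numbers of visits. -/
theorem IsRun.measureReal_not_concentrated_le (hrun : IsRun μ M β V δ st pol) {h : ℕ}
    (hh : h < M.H) (s : S) (a : A) {f : S → ℝ} {B : ℝ} (hB : 0 < B) (hf : ∀ y, 0 ≤ f y)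
    (hfB : ∀ y, f y ≤ B) {t : ℕ} (ht : 1 ≤ t) {x : ℝ} (hx : 0 < x) :
    μ.real {ω | ¬ M.Concentrated (st ω) (actions (st ω) (pol ω)) t h s a x B f} ≤
      2 * t * Real.exp (-x) := by
  set lo : ℕ → Set Ω := fun n => {ω | visits (st ω) (actions (st ω) (pol ω)) t h s a = n ∧
      Real.sqrt (2 * x * (∑ y, M.P s a y * f y ^ 2) / n) < ∑ y, M.P s a y * f y -
        ∑ y, empP (st ω) (actions (st ω) (pol ω)) t h s a y * f y} with hlo
  set up : ℕ → Set Ω := fun n => {ω | visits (st ω) (actions (st ω) (pol ω)) t h s a = n ∧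
      2 * Real.sqrt (x * (∑ y, M.P s a y * f y ^ 2) / n) + B * x / n <
        ∑ y, empP (st ω) (actions (st ω) (pol ω)) t h s a y * f y -
          ∑ y, M.P s a y * f y} with hup
  have hsub : {ω | ¬ M.Concentrated (st ω) (actions (st ω) (pol ω)) t h s a x B f} ⊆
      ⋃ n ∈ Finset.Ico 1 t, (lo n ∪ up n) := by
    intro ω hω
    simp only [Concentrated, Set.mem_ofPred_eq, Classical.not_imp, not_and_or, not_le] at hω
    obtain ⟨h1, h2⟩ := hω
    refine Set.mem_biUnion (x := visits (st ω) (actions (st ω) (pol ω)) t h s a) ?_ ?_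
    · exact Finset.coe_Ico 1 t ▸ Finset.mem_coe.2 (Finset.mem_Ico.2 ⟨h1, visits_lt _ _ ht _ _ _⟩)
    · rcases h2 with h2 | h2
      · exact Or.inl ⟨rfl, h2⟩
      · exact Or.inr ⟨rfl, h2⟩
  calc _ ≤ μ.real (⋃ n ∈ Finset.Ico 1 t, (lo n ∪ up n)) := measureReal_mono hsub (measure_ne_top _ _)
    _ ≤ ∑ n ∈ Finset.Ico 1 t, μ.real (lo n ∪ up n) := measureReal_biUnion_finset_le _ _
    _ ≤ ∑ n ∈ Finset.Ico 1 t, 2 * Real.exp (-x) := by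
        refine Finset.sum_le_sum fun n hn => ?_
        have hn1 : 0 < n := (Finset.mem_Ico.1 hn).1
        have h1 := hrun.measureReal_lower_le hh s a hf hn1 t hx
        have h2 := hrun.measureReal_upper_le hh s a hB hf hfB hn1 t hx
        have h3 := measureReal_union_le (μ := μ) (lo n) (up n)
        simp only [hlo, hup] at h3 ⊢
        linarith
    _ ≤ 2 * t * Real.exp (-x) := by
        rw [Finset.sum_const, Nat.card_Ico, nsmul_eq_mul]
        have h1 : ((t - 1 : ℕ) : ℝ) ≤ t := by exact_mod_cast Nat.sub_le t 1
        have h2 := Real.exp_pos (-x)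
        nlinarith

end

section

variable {S A : Type*}

/-! ### Costs along stopped trajectories -/

open Classical in
/-- The total cost of a trajectory `x`, `a` over the `n` steps from step `h` on, each step being
weighted by an additional factor `ρ`; the trajectory is stopped when it has traversed a pair of
`D`. -/
def stoppedSum (D : Set (S × A)) (ρ : ℝ) (c : ℕ → S → A → ℝ) (x : ℕ → S) (a : ℕ → A) :
    ℕ → ℕ → ℝ
  | 0, _ => 0
  | n + 1, h => c h (x h) (a h) +
      if (x h, a h) ∈ D then 0 else ρ * stoppedSum D ρ c x a n (h + 1)

open Classical in
/-- The expectation of `stoppedSum` under the policy `π`, started in `s` at step `h`. -/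
def stoppedValue [Fintype S] (M : EpisodicMDP S A) (D : Set (S × A)) (ρ : ℝ) (c : ℕ → S → A → ℝ)
    (π : ℕ → S → A) : ℕ → ℕ → S → ℝ
  | 0, _, _ => 0
  | n + 1, h, s => c h s (π h s) +
      if (s, π h s) ∈ D then 0 else ρ * ∑ y, M.P s (π h s) y * stoppedValue M D ρ c π n (h + 1) y

theorem stoppedSum_nonneg {D : Set (S × A)} {ρ : ℝ} (hρ : 0 ≤ ρ) {c : ℕ → S → A → ℝ}
    (hc : ∀ h s a, 0 ≤ c h s a) (x : ℕ → S) (a : ℕ → A) (n h : ℕ) :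
    0 ≤ stoppedSum D ρ c x a n h := by
  induction n generalizing h with
  | zero => exact le_rfl
  | succ n ih =>
    rw [stoppedSum]
    have h1 := hc h (x h) (a h)
    have h2 := mul_nonneg hρ (ih (h + 1))
    split_ifs <;> linarith

theorem stoppedSum_le {D : Set (S × A)} {ρ : ℝ} (hρ : 1 ≤ ρ) {c : ℕ → S → A → ℝ} {B : ℝ}
    (hB : 0 ≤ B) (hcB : ∀ h s a, c h s a ≤ B) (x : ℕ → S) (a : ℕ → A) (n h : ℕ) :
    stoppedSum D ρ c x a n h ≤ ρ ^ n * (n * B) := by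
  induction n generalizing h with
  | zero => simp [stoppedSum]
  | succ n ih =>
    rw [stoppedSum]
    have h1 := hcB h (x h) (a h)
    have h2 : ρ * stoppedSum D ρ c x a n (h + 1) ≤ ρ ^ (n + 1) * (n * B) := by
      rw [pow_succ', mul_assoc]
      exact mul_le_mul_of_nonneg_left (ih (h + 1)) (by linarith)
    have h3 : 1 ≤ ρ ^ (n + 1) := one_le_pow₀ hρ
    have h4 : B ≤ ρ ^ (n + 1) * B := le_mul_of_one_le_left hB h3
    have h5 : 0 ≤ ρ ^ (n + 1) * (n * B) := by positivity
    push_cast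
    split_ifs <;> nlinarith

theorem one_add_inv_pow_le (H : ℕ) : (1 + 1 / (H : ℝ)) ^ H ≤ 3 := by
  rcases Nat.eq_zero_or_pos H with rfl | hH
  · norm_num
  have hH' : (0 : ℝ) < H := by exact_mod_cast hH
  calc (1 + 1 / (H : ℝ)) ^ H ≤ Real.exp (1 / H) ^ H := by
        gcongr
        linarith [Real.add_one_le_exp (1 / (H : ℝ))]
    _ = Real.exp 1 := by
        rw [← Real.exp_nat_mul]
        congr 1
        field_simp
    _ ≤ 3 := by linarith [Real.exp_one_lt_d9]

section

variable [Fintype S] {Ω : Type*} {M : EpisodicMDP S A} {st : Ω → ℕ → ℕ → S}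
  {pol : Ω → ℕ → ℕ → S → A}

theorem histDet_stoppedValue {t : ℕ} (ht : 1 ≤ t) (D : Set (S × A)) (ρ : ℝ)
    {c : Ω → ℕ → S → A → ℝ} (hc : ∀ k < M.H, M.HistDet st pol t 0 fun ω => c ω k) (n h : ℕ)
    (hn : h + n ≤ M.H) :
    M.HistDet st pol t 0 fun ω => M.stoppedValue D ρ (c ω) (pol ω t) n h := by
  induction n generalizing h with
  | zero => exact fun _ _ _ => rfl
  | succ n ih =>
    intro ω ω' hω
    have h1 := hc h (by omega) ω ω' hω
    have h2 := histDet_pol (h := 0) ht (by omega : h < M.H) ω ω' hω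
    have h3 := ih (h + 1) (by omega) ω ω' hω
    simp only at h1 h2 h3
    funext s
    simp only [stoppedValue]
    rw [h1, h2, h3]

theorem histDet_stoppedSum {t : ℕ} (ht : 1 ≤ t) (D : Set (S × A)) (ρ : ℝ)
    {c : Ω → ℕ → S → A → ℝ} (hc : ∀ k < M.H, M.HistDet st pol t 0 fun ω => c ω k) (n h : ℕ)
    (hn : h + n ≤ M.H) :
    M.HistDet st pol t M.H fun ω =>
      stoppedSum D ρ (c ω) (st ω t) (actions (st ω) (pol ω) t) n h := by
  induction n generalizing h with
  | zero => exact fun _ _ _ => rfl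
  | succ n ih =>
    intro ω ω' hω
    have h1 := (hc h (by omega)).mono (Nat.zero_le _) ω ω' hω
    have h2 := histDet_ac ht (by omega : h < M.H) (by omega) ω ω' hω
    have h3 := ih (h + 1) (by omega) ω ω' hω
    have h4 : st ω' t h = st ω t h := hω.2.2 h (by omega)
    simp only at h1 h2 h3
    simp only [stoppedSum]
    rw [h1, h2, h3, h4]

variable [Fintype A] [MeasurableSpace Ω] {μ : Measure Ω} [IsProbabilityMeasure μ]
  {β : ℝ} {V : ℕ → S → ℝ} {δ : ℝ}

theorem IsRun.integral_mul_stoppedSum (hrun : IsRun μ M β V δ st pol) {t : ℕ} (ht : 1 ≤ t)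
    (D : Set (S × A)) (ρ : ℝ) {c : Ω → ℕ → S → A → ℝ}
    (hc : ∀ k < M.H, M.HistDet st pol t 0 fun ω => c ω k) (n h : ℕ) (hn : h + n ≤ M.H)
    {Z : Ω → ℝ} (hZ : M.HistDet st pol t h Z) :
    ∫ ω, Z ω * stoppedSum D ρ (c ω) (st ω t) (actions (st ω) (pol ω) t) n h ∂μ =
      ∫ ω, Z ω * M.stoppedValue D ρ (c ω) (pol ω t) n h (st ω t h) ∂μ := by
  classical
  induction n generalizing h Z with
  | zero => simp [stoppedSum, stoppedValue]
  | succ n ih =>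
    have hh : h < M.H := by omega
    have hac : M.HistDet st pol t h fun ω => (st ω t h, actions (st ω) (pol ω) t h) :=
      (histDet_st le_rfl).comp₂ (histDet_ac ht hh le_rfl) Prod.mk
    set f : S × A → ℝ := fun p => if p ∈ D then 0 else ρ with hf
    set Z' : Ω → ℝ := fun ω => Z ω * f (st ω t h, actions (st ω) (pol ω) t h) with hZ'
    have hZ'd : M.HistDet st pol t h Z' := hZ.comp₂ (hac.comp f) (· * ·)
    have hI1 : Integrable (fun ω => Z ω * c ω h (st ω t h) (actions (st ω) (pol ω) t h)) μ :=
      hrun.integrable (hZ.comp₂ (((hc h hh).mono (Nat.zero_le _)).comp₂ hac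
        fun u p => u p.1 p.2) (· * ·))
    have hW := histDet_stoppedValue ht D ρ hc n (h + 1) (by omega)
    have hI2 : Integrable (fun ω => Z' ω *
        stoppedSum D ρ (c ω) (st ω t) (actions (st ω) (pol ω) t) n (h + 1)) μ :=
      hrun.integrable ((hZ'd.mono hh.le).comp₂
        (histDet_stoppedSum ht D ρ hc n (h + 1) (by omega)) (· * ·))
    have hI3 : Integrable (fun ω => ∑ y, M.P (st ω t h) (pol ω t h (st ω t h)) y *
        (Z' ω * M.stoppedValue D ρ (c ω) (pol ω t) n (h + 1) y)) μ :=
      hrun.integrable ((hac.comp fun p => M.P p.1 p.2).comp₂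
        (hZ'd.comp₂ (hW.mono (Nat.zero_le h)) fun z w => (z, w))
        fun p w => ∑ y, p y * (w.1 * w.2 y))
    have hnext := hrun.integral_next ht hh
      (g := fun ω y => Z' ω * M.stoppedValue D ρ (c ω) (pol ω t) n (h + 1) y)
      (hZ'd.comp₂ (hW.mono (Nat.zero_le h)) fun z w y => z * w y)
    have hIH := ih (h + 1) (by omega) (hZ'd.mono (Nat.le_succ h))
    calc _ = ∫ ω, (Z ω * c ω h (st ω t h) (actions (st ω) (pol ω) t h) + Z' ω *
          stoppedSum D ρ (c ω) (st ω t) (actions (st ω) (pol ω) t) n (h + 1)) ∂μ := by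
          refine integral_congr_ae (Filter.Eventually.of_forall fun ω => ?_)
          simp only [stoppedSum, hZ', hf]
          split_ifs <;> ring
      _ = ∫ ω, (Z ω * c ω h (st ω t h) (actions (st ω) (pol ω) t h) +
            ∑ y, M.P (st ω t h) (pol ω t h (st ω t h)) y *
              (Z' ω * M.stoppedValue D ρ (c ω) (pol ω t) n (h + 1) y)) ∂μ := by
          rw [integral_add hI1 hI2, integral_add hI1 hI3, hIH, hnext]
      _ = _ := by
          refine integral_congr_ae (Filter.Eventually.of_forall fun ω => ?_)
          simp only [stoppedValue, hZ', hf, actions]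
          simp_rw [mul_left_comm _ (Z ω * _)]
          rw [← Finset.mul_sum]
          split_ifs <;> ring

/-- Over the episodes, the realized costs are compared with their expectations by an exponential
supermartingale. Nonnegative bounded costs lose only a constant factor. -/
theorem IsRun.integral_exp_stopped_le (hrun : IsRun μ M β V δ st pol)
    (D : Set (S × A)) (ρ : ℝ) {c : Ω → ℕ → ℕ → S → A → ℝ}
    (hc : ∀ t, 1 ≤ t → ∀ k < M.H, M.HistDet st pol t 0 fun ω => c ω t k) {K : ℝ} (hK : 0 < K)
    (h0 : ∀ ω t, 0 ≤ stoppedSum D ρ (c ω t) (st ω t) (actions (st ω) (pol ω) t) M.H 0)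
    (h1 : ∀ ω t, stoppedSum D ρ (c ω t) (st ω t) (actions (st ω) (pol ω) t) M.H 0 ≤ K) (T : ℕ) :
    ∫ ω, Real.exp (∑ t ∈ Finset.Icc 1 T,
      (M.stoppedValue D ρ (c ω t) (pol ω t) M.H 0 (st ω t 0) / 2 -
        stoppedSum D ρ (c ω t) (st ω t) (actions (st ω) (pol ω) t) M.H 0) / K) ∂μ ≤ 1 := by
  set U : Ω → ℕ → ℝ := fun ω t => M.stoppedValue D ρ (c ω t) (pol ω t) M.H 0 (st ω t 0) with hU
  set G : Ω → ℕ → ℝ := fun ω t =>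
    stoppedSum D ρ (c ω t) (st ω t) (actions (st ω) (pol ω) t) M.H 0 with hG
  have hUd : ∀ t, 1 ≤ t → M.HistDet st pol t 0 fun ω => U ω t := fun t ht =>
    (histDet_stoppedValue ht D ρ (hc t ht) M.H 0 (by omega)).comp₂ (histDet_st le_rfl)
      fun f s => f s
  have hGd : ∀ t, 1 ≤ t → M.HistDet st pol t M.H fun ω => G ω t := fun t ht =>
    histDet_stoppedSum ht D ρ (hc t ht) M.H 0 (by omega)
  have hYd : ∀ T, M.HistDet st pol (T + 1) 0 fun ω =>
      ∑ t ∈ Finset.Icc 1 T, (U ω t / 2 - G ω t) / K := by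
    intro T
    induction T with
    | zero => exact fun _ _ _ => by simp
    | succ T ih =>
      simp_rw [Finset.sum_Icc_succ_top (Nat.le_add_left 1 T)]
      exact (ih.succ (by omega) (Nat.zero_le _) 0).comp₂
        ((((hUd (T + 1) (by omega)).mono (Nat.zero_le _)).comp₂ (hGd (T + 1) (by omega))
          fun u g => (u / 2 - g) / K).succ (by omega) le_rfl 0) (· + ·)
  induction T with
  | zero => simp
  | succ T ih =>
    refine le_trans ?_ ih
    simp_rw [Finset.sum_Icc_succ_top (Nat.le_add_left 1 T), Real.exp_add]
    set Y : Ω → ℝ := fun ω => Real.exp (∑ t ∈ Finset.Icc 1 T, (U ω t / 2 - G ω t) / K) with hY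
    have hYd' : M.HistDet st pol (T + 1) 0 Y := (hYd T).comp Real.exp
    set Z : Ω → ℝ := fun ω => Y ω * Real.exp (U ω (T + 1) / 2 / K) with hZ
    have hZd : M.HistDet st pol (T + 1) 0 Z :=
      hYd'.comp₂ (hUd (T + 1) (by omega)) fun y u => y * Real.exp (u / 2 / K)
    have hZpos : ∀ ω, 0 < Z ω := fun ω => mul_pos (Real.exp_pos _) (Real.exp_pos _)
    have hIZG : Integrable (fun ω => Z ω * G ω (T + 1)) μ :=
      hrun.integrable ((hZd.mono (Nat.zero_le _)).comp₂ (hGd (T + 1) (by omega)) (· * ·))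
    have hIZU : Integrable (fun ω => Z ω * U ω (T + 1)) μ :=
      hrun.integrable (hZd.comp₂ (hUd (T + 1) (by omega)) (· * ·))
    have hIZ : Integrable Z μ := hrun.integrable hZd
    calc ∫ ω, Y ω * Real.exp ((U ω (T + 1) / 2 - G ω (T + 1)) / K) ∂μ
        ≤ ∫ ω, (Z ω - 1 / (2 * K) * (Z ω * G ω (T + 1))) ∂μ := by
          refine integral_mono ?_ (hIZ.sub (hIZG.const_mul _)) fun ω => ?_
          · exact hrun.integrable ((hYd'.mono (Nat.zero_le M.H)).comp₂
              (((hUd (T + 1) (by omega)).mono (Nat.zero_le _)).comp₂ (hGd (T + 1) (by omega))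
                fun u g => (u / 2 - g) / K) fun y z => y * Real.exp z)
          · have hx0 : 0 ≤ G ω (T + 1) / K := div_nonneg (h0 ω _) hK.le
            have hx1 : G ω (T + 1) / K ≤ 1 := (div_le_one hK).2 (h1 ω _)
            have hexp : Real.exp (-(G ω (T + 1) / K)) ≤ 1 - G ω (T + 1) / K / 2 := by
              have := exp_neg_le_quadratic hx0
              nlinarith
            simp only
            rw [show (U ω (T + 1) / 2 - G ω (T + 1)) / K =
              U ω (T + 1) / 2 / K + -(G ω (T + 1) / K) by ring, Real.exp_add, ← mul_assoc]
            refine (mul_le_mul_of_nonneg_left hexp (hZpos ω).le).trans_eq ?_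
            simp only [hZ]
            ring
      _ = ∫ ω, (Z ω - 1 / (2 * K) * (Z ω * U ω (T + 1))) ∂μ := by
          rw [integral_sub hIZ (hIZG.const_mul _), integral_sub hIZ (hIZU.const_mul _),
            integral_const_mul, integral_const_mul,
            hrun.integral_mul_stoppedSum (by omega) D ρ (hc (T + 1) (by omega)) M.H 0 (by omega)
              hZd]
      _ ≤ ∫ ω, Y ω ∂μ := by
          refine integral_mono (hIZ.sub (hIZU.const_mul _)) (hrun.integrable hYd') fun ω => ?_
          have hexp : 1 - U ω (T + 1) / 2 / K ≤ Real.exp (-(U ω (T + 1) / 2 / K)) := by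
            linarith [Real.add_one_le_exp (-(U ω (T + 1) / 2 / K))]
          have h2 := mul_le_mul_of_nonneg_left hexp (hZpos ω).le
          have h3 : Z ω * Real.exp (-(U ω (T + 1) / 2 / K)) = Y ω := by
            simp only [hZ]
            rw [mul_assoc, ← Real.exp_add, add_neg_cancel, Real.exp_zero, mul_one]
          rw [h3] at h2
          refine le_trans (le_of_eq ?_) h2
          simp only
          ring

theorem IsRun.measureReal_stopped_le (hrun : IsRun μ M β V δ st pol)
    (D : Set (S × A)) (ρ : ℝ) {c : Ω → ℕ → ℕ → S → A → ℝ}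
    (hc : ∀ t, 1 ≤ t → ∀ k < M.H, M.HistDet st pol t 0 fun ω => c ω t k) {K : ℝ} (hK : 0 < K)
    (h0 : ∀ ω t, 0 ≤ stoppedSum D ρ (c ω t) (st ω t) (actions (st ω) (pol ω) t) M.H 0)
    (h1 : ∀ ω t, stoppedSum D ρ (c ω t) (st ω t) (actions (st ω) (pol ω) t) M.H 0 ≤ K) (T : ℕ)
    (x : ℝ) :
    μ.real {ω | 2 * ∑ t ∈ Finset.Icc 1 T,
        stoppedSum D ρ (c ω t) (st ω t) (actions (st ω) (pol ω) t) M.H 0 + 2 * K * x <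
      ∑ t ∈ Finset.Icc 1 T, M.stoppedValue D ρ (c ω t) (pol ω t) M.H 0 (st ω t 0)} ≤
      Real.exp (-x) := by
  have hint := hrun.integral_exp_stopped_le D ρ hc hK h0 h1 T
  set X : Ω → ℝ := fun ω => ∑ t ∈ Finset.Icc 1 T,
      (M.stoppedValue D ρ (c ω t) (pol ω t) M.H 0 (st ω t 0) / 2 -
        stoppedSum D ρ (c ω t) (st ω t) (actions (st ω) (pol ω) t) M.H 0) / K with hX
  have hI : Integrable (fun ω => Real.exp (X ω)) μ := by
    refine hrun.integrable (t := T + 1) (h := 0) ?_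
    intro ω ω' hω
    simp only [hX]
    refine congrArg Real.exp (Finset.sum_congr rfl fun t ht => ?_)
    obtain ⟨ht1, ht2⟩ := Finset.mem_Icc.1 ht
    have hω' : ω' ∈ M.history st pol t M.H (st ω) (pol ω) :=
      ⟨fun i hi hit => hω.1 i hi (by omega), fun i hi hit => hω.2.1 i hi (by omega),
        fun k hk => hω.1 t ht1 (by omega) k hk⟩
    have e1 := (histDet_stoppedValue ht1 D ρ (hc t ht1) M.H 0 (by omega)).mono
      (Nat.zero_le M.H) ω ω' hω'
    have e2 := histDet_stoppedSum ht1 D ρ (hc t ht1) M.H 0 (by omega) ω ω' hω'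
    simp only at e1 e2
    rw [e1, e2, hω'.2.2 0 (Nat.zero_le _)]
  have h2 := mul_meas_ge_le_integral_of_nonneg (μ := μ) (f := fun ω => Real.exp (X ω))
    (Filter.Eventually.of_forall fun ω => (Real.exp_pos _).le) hI (Real.exp x)
  simp only [Real.exp_le_exp] at h2
  have h3 : μ.real {ω | x ≤ X ω} ≤ Real.exp (-x) := by
    rw [Real.exp_neg, ← one_div, le_div_iff₀ (Real.exp_pos x), mul_comm]
    exact h2.trans hint
  refine le_trans (measureReal_mono ?_) h3
  intro ω hω
  simp only [Set.mem_ofPred_eq, hX] at hω ⊢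
  rw [← Finset.sum_div, Finset.sum_sub_distrib, ← Finset.sum_div, le_div_iff₀ hK]
  linarith

end

end

section

variable {S A : Type*} [Fintype S]

/-! ### Consequences of the shaping condition -/

/-- The standing assumption on the shaping function `V`: it bounds the optimal value up to the
factor `β`. -/
structure IsShaping (M : EpisodicMDP S A) (β : ℝ) (V : ℕ → S → ℝ) : Prop where
  one_le : 1 ≤ β
  optValue_le : ∀ h ≤ M.H, ∀ s, M.optValue h s ≤ β * V h s

theorem IsShaping.nonneg [Nonempty A] {M : EpisodicMDP S A} {β : ℝ} {V : ℕ → S → ℝ}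
    (hV : M.IsShaping β V) {h : ℕ} (hh : h ≤ M.H) (s : S) : 0 ≤ V h s := by
  have h1 := (M.optValue_nonneg h s).trans (hV.optValue_le h hh s)
  exact nonneg_of_mul_nonneg_right h1 (by linarith [hV.one_le])

theorem IsShaping.optValue_le_mul_shapeMax {M : EpisodicMDP S A} {β : ℝ} {V : ℕ → S → ℝ}
    (hV : M.IsShaping β V) {h : ℕ} (hh : h ≤ M.H) (s : S) :
    M.optValue h s ≤ β * M.shapeMax V :=
  (hV.optValue_le h hh s).trans
    (mul_le_mul_of_nonneg_left (M.le_shapeMax V hh s) (by linarith [hV.one_le]))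

/-- The logarithm in the bonus of episode `t`. -/
def confLog (S A : Type*) [Fintype S] [Fintype A] (δ : ℝ) (t : ℕ) : ℝ :=
  Real.log (2 * Fintype.card S * Fintype.card A * t / δ)

open Classical in
/-- The indicator function of a state. -/
def indic (y : S) : S → ℝ := fun z => if z = y then 1 else 0

/-- The event on which the regret bound is derived, for a fixed outcome: transitions have positive
probability, and the empirical means of the optimal value, of the shaping function, of its square
and of the indicators of the states are concentrated. -/
structure GoodEvent [Fintype A] (M : EpisodicMDP S A) (β : ℝ) (V : ℕ → S → ℝ) (δ : ℝ)
    (st : ℕ → ℕ → S) (pol : ℕ → ℕ → S → A) : Prop where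
  start : ∀ t, 1 ≤ t → st t 0 = M.s0
  greedy : ∀ t, 1 ≤ t → ∀ h < M.H, ∀ s a, M.Qhat β V δ st (actions st pol) t h s a ≤
    M.Qhat β V δ st (actions st pol) t h s (pol t h s)
  pos : ∀ t, 1 ≤ t → ∀ h < M.H, 0 < M.P (st t h) (actions st pol t h) (st t (h + 1))
  conc_opt : ∀ t, 1 ≤ t → ∀ h < M.H, ∀ s a, M.Concentrated st (actions st pol) t h s a
    (4 * confLog S A δ t) (β * M.shapeMax V) (M.optValue (h + 1))
  conc_shape : ∀ t, 1 ≤ t → ∀ h < M.H, ∀ s a, M.Concentrated st (actions st pol) t h s a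
    (4 * confLog S A δ t) (M.shapeMax V) (V (h + 1))
  conc_sq : ∀ t, 1 ≤ t → ∀ h < M.H, ∀ s a, M.Concentrated st (actions st pol) t h s a
    (4 * confLog S A δ t) (M.shapeMax V ^ 2) (fun y => V (h + 1) y ^ 2)
  conc_indic : ∀ t, 1 ≤ t → ∀ h < M.H, ∀ s a y, M.Concentrated st (actions st pol) t h s a
    (4 * confLog S A δ t) 1 (indic y)

section empirical

variable {st : ℕ → ℕ → S} {ac : ℕ → ℕ → A} {t h : ℕ} {s : S} {a : A}

omit [Fintype S] in
theorem empP_nonneg (y : S) : 0 ≤ empP st ac t h s a y := by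
  unfold empP
  positivity

theorem sum_empP_mul_le {f : S → ℝ} {c : ℝ} (hc : 0 ≤ c) (hf : ∀ y, f y ≤ c) :
    ∑ y, empP st ac t h s a y * f y ≤ c := by
  have h1 : ∑ y, empP st ac t h s a y * c ≤ c := by
    have h2 := visitSum_affine st ac t h s a (fun _ => 0) 0 c
    rw [sum_empP_mul (f := fun _ => c)]
    simp only [mul_zero, zero_add, zero_mul] at h2
    rw [h2]
    exact div_le_of_le_mul₀ (Nat.cast_nonneg _) hc (by rw [mul_comm])
  exact le_trans (Finset.sum_le_sum fun y _ =>
    mul_le_mul_of_nonneg_left (hf y) (empP_nonneg y)) h1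

theorem sum_empP_mul_nonneg {f : S → ℝ} (hf : ∀ y, 0 ≤ f y) :
    0 ≤ ∑ y, empP st ac t h s a y * f y :=
  Finset.sum_nonneg fun y _ => mul_nonneg (empP_nonneg y) (hf y)

end empirical

theorem sqrt_mul_le_half_add {a b : ℝ} (ha : 0 ≤ a) (hb : 0 ≤ b) :
    Real.sqrt (a * b) ≤ (a + b) / 2 := by
  refine Real.sqrt_le_iff.2 ⟨by positivity, ?_⟩
  nlinarith [sq_nonneg (a - b)]

/-- Concentration of a function bounded by `B`, with the second moment replaced by `B ^ 2`. -/
theorem Concentrated.upper_le {M : EpisodicMDP S A} {st : ℕ → ℕ → S} {ac : ℕ → ℕ → A} {t h : ℕ}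
    {s : S} {a : A} {l B : ℝ} {f : S → ℝ} (hc : M.Concentrated st ac t h s a (4 * l) B f)
    (hN : 0 < visits st ac t h s a) (hl : 0 ≤ l) (hf : ∀ y, 0 ≤ f y) (hfB : ∀ y, f y ≤ B)
    (hB : 0 ≤ B) :
    ∑ y, empP st ac t h s a y * f y - ∑ y, M.P s a y * f y ≤
      4 * B * Real.sqrt (l / visits st ac t h s a) + 4 * B * l / visits st ac t h s a := by
  refine (hc hN).2.trans ?_
  have h1 : ∑ y, M.P s a y * f y ^ 2 ≤ B ^ 2 :=
    M.expect_le s a fun y => pow_le_pow_left₀ (hf y) (hfB y) 2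
  have h2 : Real.sqrt (4 * l * (∑ y, M.P s a y * f y ^ 2) / visits st ac t h s a) ≤
      2 * B * Real.sqrt (l / visits st ac t h s a) := by
    rw [show 2 * B * Real.sqrt (l / visits st ac t h s a) =
      Real.sqrt ((2 * B) ^ 2 * (l / visits st ac t h s a)) by
        rw [Real.sqrt_mul (by positivity), Real.sqrt_sq (by positivity)]]
    refine Real.sqrt_le_sqrt ?_
    rw [← mul_div_assoc]
    refine div_le_div_of_nonneg_right ?_ (Nat.cast_nonneg _)
    nlinarith [mul_le_mul_of_nonneg_left h1 hl]
  have h3 : B * (4 * l) / (visits st ac t h s a : ℝ) = 4 * B * l / visits st ac t h s a := by ring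
  linarith

section

variable [Fintype A]

theorem confLog_nonneg [Nonempty S] [Nonempty A] {δ : ℝ} (hδ : 0 < δ) (hδ1 : δ < 1) {t : ℕ}
    (ht : 1 ≤ t) : 0 ≤ confLog S A δ t := by
  refine Real.log_nonneg ?_
  rw [le_div_iff₀ hδ, one_mul]
  have h1 : (1 : ℝ) ≤ Fintype.card S := by exact_mod_cast Fintype.card_pos
  have h2 : (1 : ℝ) ≤ Fintype.card A := by exact_mod_cast Fintype.card_pos
  have h3 : (1 : ℝ) ≤ t := by exact_mod_cast ht
  nlinarith [mul_le_mul h1 h2 zero_le_one (by linarith), mul_le_mul (mul_le_mul h1 h2 zero_le_one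
    (by linarith)) h3 zero_le_one (by nlinarith)]

variable {M : EpisodicMDP S A} {β : ℝ} {V : ℕ → S → ℝ} {δ : ℝ} {st : ℕ → ℕ → S}
  {pol : ℕ → ℕ → S → A}

/-! ### Optimism -/

theorem bonus_le {ac : ℕ → ℕ → A} [Nonempty A] (hV : M.IsShaping β V) (hδ : 0 < δ) (hδ1 : δ < 1)
    {t h : ℕ} (ht : 1 ≤ t) (hh : h < M.H) (s : S) (a : A) (hN : 0 < visits st ac t h s a) :
    M.bonus β V δ st ac t h s a ≤
      16 * (β * M.shapeMax V) * Real.sqrt (confLog S A δ t / visits st ac t h s a) +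
        12 * (β * M.shapeMax V) * confLog S A δ t / visits st ac t h s a := by
  have : Nonempty S := ⟨M.s0⟩
  have hl := confLog_nonneg (S := S) (A := A) hδ hδ1 ht
  have hβ := hV.one_le
  have hm : 0 ≤ M.shapeMax V := (hV.nonneg (Nat.zero_le _) M.s0).trans
    (M.le_shapeMax V (Nat.zero_le _) M.s0)
  unfold bonus
  rw [if_neg hN.ne']
  refine (min_le_left _ _).trans ?_
  change 16 * β * Real.sqrt ((∑ y, empP st ac t h s a y * V (h + 1) y ^ 2) * confLog S A δ t /
    visits st ac t h s a) + 12 * β * M.shapeMax V / visits st ac t h s a * confLog S A δ t ≤ _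
  have hE : ∑ y, empP st ac t h s a y * V (h + 1) y ^ 2 ≤ M.shapeMax V ^ 2 :=
    sum_empP_mul_le (by positivity) fun y =>
      pow_le_pow_left₀ (hV.nonneg hh y) (M.le_shapeMax V hh y) 2
  have h1 : Real.sqrt ((∑ y, empP st ac t h s a y * V (h + 1) y ^ 2) * confLog S A δ t /
      visits st ac t h s a) ≤
      M.shapeMax V * Real.sqrt (confLog S A δ t / visits st ac t h s a) := by
    rw [show M.shapeMax V * Real.sqrt (confLog S A δ t / visits st ac t h s a) =
      Real.sqrt (M.shapeMax V ^ 2 * (confLog S A δ t / visits st ac t h s a)) by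
        rw [Real.sqrt_mul (by positivity), Real.sqrt_sq hm], ← mul_div_assoc]
    gcongr
  have h2 := mul_le_mul_of_nonneg_left h1 (by positivity : 0 ≤ 16 * β)
  refine (add_le_add_left h2 _).trans (le_of_eq ?_)
  ring

/-- The bonus dominates the lower deviation of the empirical mean of the optimal value. The
unknown second moment of `V` is replaced by the empirical one, at the cost of a factor `2` and a
term of lower order. -/
theorem GoodEvent.deviation_le_bonus [Nonempty A] (hg : M.GoodEvent β V δ st pol)
    (hV : M.IsShaping β V) (hδ : 0 < δ) (hδ1 : δ < 1)
    {t h : ℕ} (ht : 1 ≤ t) (hh : h < M.H) (s : S) (a : A) :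
    ∑ y, M.P s a y * M.optValue (h + 1) y -
      ∑ y, empP st (actions st pol) t h s a y * M.optValue (h + 1) y ≤
      M.bonus β V δ st (actions st pol) t h s a := by
  have : Nonempty S := ⟨M.s0⟩
  set ac := actions st pol with hac
  have hl := confLog_nonneg (S := S) (A := A) hδ hδ1 ht
  have hβ := hV.one_le
  have hm : 0 ≤ M.shapeMax V := (hV.nonneg (Nat.zero_le _) M.s0).trans
    (M.le_shapeMax V (Nat.zero_le _) M.s0)
  have hcap : ∑ y, M.P s a y * M.optValue (h + 1) y -
      ∑ y, empP st ac t h s a y * M.optValue (h + 1) y ≤ 2 * β * M.shapeMax V := by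
    have h1 := M.expect_le s a fun y => hV.optValue_le_mul_shapeMax hh y
    have h2 := sum_empP_mul_nonneg (st := st) (ac := ac) (t := t) (h := h) (s := s) (a := a)
      fun y => M.optValue_nonneg (h + 1) y
    have h3 : 0 ≤ β * M.shapeMax V := by positivity
    linarith
  unfold bonus
  split_ifs with hN
  · exact hcap
  refine le_min ?_ hcap
  change _ ≤ 16 * β * Real.sqrt ((∑ y, empP st ac t h s a y * V (h + 1) y ^ 2) *
    confLog S A δ t / visits st ac t h s a) +
      12 * β * M.shapeMax V / visits st ac t h s a * confLog S A δ t
  have hN' : 0 < visits st ac t h s a := Nat.pos_of_ne_zero hN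
  have hn : (0 : ℝ) < visits st ac t h s a := by exact_mod_cast hN'
  have e1 := (hg.conc_sq t ht h hh s a hN').1
  have e2 := (hg.conc_opt t ht h hh s a hN').1
  set n : ℝ := (visits st ac t h s a : ℝ) with hndef
  set l := confLog S A δ t with hldef
  set E := ∑ y, empP st ac t h s a y * V (h + 1) y ^ 2 with hE
  set m2 := ∑ y, M.P s a y * V (h + 1) y ^ 2 with hm2
  set Vm := M.shapeMax V with hVm
  have hE0 : 0 ≤ E := sum_empP_mul_nonneg fun y => sq_nonneg _
  have hm20 : 0 ≤ m2 := M.expect_nonneg s a fun y => sq_nonneg _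
  have h4 : ∑ y, M.P s a y * (V (h + 1) y ^ 2) ^ 2 ≤ Vm ^ 2 * m2 := by
    rw [hm2, Finset.mul_sum]
    refine Finset.sum_le_sum fun y _ => ?_
    have h5 : V (h + 1) y ^ 2 ≤ Vm ^ 2 :=
      pow_le_pow_left₀ (hV.nonneg hh y) (M.le_shapeMax V hh y) 2
    have h6 := mul_le_mul_of_nonneg_right h5
      (mul_nonneg (M.P_nonneg s a y) (sq_nonneg (V (h + 1) y)))
    calc _ = V (h + 1) y ^ 2 * (M.P s a y * V (h + 1) y ^ 2) := by ring
      _ ≤ _ := h6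
  have h7 : m2 ≤ 2 * E + 8 * Vm ^ 2 * l / n := by
    have h8 : Real.sqrt (2 * (4 * l) * (∑ y, M.P s a y * (V (h + 1) y ^ 2) ^ 2) / n) ≤
        (m2 + 8 * Vm ^ 2 * l / n) / 2 := by
      refine le_trans (Real.sqrt_le_sqrt ?_) (sqrt_mul_le_half_add hm20 (by positivity))
      rw [← mul_div_assoc]
      refine div_le_div_of_nonneg_right ?_ hn.le
      have h5 := mul_le_mul_of_nonneg_left h4 (by positivity : 0 ≤ 8 * l)
      linarith
    simp only at e1
    linarith
  have h9 : ∑ y, M.P s a y * M.optValue (h + 1) y ^ 2 ≤ β ^ 2 * m2 := by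
    rw [hm2, Finset.mul_sum]
    refine Finset.sum_le_sum fun y _ => ?_
    have h5 : M.optValue (h + 1) y ^ 2 ≤ (β * V (h + 1) y) ^ 2 :=
      pow_le_pow_left₀ (M.optValue_nonneg _ y) (hV.optValue_le _ hh y) 2
    calc _ ≤ M.P s a y * (β * V (h + 1) y) ^ 2 :=
          mul_le_mul_of_nonneg_left h5 (M.P_nonneg s a y)
      _ = _ := by ring
  have h10 : Real.sqrt (2 * (4 * l) * (∑ y, M.P s a y * M.optValue (h + 1) y ^ 2) / n) ≤
      4 * β * Real.sqrt (E * l / n) + 8 * β * Vm * l / n := by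
    refine Real.sqrt_le_iff.2 ⟨by positivity, ?_⟩
    have h11 : Real.sqrt (E * l / n) ^ 2 = E * l / n := Real.sq_sqrt (by positivity)
    have h12 : 2 * (4 * l) * (∑ y, M.P s a y * M.optValue (h + 1) y ^ 2) / n ≤
        2 * (4 * l) * (β ^ 2 * (2 * E + 8 * Vm ^ 2 * l / n)) / n := by
      gcongr
      exact h9.trans (mul_le_mul_of_nonneg_left h7 (by positivity))
    have h13 : 2 * (4 * l) * (β ^ 2 * (2 * E + 8 * Vm ^ 2 * l / n)) / n =
        16 * β ^ 2 * (E * l / n) + (8 * β * Vm * l / n) ^ 2 := by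
      field_simp
      ring
    have h14 : 0 ≤ 2 * (4 * β * Real.sqrt (E * l / n)) * (8 * β * Vm * l / n) := by positivity
    rw [h13, ← h11] at h12
    nlinarith
  have h15 : 12 * β * Vm / n * l = 12 * (β * Vm * l / n) := by ring
  have h16 : 8 * β * Vm * l / n = 8 * (β * Vm * l / n) := by ring
  have h17 : 0 ≤ β * Vm * l / n := by positivity
  have h18 : 0 ≤ β * Real.sqrt (E * l / n) := by positivity
  rw [h15]
  rw [h16] at h10
  linarith

theorem Vhat_of_le {ac : ℕ → ℕ → A} {t h : ℕ} (hh : M.H ≤ h) (s : S) :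
    M.Vhat β V δ st ac t h s = 0 := by
  simp [Vhat, Nat.sub_eq_zero_of_le hh, vAux]

theorem Vhat_eq {ac : ℕ → ℕ → A} {t h : ℕ} (hh : h < M.H) (s : S) :
    M.Vhat β V δ st ac t h s =
      min (⨆ a, M.Qhat β V δ st ac t h s a) (β * V h s) := by
  obtain ⟨n, hn⟩ : ∃ n, M.H = h + n + 1 := ⟨M.H - h - 1, by omega⟩
  have h1 : M.H - h = n + 1 := by omega
  have h2 : M.H - (h + 1) = n := by omega
  have h3 : M.H - (n + 1) = h := by omega
  unfold Qhat Vhat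
  rw [h1, h2, vAux, h3]

theorem GoodEvent.optValue_le_Vhat [Nonempty A] (hg : M.GoodEvent β V δ st pol)
    (hV : M.IsShaping β V) (hδ : 0 < δ) (hδ1 : δ < 1) {t : ℕ} (ht : 1 ≤ t) (h : ℕ) (s : S) :
    M.optValue h s ≤ M.Vhat β V δ st (actions st pol) t h s := by
  rcases le_or_gt M.H h with hh | hh
  · rw [M.optValue_of_le hh, Vhat_of_le hh]
  obtain ⟨n, hn⟩ : ∃ n, h + n = M.H := ⟨M.H - h, by omega⟩
  clear hh
  induction n generalizing h s with
  | zero => rw [M.optValue_of_le (by omega), Vhat_of_le (by omega)]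
  | succ n ih =>
    have hh : h < M.H := by omega
    rw [Vhat_eq hh]
    refine le_min ?_ (hV.optValue_le h hh.le s)
    obtain ⟨a, ha⟩ := M.exists_optValue_le hh s
    refine le_trans ?_ (le_ciSup (Set.finite_range _).bddAbove a)
    unfold Qhat qStep
    refine le_min ?_ (M.optValue_le h s)
    have h1 := hg.deviation_le_bonus hV hδ hδ1 ht hh s a
    have h2 : ∑ y, empP st (actions st pol) t h s a y * M.optValue (h + 1) y ≤
        ∑ y, empP st (actions st pol) t h s a y * M.Vhat β V δ st (actions st pol) t (h + 1) y :=
      Finset.sum_le_sum fun y _ =>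
        mul_le_mul_of_nonneg_left (ih (h + 1) y (by omega)) (empP_nonneg y)
    linarith

theorem Vhat_le_shape [Nonempty A] (hV : M.IsShaping β V) {ac : ℕ → ℕ → A} (t : ℕ) {h : ℕ}
    (hh : h ≤ M.H) (s : S) : M.Vhat β V δ st ac t h s ≤ β * V h s := by
  rcases hh.eq_or_lt with hh | hh
  · rw [Vhat_of_le hh.ge]
    exact mul_nonneg (by linarith [hV.one_le]) (hV.nonneg hh.le s)
  · rw [Vhat_eq hh]
    exact min_le_right _ _

theorem Vhat_le_mul_shapeMax [Nonempty A] (hV : M.IsShaping β V) {ac : ℕ → ℕ → A} (t : ℕ) {h : ℕ}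
    (hh : h ≤ M.H) (s : S) : M.Vhat β V δ st ac t h s ≤ β * M.shapeMax V :=
  (Vhat_le_shape hV t hh s).trans
    (mul_le_mul_of_nonneg_left (M.le_shapeMax V hh s) (by linarith [hV.one_le]))

theorem GoodEvent.Vhat_le_backup [Nonempty A] (hg : M.GoodEvent β V δ st pol) {t h : ℕ}
    (ht : 1 ≤ t) (hh : h < M.H) (s : S) :
    M.Vhat β V δ st (actions st pol) t h s ≤
      M.r s (pol t h s) + M.bonus β V δ st (actions st pol) t h s (pol t h s) +
        ∑ y, empP st (actions st pol) t h s (pol t h s) y *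
          M.Vhat β V δ st (actions st pol) t (h + 1) y := by
  rw [Vhat_eq hh]
  refine (min_le_left _ _).trans ((ciSup_le (hg.greedy t ht h hh s)).trans ?_)
  exact min_le_left _ _

/-! ### Recursion for the regret -/

theorem GoodEvent.empP_eq_zero (hg : M.GoodEvent β V δ st pol) {t h : ℕ} (hh : h < M.H)
    {s : S} {a : A} {y : S} (hy : M.P s a y = 0) : empP st (actions st pol) t h s a y = 0 := by
  classical
  have : visitsNext st (actions st pol) t h s a y = 0 := by
    unfold visitsNext
    rw [Finset.card_eq_zero, Finset.filter_eq_empty_iff]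
    rintro i hi ⟨h1, h2, h3⟩
    have := hg.pos i (Finset.mem_Ico.1 hi).1 h hh
    rw [h1, h2, h3, hy] at this
    exact lt_irrefl _ this
  simp [empP, this]

/-- The upper deviation of the empirical mean of a function `x` that depends on the data. It is
controlled through the deviations of the single transition probabilities: the square-root terms
are absorbed by the fraction `1 / H` of the true mean. -/
theorem GoodEvent.deviation_le [Nonempty A] (hg : M.GoodEvent β V δ st pol) (hδ : 0 < δ)
    (hδ1 : δ < 1) {t h : ℕ} (ht : 1 ≤ t) (hh : h < M.H) {s : S} {a : A}
    (hN : 0 < visits st (actions st pol) t h s a) {x : S → ℝ} {W n : ℝ} (hx0 : ∀ y, 0 ≤ x y)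
    (hxW : ∀ y, x y ≤ W) (hcard : ({y | 0 < M.P s a y}.ncard : ℝ) ≤ n) :
    ∑ y, empP st (actions st pol) t h s a y * x y - ∑ y, M.P s a y * x y ≤
      1 / M.H * ∑ y, M.P s a y * x y +
        8 * n * M.H * W * confLog S A δ t / visits st (actions st pol) t h s a := by
  classical
  have : Nonempty S := ⟨M.s0⟩
  have hl := confLog_nonneg (S := S) (A := A) hδ hδ1 ht
  have hn : (0 : ℝ) < visits st (actions st pol) t h s a := by exact_mod_cast hN
  have hW : 0 ≤ W := (hx0 M.s0).trans (hxW M.s0)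
  have hH : (1 : ℝ) ≤ M.H := by exact_mod_cast (by omega : 1 ≤ M.H)
  have hH0 : (0 : ℝ) < M.H := by linarith
  set N : ℝ := (visits st (actions st pol) t h s a : ℝ) with hNdef
  set l := confLog S A δ t with hldef
  set T : ℝ := 8 * M.H * W * l / N with hT
  have hT0 : 0 ≤ T := by positivity
  have key : ∀ y, empP st (actions st pol) t h s a y * x y - M.P s a y * x y ≤
      1 / M.H * (M.P s a y * x y) + if 0 < M.P s a y then T else 0 := by
    intro y
    split_ifs with hy
    · have h1 := (hg.conc_indic t ht h hh s a y hN).2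
      simp only [indic, ite_pow, one_pow, ne_eq, OfNat.ofNat_ne_zero, not_false_eq_true, zero_pow,
        mul_ite, mul_one, mul_zero, Finset.sum_ite_eq', Finset.mem_univ, if_true] at h1
      have h2 : Real.sqrt (4 * l * M.P s a y / N) ≤
          (M.P s a y / M.H + 4 * M.H * l / N) / 2 := by
        refine le_trans (Real.sqrt_le_sqrt (le_of_eq ?_))
          (sqrt_mul_le_half_add (by positivity) (by positivity))
        field_simp
      have h3 : empP st (actions st pol) t h s a y - M.P s a y ≤
          1 / M.H * M.P s a y + 8 * M.H * l / N := by
        have h4 : 4 * l / N ≤ 4 * M.H * l / N := by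
          gcongr
          linarith
        have h5 : 8 * M.H * l / N = 2 * (4 * M.H * l / N) := by ring
        have h6 : 1 / M.H * M.P s a y = M.P s a y / M.H := by ring
        have h7 : (1 : ℝ) * (4 * l) / N = 4 * l / N := by ring
        rw [← hNdef, ← hldef, h7] at h1
        linarith
      have h8 := mul_le_mul_of_nonneg_right h3 (hx0 y)
      have h9 : 8 * M.H * l / N * x y ≤ T := by
        rw [hT, show 8 * M.H * W * l / N = 8 * M.H * l / N * W by ring]
        exact mul_le_mul_of_nonneg_left (hxW y) (by positivity)
      linarith
    · have hy0 : M.P s a y = 0 := le_antisymm (not_lt.1 hy) (M.P_nonneg s a y)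
      rw [hg.empP_eq_zero hh hy0, hy0]
      simp
  calc _ = ∑ y, (empP st (actions st pol) t h s a y * x y - M.P s a y * x y) := by
        rw [Finset.sum_sub_distrib]
    _ ≤ ∑ y, (1 / M.H * (M.P s a y * x y) + if 0 < M.P s a y then T else 0) :=
        Finset.sum_le_sum fun y _ => key y
    _ = 1 / M.H * ∑ y, M.P s a y * x y + {y | 0 < M.P s a y}.ncard * T := by
        rw [Finset.sum_add_distrib, ← Finset.mul_sum, Finset.sum_ite, Finset.sum_const_zero,
          add_zero, Finset.sum_const, nsmul_eq_mul, Set.ncard_eq_toFinset_card']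
        congr 4
        ext y
        simp
    _ ≤ _ := by
        have h4 := mul_le_mul_of_nonneg_right hcard hT0
        have h5 : n * T = 8 * n * M.H * W * l / N := by rw [hT]; ring
        linarith

open Classical in
/-- The upper bound on what one step contributes to the regret: `B` for a pair of `D`, where the
trajectory is stopped, and otherwise the confidence width for `N h s a` visits, capped at `B`. The
parameter `e` is the coefficient of the term of order `1 / N`. -/
def stepCost (D : Set (S × A)) (B e l : ℝ) (N : ℕ → S → A → ℕ) (h : ℕ) (s : S) (a : A) : ℝ :=
  if (s, a) ∈ D ∨ N h s a = 0 then B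
  else min B (20 * B * Real.sqrt (l / N h s a) + 16 * e * l / N h s a)

omit [Fintype S] [Fintype A] in
theorem stepCost_nonneg {D : Set (S × A)} {B e l : ℝ} (hB : 0 ≤ B) (he : 0 ≤ e) (hl : 0 ≤ l)
    (N : ℕ → S → A → ℕ) (h : ℕ) (s : S) (a : A) : 0 ≤ stepCost D B e l N h s a := by
  unfold stepCost
  split_ifs
  · exact hB
  · exact le_min hB (by positivity)

omit [Fintype S] [Fintype A] in
theorem stepCost_le {D : Set (S × A)} {B e l : ℝ} (N : ℕ → S → A → ℕ) (h : ℕ) (s : S) (a : A) :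
    stepCost D B e l N h s a ≤ B := by
  unfold stepCost
  split_ifs
  · exact le_rfl
  · exact min_le_left _ _

/-- What an unstopped visited step adds to the difference between the empirical value function and
the value of the policy. Here `W` bounds the gap between the empirical value function and the
optimal value, and `n` the number of possible next states. -/
theorem GoodEvent.Vhat_sub_value_le [Nonempty A] (hg : M.GoodEvent β V δ st pol)
    (hV : M.IsShaping β V) (hδ : 0 < δ) (hδ1 : δ < 1) {t h : ℕ} (ht : 1 ≤ t) (hh : h < M.H)
    (s : S) (hN : 0 < visits st (actions st pol) t h s (pol t h s)) {W n : ℝ} (hW0 : 0 ≤ W)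
    (hn0 : 0 ≤ n) (hW : ∀ h < M.H, ∀ s, β * V h s - M.optValue h s ≤ W)
    (hn : h + 1 < M.H → ({y | 0 < M.P s (pol t h s) y}.ncard : ℝ) ≤ n) :
    M.Vhat β V δ st (actions st pol) t h s - M.value (pol t) h s ≤
      20 * (β * M.shapeMax V) *
          Real.sqrt (confLog S A δ t / visits st (actions st pol) t h s (pol t h s)) +
        16 * (β * M.shapeMax V + n * M.H * W) * confLog S A δ t /
          visits st (actions st pol) t h s (pol t h s) +
        (1 + 1 / M.H) * ∑ y, M.P s (pol t h s) y *
          (M.Vhat β V δ st (actions st pol) t (h + 1) y - M.value (pol t) (h + 1) y) := by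
  have : Nonempty S := ⟨M.s0⟩
  have hl := confLog_nonneg (S := S) (A := A) hδ hδ1 ht
  have hβ := hV.one_le
  have hm : 0 ≤ M.shapeMax V := (hV.nonneg (Nat.zero_le _) M.s0).trans
    (M.le_shapeMax V (Nat.zero_le _) M.s0)
  have hB : 0 ≤ β * M.shapeMax V := by positivity
  set a := pol t h s with ha
  have e1 := hg.Vhat_le_backup ht hh s
  have e2 := bonus_le hV hδ hδ1 ht hh s a hN
  have e3 := (hg.conc_opt t ht h hh s a).upper_le hN hl (fun y => M.optValue_nonneg _ y)
    (fun y => hV.optValue_le_mul_shapeMax hh y) hB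
  set x : S → ℝ := fun y =>
    M.Vhat β V δ st (actions st pol) t (h + 1) y - M.optValue (h + 1) y with hx
  have hx0 : ∀ y, 0 ≤ x y := fun y => sub_nonneg.2 (hg.optValue_le_Vhat hV hδ hδ1 ht (h + 1) y)
  have e4 : ∑ y, empP st (actions st pol) t h s a y * x y - ∑ y, M.P s a y * x y ≤
      1 / M.H * ∑ y, M.P s a y * x y + 8 * n * M.H * W * confLog S A δ t /
        visits st (actions st pol) t h s a := by
    rcases lt_or_ge (h + 1) M.H with hh1 | hh1
    · refine hg.deviation_le hδ hδ1 ht hh hN hx0 (fun y => ?_) (hn hh1)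
      have h1 := hW (h + 1) hh1 y
      have h2 := Vhat_le_shape (δ := δ) (st := st) (ac := actions st pol) hV t hh1.le y
      simp only [hx]
      linarith
    · have hx1 : ∀ y, x y = 0 := fun y => by
        simp only [hx]
        rw [Vhat_of_le hh1, M.optValue_of_le hh1, sub_zero]
      simp only [hx1, mul_zero, Finset.sum_const_zero, sub_zero, zero_add]
      positivity
  have e5 : ∑ y, M.P s a y * x y ≤ ∑ y, M.P s a y *
      (M.Vhat β V δ st (actions st pol) t (h + 1) y - M.value (pol t) (h + 1) y) :=
    M.expect_mono s a fun y _ => by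
      simp only [hx]
      linarith [M.value_le_optValue (pol t) (h + 1) y]
  have e6 : ∑ y, empP st (actions st pol) t h s a y * x y =
      ∑ y, empP st (actions st pol) t h s a y * M.Vhat β V δ st (actions st pol) t (h + 1) y -
      ∑ y, empP st (actions st pol) t h s a y * M.optValue (h + 1) y := by
    simp only [hx, mul_sub, Finset.sum_sub_distrib]
  have e7 : ∑ y, M.P s a y * x y =
      ∑ y, M.P s a y * M.Vhat β V δ st (actions st pol) t (h + 1) y -
      ∑ y, M.P s a y * M.optValue (h + 1) y := by
    simp only [hx, mul_sub, Finset.sum_sub_distrib]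
  have e8 : ∑ y, M.P s a y *
      (M.Vhat β V δ st (actions st pol) t (h + 1) y - M.value (pol t) (h + 1) y) =
      ∑ y, M.P s a y * M.Vhat β V δ st (actions st pol) t (h + 1) y -
      ∑ y, M.P s a y * M.value (pol t) (h + 1) y := by
    simp only [mul_sub, Finset.sum_sub_distrib]
  have e9 := mul_le_mul_of_nonneg_left e5 (by positivity : 0 ≤ 1 / (M.H : ℝ))
  rw [M.value_eq (pol t) hh, add_mul, one_mul]
  have e10 : 16 * (β * M.shapeMax V + n * M.H * W) * confLog S A δ t /
      visits st (actions st pol) t h s a =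
      12 * (β * M.shapeMax V) * confLog S A δ t / visits st (actions st pol) t h s a +
      4 * (β * M.shapeMax V) * confLog S A δ t / visits st (actions st pol) t h s a +
      2 * (8 * n * M.H * W * confLog S A δ t / visits st (actions st pol) t h s a) := by ring
  have e11 : 0 ≤ 8 * n * M.H * W * confLog S A δ t / visits st (actions st pol) t h s a := by
    positivity
  rw [← ha]
  rw [e10]
  linarith

/-- On the good event the regret of an episode is at most the expected cost of its trajectory,
stopped at the first pair of `D`. -/
theorem GoodEvent.Vhat_sub_value_le_stoppedValue [Nonempty A] (hg : M.GoodEvent β V δ st pol)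
    (hV : M.IsShaping β V) (hδ : 0 < δ) (hδ1 : δ < 1) {t : ℕ} (ht : 1 ≤ t) {D : Set (S × A)}
    {W n : ℝ} (hW0 : 0 ≤ W) (hW : ∀ h < M.H, ∀ s, β * V h s - M.optValue h s ≤ W)
    (hn : ∀ h < M.H, ((M.avoidReach D h).ncard : ℝ) ≤ n) (k h : ℕ) (hk : h + k = M.H) {s : S}
    (hs : s ∈ M.avoidReach D h) :
    M.Vhat β V δ st (actions st pol) t h s - M.value (pol t) h s ≤
      M.stoppedValue D (1 + 1 / M.H) (stepCost D (β * M.shapeMax V)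
        (β * M.shapeMax V + n * M.H * W) (confLog S A δ t) (visits st (actions st pol) t))
        (pol t) k h s := by
  induction k generalizing h s with
  | zero => rw [Vhat_of_le (by omega), M.value_of_le _ (by omega), stoppedValue, sub_zero]
  | succ k ih =>
    have hh : h < M.H := by omega
    have hn0 : 0 ≤ n := (Nat.cast_nonneg _).trans (hn h hh)
    have hρ : 0 ≤ 1 + 1 / (M.H : ℝ) := by positivity
    have hcap : M.Vhat β V δ st (actions st pol) t h s - M.value (pol t) h s ≤
        β * M.shapeMax V := by
      linarith [Vhat_le_mul_shapeMax (δ := δ) (st := st) (ac := actions st pol) hV t hh.le s,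
        M.value_nonneg (pol t) h s]
    rw [stoppedValue]
    by_cases hD : (s, pol t h s) ∈ D
    · rw [if_pos hD, add_zero, stepCost, if_pos (Or.inl hD)]
      exact hcap
    rw [if_neg hD]
    have hnext := M.expect_mono s (pol t h s) fun y hy =>
      ih (h + 1) (by omega) (M.avoidReach_succ hs hD hy)
    have hnext0 : 0 ≤ ∑ y, M.P s (pol t h s) y *
        (M.Vhat β V δ st (actions st pol) t (h + 1) y - M.value (pol t) (h + 1) y) :=
      M.expect_nonneg s _ fun y => by
        linarith [hg.optValue_le_Vhat hV hδ hδ1 ht (h + 1) y,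
          M.value_le_optValue (pol t) (h + 1) y]
    have hρnext := mul_le_mul_of_nonneg_left hnext hρ
    have hρnext0 := mul_nonneg hρ hnext0
    by_cases hN : visits st (actions st pol) t h s (pol t h s) = 0
    · rw [stepCost, if_pos (Or.inr hN)]
      linarith
    rw [stepCost, if_neg (by tauto)]
    have hstep := hg.Vhat_sub_value_le hV hδ hδ1 ht hh s (Nat.pos_of_ne_zero hN) hW0 hn0 hW
      fun hh1 => by
        refine le_trans ?_ (hn (h + 1) hh1)
        exact_mod_cast Set.ncard_le_ncard fun y hy => M.avoidReach_succ hs hD hy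
    rcases min_cases (β * M.shapeMax V) (20 * (β * M.shapeMax V) *
          Real.sqrt (confLog S A δ t / visits st (actions st pol) t h s (pol t h s)) +
        16 * (β * M.shapeMax V + n * M.H * W) * confLog S A δ t /
          visits st (actions st pol) t h s (pol t h s)) with hmin | hmin
    · rw [hmin.1]
      linarith
    · rw [hmin.1]
      linarith

/-! ### Visits of pseudo-suboptimal pairs -/

/-- A pair whose surrogate value falls short of the optimal value by `Δ` is chosen only as long as
its confidence width is at least `Δ`, hence a limited number of times. -/
theorem GoodEvent.visits_le_of_gap [Nonempty A] (hg : M.GoodEvent β V δ st pol)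
    (hV : M.IsShaping β V) (hδ : 0 < δ) (hδ1 : δ < 1) {t h : ℕ} (ht : 1 ≤ t) (hh : h < M.H)
    {s : S} {Δ : ℝ} (hΔ : 0 < Δ) (hgap : Δ + M.Qup β V h s (pol t h s) ≤ M.optValue h s) :
    (visits st (actions st pol) t h s (pol t h s) : ℝ) ≤
      1296 * (β * M.shapeMax V) ^ 2 * confLog S A δ t / Δ ^ 2 := by
  have : Nonempty S := ⟨M.s0⟩
  have hl := confLog_nonneg (S := S) (A := A) hδ hδ1 ht
  have hβ := hV.one_le
  have hm : 0 ≤ M.shapeMax V := (hV.nonneg (Nat.zero_le _) M.s0).trans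
    (M.le_shapeMax V (Nat.zero_le _) M.s0)
  have hB : 0 ≤ β * M.shapeMax V := by positivity
  rcases Nat.eq_zero_or_pos (visits st (actions st pol) t h s (pol t h s)) with hN | hN
  · rw [hN, Nat.cast_zero]
    positivity
  set a := pol t h s with ha
  have e1 := hg.Vhat_le_backup ht hh s
  have e2 := bonus_le hV hδ hδ1 ht hh s a hN
  have e3 := (hg.conc_shape t ht h hh s a).upper_le hN hl (fun y => hV.nonneg hh y)
    (fun y => M.le_shapeMax V hh y) hm
  have e4 := hg.optValue_le_Vhat hV hδ hδ1 ht h s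
  have e5 : ∑ y, empP st (actions st pol) t h s a y *
      M.Vhat β V δ st (actions st pol) t (h + 1) y ≤
      β * ∑ y, empP st (actions st pol) t h s a y * V (h + 1) y := by
    rw [Finset.mul_sum]
    refine Finset.sum_le_sum fun y _ => ?_
    rw [mul_left_comm]
    exact mul_le_mul_of_nonneg_left (Vhat_le_shape hV t hh y) (empP_nonneg y)
  have e6 := mul_le_mul_of_nonneg_left e3 (by linarith : 0 ≤ β)
  rw [Qup_eq] at hgap
  have hn : (0 : ℝ) < visits st (actions st pol) t h s a := by exact_mod_cast hN
  have e7 : Δ ≤ β * M.shapeMax V := by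
    have h1 := hV.optValue_le_mul_shapeMax hh.le s
    have h2 := M.r_nonneg s a
    have h3 : 0 ≤ β * ∑ y, M.P s a y * V (h + 1) y :=
      mul_nonneg (by linarith) (M.expect_nonneg s a fun y => hV.nonneg hh y)
    linarith
  set N : ℝ := (visits st (actions st pol) t h s a : ℝ) with hNdef
  set l := confLog S A δ t with hldef
  set B := β * M.shapeMax V with hBdef
  have e8 : Δ ≤ 20 * B * Real.sqrt (l / N) + 16 * B * (l / N) := by
    have h1 : β * (4 * M.shapeMax V * Real.sqrt (l / N) + 4 * M.shapeMax V * l / N) =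
        4 * B * Real.sqrt (l / N) + 4 * B * (l / N) := by rw [hBdef]; ring
    have h2 : 12 * B * l / N = 12 * B * (l / N) := by ring
    rw [h1] at e6
    rw [h2] at e2
    linarith
  have hy2 : Real.sqrt (l / N) ^ 2 = l / N := Real.sq_sqrt (by positivity)
  set y := Real.sqrt (l / N) with hy
  have hy0 : 0 ≤ y := Real.sqrt_nonneg _
  have e9 : Δ ^ 2 ≤ 1296 * B ^ 2 * y ^ 2 := by
    have h1 : Δ ≤ 36 * B * y := by
      rcases le_total y 1 with h1 | h1
      · have : B * y ^ 2 ≤ B * y := mul_le_mul_of_nonneg_left (by nlinarith) hB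
        rw [← hy2] at e8
        linarith
      · nlinarith
    calc Δ ^ 2 ≤ (36 * B * y) ^ 2 := pow_le_pow_left₀ hΔ.le h1 2
      _ = _ := by ring
  rw [le_div_iff₀ (by positivity)]
  rw [hy2, ← mul_div_assoc, le_div_iff₀ hn] at e9
  linarith

end

end

section

/-! ### Probability of the good event -/

theorem measure_iUnion_le_two_mul {Ω : Type*} [MeasurableSpace Ω] {μ : Measure Ω}
    [IsProbabilityMeasure μ] {δ : ℝ} (hδ : 0 < δ) {bad : ℕ → Set Ω}
    (hbad : ∀ t, 1 ≤ t → μ.real (bad t) ≤ δ / t ^ 2) :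
    μ (⋃ t, ⋃ _ : 1 ≤ t, bad t) ≤ ENNReal.ofReal (2 * δ) := by
  have hsum : HasSum (fun t : ℕ => δ / (t : ℝ) ^ 2) (δ * (Real.pi ^ 2 / 6)) := by
    simpa [div_eq_mul_inv] using hasSum_zeta_two.mul_left δ
  calc μ (⋃ t, ⋃ _ : 1 ≤ t, bad t) ≤ ∑' t, μ (⋃ _ : 1 ≤ t, bad t) := measure_iUnion_le _
    _ ≤ ∑' t : ℕ, ENNReal.ofReal (δ / (t : ℝ) ^ 2) := by
        refine ENNReal.tsum_le_tsum fun t => ?_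
        by_cases ht : 1 ≤ t
        · simp only [ht, Set.iUnion_true]
          rw [← ofReal_measureReal]
          exact ENNReal.ofReal_le_ofReal (hbad t ht)
        · simp [ht]
    _ = ENNReal.ofReal (δ * (Real.pi ^ 2 / 6)) := by
        rw [← ENNReal.ofReal_tsum_of_nonneg (fun t => by positivity) hsum.summable, hsum.tsum_eq]
    _ ≤ ENNReal.ofReal (2 * δ) := by
        refine ENNReal.ofReal_le_ofReal ?_
        have h1 : Real.pi ^ 2 ≤ 12 := by nlinarith [Real.pi_lt_d2, Real.pi_pos]
        nlinarith

theorem exp_neg_mul_confLog {S A : Type*} [Fintype S] [Fintype A] [Nonempty S] [Nonempty A] {δ : ℝ}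
    (hδ : 0 < δ) {t : ℕ} (ht : 1 ≤ t) (k : ℕ) :
    Real.exp (-(k * confLog S A δ t)) =
      (δ / (2 * Fintype.card S * Fintype.card A * t)) ^ k := by
  have h1 : (0 : ℝ) < Fintype.card S := by exact_mod_cast Fintype.card_pos
  have h2 : (0 : ℝ) < Fintype.card A := by exact_mod_cast Fintype.card_pos
  have h3 : (0 : ℝ) < t := by exact_mod_cast ht
  rw [Real.exp_neg, Real.exp_nat_mul, confLog, Real.exp_log (by positivity), ← inv_pow, inv_div]

variable {S A : Type*} [Fintype S] [Fintype A] {Ω : Type*} {M : EpisodicMDP S A}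
  {st : Ω → ℕ → ℕ → S} {pol : Ω → ℕ → ℕ → S → A} [MeasurableSpace Ω] {μ : Measure Ω}
  [IsProbabilityMeasure μ] {β : ℝ} {V : ℕ → S → ℝ} {δ : ℝ}

theorem IsRun.measure_not_goodEvent_le [Nonempty A] (hrun : IsRun μ M β V δ st pol)
    (hV : M.IsShaping β V) (hm : 0 < M.shapeMax V) (hHS : M.H ≤ Fintype.card S) (hδ : 0 < δ)
    (hδ1 : δ < 1) :
    μ {ω | ¬ M.GoodEvent β V δ (st ω) (pol ω)} ≤ ENNReal.ofReal (2 * δ) := by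
  classical
  have : Nonempty S := ⟨M.s0⟩
  have hβ := hV.one_le
  -- The failure of concentration for `(h,s,a)` in episode `t`.
  set one : ℕ → ℕ → S → A → ℝ → (S → ℝ) → Set Ω := fun t h s a B f =>
    {ω | ¬ M.Concentrated (st ω) (actions (st ω) (pol ω)) t h s a (4 * confLog S A δ t) B f}
    with hone
  set bad : ℕ → Set Ω := fun t => ⋃ k : Fin M.H × S × A,
    (one t k.1 k.2.1 k.2.2 (β * M.shapeMax V) (M.optValue (k.1 + 1)) ∪
      one t k.1 k.2.1 k.2.2 (M.shapeMax V) (V (k.1 + 1))) ∪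
    (one t k.1 k.2.1 k.2.2 (M.shapeMax V ^ 2) (fun y => V (k.1 + 1) y ^ 2) ∪
      ⋃ y, one t k.1 k.2.1 k.2.2 1 (indic y)) with hbaddef
  have hS : (1 : ℝ) ≤ Fintype.card S := by exact_mod_cast Fintype.card_pos
  have hA : (1 : ℝ) ≤ Fintype.card A := by exact_mod_cast Fintype.card_pos
  have hH : (M.H : ℝ) ≤ Fintype.card S := by exact_mod_cast hHS
  have hbad : ∀ t, 1 ≤ t → μ.real (bad t) ≤ δ / t ^ 2 := by
    intro t ht
    have ht' : (1 : ℝ) ≤ t := by exact_mod_cast ht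
    have hl : 0 < 4 * confLog S A δ t := by
      have : 0 < confLog S A δ t := by
        refine Real.log_pos ?_
        rw [lt_div_iff₀ hδ, one_mul]
        have h1 : 1 ≤ (Fintype.card S : ℝ) * Fintype.card A := by nlinarith
        have h2 : 1 ≤ (Fintype.card S : ℝ) * Fintype.card A * t := by nlinarith
        nlinarith
      linarith
    set p := 2 * t * Real.exp (-(4 * confLog S A δ t)) with hp
    have hp0 : 0 ≤ p := by positivity
    have h1 : ∀ (k : Fin M.H × S × A) (B : ℝ) (f : S → ℝ), 0 < B → (∀ y, 0 ≤ f y) →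
        (∀ y, f y ≤ B) → μ.real (one t k.1 k.2.1 k.2.2 B f) ≤ p := fun k B f hB hf hfB =>
      hrun.measureReal_not_concentrated_le k.1.2 k.2.1 k.2.2 hB hf hfB ht hl
    have h2 : ∀ k : Fin M.H × S × A, μ.real
        ((one t k.1 k.2.1 k.2.2 (β * M.shapeMax V) (M.optValue (k.1 + 1)) ∪
          one t k.1 k.2.1 k.2.2 (M.shapeMax V) (V (k.1 + 1))) ∪
        (one t k.1 k.2.1 k.2.2 (M.shapeMax V ^ 2) (fun y => V (k.1 + 1) y ^ 2) ∪
          ⋃ y, one t k.1 k.2.1 k.2.2 1 (indic y))) ≤ 4 * Fintype.card S * p := by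
      intro k
      have a1 := h1 k (β * M.shapeMax V) (M.optValue (k.1 + 1)) (by positivity)
        (fun y => M.optValue_nonneg _ y) (fun y => hV.optValue_le_mul_shapeMax k.1.2 y)
      have a2 := h1 k (M.shapeMax V) (V (k.1 + 1)) hm (fun y => hV.nonneg k.1.2 y)
        (fun y => M.le_shapeMax V k.1.2 y)
      have a3 := h1 k (M.shapeMax V ^ 2) (fun y => V (k.1 + 1) y ^ 2) (by positivity)
        (fun y => sq_nonneg _)
        (fun y => pow_le_pow_left₀ (hV.nonneg k.1.2 y) (M.le_shapeMax V k.1.2 y) 2)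
      have a4 : μ.real (⋃ y, one t k.1 k.2.1 k.2.2 1 (indic y)) ≤ Fintype.card S * p := by
        refine (measureReal_iUnion_fintype_le _).trans ?_
        refine (Finset.sum_le_sum fun y _ => h1 k 1 (indic y) one_pos
          (fun z => by unfold indic; split_ifs <;> norm_num)
          (fun z => by unfold indic; split_ifs <;> norm_num)).trans ?_
        simp
      have b1 := measureReal_union_le (μ := μ)
        (one t k.1 k.2.1 k.2.2 (β * M.shapeMax V) (M.optValue (k.1 + 1)))
        (one t k.1 k.2.1 k.2.2 (M.shapeMax V) (V (k.1 + 1)))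
      have b2 := measureReal_union_le (μ := μ)
        (one t k.1 k.2.1 k.2.2 (M.shapeMax V ^ 2) (fun y => V (k.1 + 1) y ^ 2))
        (⋃ y, one t k.1 k.2.1 k.2.2 1 (indic y))
      refine (measureReal_union_le _ _).trans ?_
      nlinarith
    calc μ.real (bad t) ≤ ∑ _k : Fin M.H × S × A, 4 * Fintype.card S * p :=
          (measureReal_iUnion_fintype_le _).trans (Finset.sum_le_sum fun k _ => h2 k)
      _ = M.H * Fintype.card S * Fintype.card A * (4 * Fintype.card S * p) := by
          simp only [Finset.sum_const, Finset.card_univ, Fintype.card_prod, Fintype.card_fin,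
            nsmul_eq_mul, Nat.cast_mul]
          ring
      _ ≤ Fintype.card S * Fintype.card S * Fintype.card A * (4 * Fintype.card S * p) := by
          gcongr
      _ = δ / t ^ 2 * (δ ^ 3 * (1 / (2 * Fintype.card S * Fintype.card A ^ 3 * t))) := by
          rw [hp]
          have := exp_neg_mul_confLog (S := S) (A := A) hδ ht 4
          push_cast at this
          rw [this]
          field_simp
          ring
      _ ≤ δ / t ^ 2 * 1 := by
          gcongr
          refine mul_le_one₀ (pow_le_one₀ hδ.le hδ1.le) (by positivity) ?_
          rw [div_le_one (by positivity)]
          have h3 : 1 ≤ (Fintype.card A : ℝ) ^ 3 := one_le_pow₀ hA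
          have h4 : 1 ≤ (Fintype.card S : ℝ) * Fintype.card A ^ 3 := by nlinarith
          have h5 : 1 ≤ (Fintype.card S : ℝ) * Fintype.card A ^ 3 * t := by nlinarith
          linarith
      _ = δ / t ^ 2 := mul_one _
  refine le_trans (measure_mono_ae ?_) (measure_iUnion_le_two_mul hδ hbad)
  filter_upwards [hrun.ae_pos] with ω hpos hω
  by_contra hcon
  refine hω ?_
  have hgood : ∀ t, 1 ≤ t → ω ∉ bad t := fun t ht hmem =>
    hcon (Set.mem_iUnion.2 ⟨t, Set.mem_iUnion.2 ⟨ht, hmem⟩⟩)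
  have hgood' : ∀ t, 1 ≤ t → ∀ h (hh : h < M.H), ∀ s a, _ := fun t ht h hh s a =>
    not_exists.1 (mt Set.mem_iUnion.2 (hgood t ht)) (⟨h, hh⟩, s, a)
  simp only [hone, Set.mem_union, Set.mem_iUnion, Set.mem_ofPred_eq, not_or, not_not,
    not_exists] at hgood'
  exact
    { start := hrun.start ω
      greedy := hrun.greedy ω
      pos := hpos
      conc_opt := fun t ht h hh s a => (hgood' t ht h hh s a).1.1
      conc_shape := fun t ht h hh s a => (hgood' t ht h hh s a).1.2
      conc_sq := fun t ht h hh s a => (hgood' t ht h hh s a).2.1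
      conc_indic := fun t ht h hh s a => (hgood' t ht h hh s a).2.2 }

/-- The cost function of episode `t` for the stopping set `D`, see `stepCost`. -/
def episodeCost (M : EpisodicMDP S A) (β : ℝ) (V : ℕ → S → ℝ) (δ W : ℝ) (D : Set (S × A))
    (st : ℕ → ℕ → S) (ac : ℕ → ℕ → A) (t : ℕ) : ℕ → S → A → ℝ :=
  stepCost D (β * M.shapeMax V) (β * M.shapeMax V + (M.avoidStates D).ncard * M.H * W)
    (confLog S A δ t) (visits st ac t)

/-- The expected stopped costs of the first `T` episodes are bounded by the realized ones. -/
def RealizedBound (M : EpisodicMDP S A) (β : ℝ) (V : ℕ → S → ℝ) (δ W : ℝ) (D : Set (S × A))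
    (st : ℕ → ℕ → S) (pol : ℕ → ℕ → S → A) (T : ℕ) : Prop :=
  ∑ t ∈ Finset.Icc 1 T, M.stoppedValue D (1 + 1 / M.H)
      (M.episodeCost β V δ W D st (actions st pol) t) (pol t) M.H 0 (st t 0) ≤
    2 * ∑ t ∈ Finset.Icc 1 T, stoppedSum D (1 + 1 / M.H)
      (M.episodeCost β V δ W D st (actions st pol) t) (st t) (actions st pol t) M.H 0 +
    2 * (3 * (M.H * (β * M.shapeMax V))) * (3 * confLog S A δ T)

theorem IsRun.measure_not_realizedBound_le [Nonempty A] (hrun : IsRun μ M β V δ st pol)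
    (hV : M.IsShaping β V) (hm : 0 < M.shapeMax V) (hH : 0 < M.H) (hδ : 0 < δ) (hδ1 : δ < 1)
    {W : ℝ} (hW : 0 ≤ W) (D : ℕ → Set (S × A)) :
    μ {ω | ¬ ∀ T, 1 ≤ T → ∀ k < Fintype.card S * Fintype.card A + 1,
      M.RealizedBound β V δ W (D k) (st ω) (pol ω) T} ≤ ENNReal.ofReal (2 * δ) := by
  have : Nonempty S := ⟨M.s0⟩
  have hβ := hV.one_le
  have hH' : (0 : ℝ) < M.H := by exact_mod_cast hH
  have hS : (1 : ℝ) ≤ Fintype.card S := by exact_mod_cast Fintype.card_pos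
  have hA : (1 : ℝ) ≤ Fintype.card A := by exact_mod_cast Fintype.card_pos
  have hB : 0 < β * M.shapeMax V := by positivity
  -- `confLog` is defined for all `t`; at `t = 0` it is `log 0 = 0`.
  have hl : ∀ t, 0 ≤ confLog S A δ t := by
    intro t
    rcases Nat.eq_zero_or_pos t with rfl | ht
    · simp [confLog]
    · exact confLog_nonneg hδ hδ1 ht
  have hone : ∀ k T, μ.real {ω | ¬ M.RealizedBound β V δ W (D k) (st ω) (pol ω) T} ≤
      Real.exp (-(3 * confLog S A δ T)) := by
    intro k T
    simp only [RealizedBound, not_le]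
    refine hrun.measureReal_stopped_le (D k) (1 + 1 / M.H)
      (c := fun ω t => M.episodeCost β V δ W (D k) (st ω) (actions (st ω) (pol ω)) t)
      ?_ (K := 3 * (M.H * (β * M.shapeMax V))) (by positivity) ?_ ?_ T _
    · intro t ht h hh ω ω' hω
      funext s a
      exact congrArg (fun n => stepCost (D k) (β * M.shapeMax V)
        (β * M.shapeMax V + (M.avoidStates (D k)).ncard * M.H * W) (confLog S A δ t)
        (fun _ _ _ => n) h s a) (histDet_visits (t := t) (h := 0) hh s a ω ω' hω)
    · intro ω t
      exact stoppedSum_nonneg (by positivity)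
        (stepCost_nonneg hB.le (by positivity) (hl t) _) _ _ _ _
    · intro ω t
      refine (stoppedSum_le (by simp) hB.le (stepCost_le _) _ _ _ _).trans ?_
      exact mul_le_mul_of_nonneg_right (one_add_inv_pow_le M.H) (by positivity)
  set bad : ℕ → Set Ω := fun T => ⋃ k ∈ Finset.range (Fintype.card S * Fintype.card A + 1),
    {ω | ¬ M.RealizedBound β V δ W (D k) (st ω) (pol ω) T} with hbaddef
  have hbad : ∀ T, 1 ≤ T → μ.real (bad T) ≤ δ / T ^ 2 := by
    intro T hT
    have hT' : (1 : ℝ) ≤ T := by exact_mod_cast hT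
    have h1 : 1 ≤ (Fintype.card S : ℝ) * Fintype.card A := by nlinarith
    calc μ.real (bad T) ≤ ∑ k ∈ Finset.range (Fintype.card S * Fintype.card A + 1),
          Real.exp (-(3 * confLog S A δ T)) :=
          (measureReal_biUnion_finset_le _ _).trans (Finset.sum_le_sum fun k _ => hone k T)
      _ = (Fintype.card S * Fintype.card A + 1) * Real.exp (-(3 * confLog S A δ T)) := by
          simp
      _ ≤ (2 * (Fintype.card S * Fintype.card A)) * Real.exp (-(3 * confLog S A δ T)) := by
          gcongr
          linarith
      _ = δ / T ^ 2 * (δ ^ 2 * (1 / (4 * (Fintype.card S * Fintype.card A) ^ 2 * T))) := by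
          have := exp_neg_mul_confLog (S := S) (A := A) hδ hT 3
          push_cast at this
          rw [this]
          field_simp
          ring
      _ ≤ δ / T ^ 2 * 1 := by
          gcongr
          refine mul_le_one₀ (pow_le_one₀ hδ.le hδ1.le) (by positivity) ?_
          rw [div_le_one (by positivity)]
          have h3 : 1 ≤ ((Fintype.card S : ℝ) * Fintype.card A) ^ 2 := one_le_pow₀ h1
          nlinarith
      _ = δ / T ^ 2 := mul_one _
  refine le_trans (measure_mono ?_) (measure_iUnion_le_two_mul hδ hbad)
  intro ω hω
  simp only [Set.mem_ofPred_eq, not_forall] at hω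
  obtain ⟨T, hT, k, hk, hbad⟩ := hω
  exact Set.mem_iUnion.2 ⟨T, Set.mem_iUnion.2 ⟨hT,
    Set.mem_biUnion (x := k) (by simpa using hk) hbad⟩⟩

end

section

/-! ### Sums over visits -/

section counting

variable {S A : Type*}

open Classical in
theorem visits_succ (st : ℕ → ℕ → S) (ac : ℕ → ℕ → A) {t : ℕ} (ht : 1 ≤ t) (h : ℕ) (s : S) (a : A) :
    visits st ac (t + 1) h s a =
      visits st ac t h s a + if st t h = s ∧ ac t h = a then 1 else 0 := by
  unfold visits
  rw [Finset.card_filter, Finset.card_filter, Finset.sum_Ico_succ_top ht]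

open Classical in
theorem sum_visits (st : ℕ → ℕ → S) (ac : ℕ → ℕ → A) (h : ℕ) (s : S) (a : A) (φ : ℕ → ℝ) (T : ℕ) :
    ∑ t ∈ Finset.Icc 1 T, (if st t h = s ∧ ac t h = a then φ (visits st ac t h s a) else 0) =
      ∑ j ∈ Finset.range (visits st ac (T + 1) h s a), φ j := by
  induction T with
  | zero => simp [visits]
  | succ T ih =>
    rw [Finset.sum_Icc_succ_top (by omega), ih, visits_succ st ac (by omega : 1 ≤ T + 1)]
    split_ifs with hv
    · rw [Finset.sum_range_succ]
    · simp

open Classical in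
/-- Summing over the visits of the triples in `K` is summing over the numbers of visits. -/
theorem sum_sum_visits (st : ℕ → ℕ → S) (ac : ℕ → ℕ → A) {H : ℕ} (K : Finset (ℕ × S × A))
    (hK : ∀ k ∈ K, k.1 < H) (φ : ℕ → ℝ) (T : ℕ) :
    ∑ t ∈ Finset.Icc 1 T, ∑ h ∈ Finset.range H,
      (if (h, st t h, ac t h) ∈ K then φ (visits st ac t h (st t h) (ac t h)) else 0) =
      ∑ k ∈ K, ∑ j ∈ Finset.range (visits st ac (T + 1) k.1 k.2.1 k.2.2), φ j := by
  simp_rw [← sum_visits]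
  rw [Finset.sum_comm (s := K)]
  refine Finset.sum_congr rfl fun t _ => ?_
  have h1 : ∀ h, (if (h, st t h, ac t h) ∈ K then φ (visits st ac t h (st t h) (ac t h)) else 0) =
      ∑ k ∈ K, if k = (h, st t h, ac t h) then φ (visits st ac t k.1 k.2.1 k.2.2) else 0 := by
    intro h
    rw [Finset.sum_ite_eq']
  simp_rw [h1]
  rw [Finset.sum_comm]
  refine Finset.sum_congr rfl fun k hk => ?_
  rw [Finset.sum_eq_single_of_mem k.1 (Finset.mem_range.2 (hK k hk))]
  · refine if_congr ?_ rfl rfl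
    simp [Prod.ext_iff, eq_comm]
  · intro h _ hne
    rw [if_neg]
    rintro rfl
    exact hne rfl

theorem sum_inv_sqrt_le (n : ℕ) :
    ∑ j ∈ Finset.range n, 1 / Real.sqrt (j + 1 : ℝ) ≤ 2 * Real.sqrt n := by
  induction n with
  | zero => simp
  | succ n ih =>
    rw [Finset.sum_range_succ]
    have h1 : Real.sqrt n ≤ Real.sqrt (n + 1) := Real.sqrt_le_sqrt (by linarith)
    have h2 : 0 < Real.sqrt ((n : ℝ) + 1) := Real.sqrt_pos.2 (by positivity)
    have h3 : Real.sqrt ((n : ℝ) + 1) ^ 2 = n + 1 := Real.sq_sqrt (by positivity)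
    have h4 : Real.sqrt (n : ℝ) ^ 2 = n := Real.sq_sqrt (by positivity)
    have h5 : 1 / Real.sqrt ((n : ℝ) + 1) ≤ 2 * (Real.sqrt (n + 1) - Real.sqrt n) := by
      rw [div_le_iff₀ h2]
      nlinarith [Real.sqrt_nonneg (n : ℝ)]
    push_cast
    linarith

theorem log_succ_ge {T : ℕ} (hT : 1 ≤ T) : 1 / 2 ≤ Real.log (T + 1 : ℝ) := by
  have h1 : (2 : ℝ) ≤ T + 1 := by
    have : (1 : ℝ) ≤ T := by exact_mod_cast hT
    linarith
  have := Real.log_le_log two_pos h1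
  linarith [Real.log_two_gt_d9]

theorem sum_inv_le {n T : ℕ} (hT : 1 ≤ T) (hn : n ≤ T) :
    ∑ j ∈ Finset.range n, 1 / (j + 1 : ℝ) ≤ 3 * Real.log (T + 1) := by
  have hlog := log_succ_ge hT
  have h1 : ∑ j ∈ Finset.range n, 1 / (j + 1 : ℝ) ≤ ∑ j ∈ Finset.range T, 1 / (j + 1 : ℝ) :=
    Finset.sum_le_sum_of_subset_of_nonneg (Finset.range_mono hn) fun _ _ _ => by positivity
  have h2 : ∑ j ∈ Finset.range T, 1 / (j + 1 : ℝ) = (harmonic T : ℝ) := by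
    simp [harmonic]
  have h3 := harmonic_le_one_add_log T
  have h4 : Real.log T ≤ Real.log (T + 1 : ℝ) :=
    Real.log_le_log (by exact_mod_cast hT) (by linarith)
  linarith

/-- The pigeonhole bound: widths of order `1 / √N` and `1 / N`, summed over all visits of the
triples in `K`, of which there are at most `R`. -/
theorem sum_width_le (K : Finset (ℕ × S × A)) (N : ℕ × S × A → ℕ) {T : ℕ} (hT : 1 ≤ T)
    (hN : ∀ k ∈ K, N k ≤ T) {α γ m R : ℝ} (hα : 0 ≤ α) (hγ : 0 ≤ γ) (hm : (K.card : ℝ) ≤ m)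
    (hR : ∑ k ∈ K, (N k : ℝ) ≤ R) :
    ∑ k ∈ K, ∑ j ∈ Finset.range (N k), (α / Real.sqrt (j + 1) + γ / (j + 1)) ≤
      2 * α * Real.sqrt (m * R) + 3 * γ * m * Real.log (T + 1) := by
  have hlog : 0 ≤ Real.log (T + 1 : ℝ) := by linarith [log_succ_ge hT]
  have h1 : ∀ k ∈ K, ∑ j ∈ Finset.range (N k), (α / Real.sqrt (j + 1) + γ / (j + 1)) ≤
      2 * α * Real.sqrt (N k) + 3 * γ * Real.log (T + 1) := by
    intro k hk
    have e1 := mul_le_mul_of_nonneg_left (sum_inv_sqrt_le (N k)) hα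
    have e2 := mul_le_mul_of_nonneg_left (sum_inv_le hT (hN k hk)) hγ
    rw [Finset.sum_add_distrib]
    simp_rw [div_eq_mul_one_div α, div_eq_mul_one_div γ]
    rw [← Finset.mul_sum, ← Finset.mul_sum]
    linarith
  have h2 : ∑ k ∈ K, Real.sqrt (N k) ≤ Real.sqrt (m * R) := by
    refine Real.le_sqrt_of_sq_le ?_
    refine sq_sum_le_card_mul_sum_sq.trans ?_
    have e1 : ∑ k ∈ K, Real.sqrt (N k) ^ 2 = ∑ k ∈ K, (N k : ℝ) :=
      Finset.sum_congr rfl fun k _ => Real.sq_sqrt (Nat.cast_nonneg _)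
    rw [e1]
    exact mul_le_mul hm hR (Finset.sum_nonneg fun k _ => Nat.cast_nonneg _)
      ((Nat.cast_nonneg _).trans hm)
  calc _ ≤ ∑ k ∈ K, (2 * α * Real.sqrt (N k) + 3 * γ * Real.log (T + 1)) :=
        Finset.sum_le_sum h1
    _ = 2 * α * ∑ k ∈ K, Real.sqrt (N k) + K.card * (3 * γ * Real.log (T + 1)) := by
        rw [Finset.sum_add_distrib, ← Finset.mul_sum, Finset.sum_const, nsmul_eq_mul]
    _ ≤ 2 * α * Real.sqrt (m * R) + m * (3 * γ * Real.log (T + 1)) := by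
        gcongr
    _ = _ := by ring

open Classical in
/-- A stopped sum is at most `ρ ^ n` times the sum of the costs of the steps before stopping. -/
theorem stoppedSum_le_sum {D : Set (S × A)} {ρ : ℝ} (hρ : 1 ≤ ρ) {c : ℕ → S → A → ℝ}
    (hc : ∀ h s a, 0 ≤ c h s a) (x : ℕ → S) (a : ℕ → A) (n h : ℕ) :
    stoppedSum D ρ c x a n h ≤ ρ ^ n * ∑ k ∈ Finset.Ico h (h + n),
      if ∀ j, h ≤ j → j < k → (x j, a j) ∉ D then c k (x k) (a k) else 0 := by
  induction n generalizing h with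
  | zero => simp [stoppedSum]
  | succ n ih =>
    have hpow : 1 ≤ ρ ^ (n + 1) := one_le_pow₀ hρ
    rw [stoppedSum, Finset.sum_eq_sum_Ico_succ_bot (by omega : h < h + (n + 1)),
      if_pos (fun j h1 h2 => by omega)]
    have h0 := hc h (x h) (a h)
    have h1 : c h (x h) (a h) ≤ ρ ^ (n + 1) * c h (x h) (a h) := le_mul_of_one_le_left h0 hpow
    by_cases hD : (x h, a h) ∈ D
    · rw [if_pos hD, mul_add]
      have : 0 ≤ ρ ^ (n + 1) * ∑ k ∈ Finset.Ico (h + 1) (h + (n + 1)),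
          if ∀ j, h ≤ j → j < k → (x j, a j) ∉ D then c k (x k) (a k) else 0 := by
        refine mul_nonneg (by linarith) (Finset.sum_nonneg fun k _ => ?_)
        split_ifs
        · exact hc _ _ _
        · exact le_rfl
      linarith
    · rw [if_neg hD, mul_add]
      have h2 := mul_le_mul_of_nonneg_left (ih (h + 1)) (by linarith : 0 ≤ ρ)
      rw [← mul_assoc, ← pow_succ', show h + 1 + n = h + (n + 1) by ring] at h2
      have h3 : ∑ k ∈ Finset.Ico (h + 1) (h + (n + 1)),
          (if ∀ j, h + 1 ≤ j → j < k → (x j, a j) ∉ D then c k (x k) (a k) else 0) =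
          ∑ k ∈ Finset.Ico (h + 1) (h + (n + 1)),
          if ∀ j, h ≤ j → j < k → (x j, a j) ∉ D then c k (x k) (a k) else 0 := by
        refine Finset.sum_congr rfl fun k _ => if_congr ⟨fun hj j h4 h5 => ?_,
          fun hj j h4 h5 => hj j (by omega) h5⟩ rfl rfl
        rcases h4.eq_or_lt with rfl | h4
        · exact hD
        · exact hj j h4 h5
      rw [h3] at h2
      linarith

theorem stepCost_le_width {D : Set (S × A)} {B e l l' : ℝ} (hB : 0 ≤ B) (hBe : B ≤ e)
    (hll : l ≤ l') (hl' : 1 ≤ l') (N : ℕ → S → A → ℕ) {h : ℕ} {s : S} {a : A} (hD : (s, a) ∉ D) :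
    stepCost D B e l N h s a ≤
      40 * B * Real.sqrt l' / Real.sqrt (N h s a + 1) + 32 * e * l' / (N h s a + 1) := by
  have he : 0 ≤ e := hB.trans hBe
  unfold stepCost
  split_ifs with hN
  · have hN0 : N h s a = 0 := hN.resolve_left hD
    rw [hN0]
    simp only [Nat.cast_zero, zero_add, Real.sqrt_one, div_one]
    have : 0 ≤ 40 * B * Real.sqrt l' := by positivity
    nlinarith
  · have hN0 : 1 ≤ N h s a := Nat.one_le_iff_ne_zero.2 fun h0 => hN (Or.inr h0)
    have hn : (1 : ℝ) ≤ N h s a := by exact_mod_cast hN0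
    set n : ℝ := (N h s a : ℝ) with hndef
    refine (min_le_right _ _).trans ?_
    have h1 : Real.sqrt (l / n) ≤ 2 * (Real.sqrt l' / Real.sqrt (n + 1)) := by
      rw [← Real.sqrt_div (by linarith), show (2 : ℝ) = Real.sqrt 4 by
        rw [show (4 : ℝ) = 2 ^ 2 by norm_num, Real.sqrt_sq two_pos.le],
        ← Real.sqrt_mul (by norm_num)]
      refine Real.sqrt_le_sqrt ?_
      rw [← mul_div_assoc, div_le_div_iff₀ (by linarith) (by linarith)]
      nlinarith
    have h2 : 16 * e * l / n ≤ 32 * e * l' / (n + 1) := by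
      rw [div_le_div_iff₀ (by linarith) (by linarith)]
      have e1 : e * l ≤ e * l' := mul_le_mul_of_nonneg_left hll he
      have e2 : 0 ≤ e * l' := by positivity
      nlinarith
    have h3 := mul_le_mul_of_nonneg_left h1 (by positivity : 0 ≤ 20 * B)
    have h4 : 20 * B * (2 * (Real.sqrt l' / Real.sqrt (n + 1))) =
      40 * B * Real.sqrt l' / Real.sqrt (n + 1) := by ring
    linarith

end counting

end

section

variable {S A : Type*} [Fintype S] [Fintype A]

/-! ### The visited pairs of the trajectories -/

open Classical in
/-- The triples (step, state, action) whose state is reached at that decision step along a path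
that avoids `D`. -/
def avoidTriples (M : EpisodicMDP S A) (D : Set (S × A)) : Finset (ℕ × S × A) :=
  (Finset.range M.H ×ˢ Finset.univ ×ˢ Finset.univ).filter fun k => k.2.1 ∈ M.avoidReach D k.1

open Classical in
/-- The triples at which a trajectory can traverse a pair of `D` for the first time. -/
def exitTriples (M : EpisodicMDP S A) (D : Set (S × A)) : Finset (ℕ × S × A) :=
  (M.avoidTriples D).filter fun k => k.2 ∈ D

theorem mem_avoidTriples {M : EpisodicMDP S A} {D : Set (S × A)} {k : ℕ × S × A} :
    k ∈ M.avoidTriples D ↔ k.1 < M.H ∧ k.2.1 ∈ M.avoidReach D k.1 := by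
  simp [avoidTriples]

theorem mem_exitTriples {M : EpisodicMDP S A} {D : Set (S × A)} {k : ℕ × S × A} :
    k ∈ M.exitTriples D ↔ (k.1 < M.H ∧ k.2.1 ∈ M.avoidReach D k.1) ∧ k.2 ∈ D := by
  simp [exitTriples, mem_avoidTriples]

theorem snd_injOn_avoidTriples {M : EpisodicMDP S A} (hM : M.StepIndexed) (D : Set (S × A)) :
    Set.InjOn Prod.snd (M.avoidTriples D : Set (ℕ × S × A)) := by
  rintro ⟨h, p⟩ hk ⟨h', p'⟩ hk' hpp
  obtain ⟨h1, h2⟩ := mem_avoidTriples.1 (Finset.mem_coe.1 hk)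
  obtain ⟨h3, h4⟩ := mem_avoidTriples.1 (Finset.mem_coe.1 hk')
  simp only at hpp h1 h2 h3 h4
  subst hpp
  rw [hM.eq h1 h3 (M.avoidReach_subset_reachable _ _ h2) (M.avoidReach_subset_reachable _ _ h4)]

theorem card_avoidTriples_le {M : EpisodicMDP S A} (hM : M.StepIndexed) (D : Set (S × A)) :
    (M.avoidTriples D).card ≤ (M.avoidStates D).ncard * Fintype.card A := by
  classical
  rw [← Finset.card_image_of_injOn (snd_injOn_avoidTriples hM D), ← Set.ncard_coe_finset]
  refine (Set.ncard_le_ncard (t := M.avoidStates D ×ˢ Set.univ) ?_).trans ?_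
  · intro p hp
    obtain ⟨k, hk, rfl⟩ := Finset.mem_image.1 (Finset.mem_coe.1 hp)
    obtain ⟨h1, h2⟩ := mem_avoidTriples.1 hk
    exact ⟨⟨k.1, h1, h2⟩, trivial⟩
  · rw [Set.ncard_prod, Set.ncard_univ, Nat.card_eq_fintype_card]

theorem card_exitTriples_le {M : EpisodicMDP S A} (hM : M.StepIndexed) (β : ℝ) (V : ℕ → S → ℝ)
    (Δ : ℝ) : (M.exitTriples (M.pseudoSub β V Δ)).card ≤ (M.boundaryPseudoSub β V Δ).ncard := by
  classical
  have hinj : Set.InjOn Prod.snd (M.exitTriples (M.pseudoSub β V Δ) : Set (ℕ × S × A)) :=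
    (snd_injOn_avoidTriples hM _).mono (Finset.coe_subset.2 (Finset.filter_subset _ _))
  rw [← Finset.card_image_of_injOn hinj, ← Set.ncard_coe_finset]
  refine Set.ncard_le_ncard ?_
  intro p hp
  obtain ⟨k, hk, rfl⟩ := Finset.mem_image.1 (Finset.mem_coe.1 hp)
  obtain ⟨⟨h1, h2⟩, h3⟩ := mem_exitTriples.1 hk
  refine ⟨h3, ?_⟩
  rw [← Set.mem_compl_iff, compl_pathPseudoSub]
  exact ⟨k.1, h1, h2⟩

variable {M : EpisodicMDP S A} {β : ℝ} {V : ℕ → S → ℝ} {δ : ℝ} {st : ℕ → ℕ → S}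
  {pol : ℕ → ℕ → S → A}

theorem GoodEvent.mem_avoidReach (hg : M.GoodEvent β V δ st pol) {D : Set (S × A)} {t k : ℕ}
    (ht : 1 ≤ t) (hk : k ≤ M.H) (hD : ∀ j < k, (st t j, actions st pol t j) ∉ D) :
    st t k ∈ M.avoidReach D k :=
  ⟨st t, actions st pol t, ⟨hg.start t ht, fun i hi => hg.pos t ht i (by omega)⟩, rfl, hD⟩

omit [Fintype A] in
theorem sum_visits_triples_le (K : Finset (ℕ × S × A)) (hK : ∀ k ∈ K, k.1 < M.H)
    (ac : ℕ → ℕ → A) (T : ℕ) :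
    ∑ k ∈ K, (visits st ac (T + 1) k.1 k.2.1 k.2.2 : ℝ) ≤ T * M.H := by
  classical
  have h1 := sum_sum_visits st ac K hK (fun _ => 1) T
  simp only [Finset.sum_const, Finset.card_range, nsmul_eq_mul, mul_one] at h1
  rw [← h1]
  calc _ ≤ ∑ t ∈ Finset.Icc 1 T, ∑ h ∈ Finset.range M.H, (1 : ℝ) := by
        gcongr
        split_ifs <;> norm_num
    _ = _ := by simp

/-- A trajectory that leaves the states reached while avoiding `D` has traversed an exit triple, so
the visits outside are at most `H` times as many as the visits of exit triples. -/
theorem GoodEvent.sum_visits_outside_le (hg : M.GoodEvent β V δ st pol) (D : Set (S × A))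
    (K : Finset (ℕ × S × A)) (hK : ∀ k ∈ K, k.1 < M.H) (hKD : ∀ k ∈ K, k ∉ M.avoidTriples D)
    (T : ℕ) :
    ∑ k ∈ K, (visits st (actions st pol) (T + 1) k.1 k.2.1 k.2.2 : ℝ) ≤
      M.H * ∑ k ∈ M.exitTriples D,
        (visits st (actions st pol) (T + 1) k.1 k.2.1 k.2.2 : ℝ) := by
  classical
  have h1 := sum_sum_visits st (actions st pol) K hK (fun _ => 1) T
  have h2 := sum_sum_visits st (actions st pol) (H := M.H) (M.exitTriples D)
    (fun k hk => (mem_exitTriples.1 hk).1.1) (fun _ => 1) T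
  simp only [Finset.sum_const, Finset.card_range, nsmul_eq_mul, mul_one] at h1 h2
  rw [← h1, ← h2, Finset.mul_sum]
  refine Finset.sum_le_sum fun t ht => ?_
  have ht1 : 1 ≤ t := (Finset.mem_Icc.1 ht).1
  have hnonneg : ∀ h ∈ Finset.range M.H,
      0 ≤ if (h, st t h, actions st pol t h) ∈ M.exitTriples D then (1 : ℝ) else 0 :=
    fun h _ => by split_ifs <;> norm_num
  by_cases hex : ∃ h < M.H, (h, st t h, actions st pol t h) ∈ K
  · obtain ⟨h, hh, hmem⟩ := hex
    have hne : ∃ j, j < h ∧ (st t j, actions st pol t j) ∈ D := by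
      by_contra hcon
      push Not at hcon
      exact hKD _ hmem (mem_avoidTriples.2 ⟨hh, hg.mem_avoidReach ht1 hh.le hcon⟩)
    have hj := Nat.find_spec hne
    set j := Nat.find hne with hjdef
    have hjexit : (j, st t j, actions st pol t j) ∈ M.exitTriples D := by
      refine mem_exitTriples.2 ⟨⟨by simp only; omega, hg.mem_avoidReach ht1 (by simp only; omega)
        fun i hi hiD => ?_⟩, hj.2⟩
      exact Nat.find_min hne hi ⟨by simp only at hi; omega, hiD⟩
    have h3 : (1 : ℝ) ≤ ∑ h ∈ Finset.range M.H,
        if (h, st t h, actions st pol t h) ∈ M.exitTriples D then 1 else 0 := by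
      refine le_trans ?_ (Finset.single_le_sum hnonneg (Finset.mem_range.2 (by omega : j < M.H)))
      rw [if_pos hjexit]
    calc _ ≤ ∑ h ∈ Finset.range M.H, (1 : ℝ) := by
          gcongr
          split_ifs <;> norm_num
      _ = M.H * 1 := by simp
      _ ≤ _ := by gcongr
  · push Not at hex
    rw [Finset.sum_eq_zero fun h hh => if_neg (hex h (Finset.mem_range.1 hh))]
    exact mul_nonneg (Nat.cast_nonneg _) (Finset.sum_nonneg hnonneg)

theorem confLog_mono [Nonempty A] (M : EpisodicMDP S A) (hδ : 0 < δ) {t T : ℕ} (ht : 1 ≤ t)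
    (hT : t ≤ T) : confLog S A δ t ≤ confLog S A δ T := by
  have : Nonempty S := ⟨M.s0⟩
  have h1 : (0 : ℝ) < Fintype.card S := by exact_mod_cast Fintype.card_pos
  have h2 : (0 : ℝ) < Fintype.card A := by exact_mod_cast Fintype.card_pos
  have h3 : (0 : ℝ) < t := by exact_mod_cast ht
  unfold confLog
  refine Real.log_le_log (by positivity) ?_
  gcongr

theorem GoodEvent.visits_exit_le [Nonempty A] (hg : M.GoodEvent β V δ st pol)
    (hV : M.IsShaping β V) (hM : M.StepIndexed) (hδ : 0 < δ) (hδ1 : δ < 1) {Δ : ℝ} (hΔ : 0 < Δ)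
    {T : ℕ} (hl : 1 ≤ confLog S A δ T) {k : ℕ × S × A}
    (hk : k ∈ M.exitTriples (M.pseudoSub β V Δ)) :
    (visits st (actions st pol) (T + 1) k.1 k.2.1 k.2.2 : ℝ) ≤
      1297 * (β * M.shapeMax V) ^ 2 * confLog S A δ T / Δ ^ 2 := by
  classical
  obtain ⟨h, s, a⟩ := k
  obtain ⟨⟨hh, hs⟩, ⟨h', hh', hr, hgap⟩⟩ := mem_exitTriples.1 hk
  simp only at hh hs hr hgap ⊢
  obtain rfl : h' = h := hM.eq hh' hh hr (M.avoidReach_subset_reachable _ _ hs)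
  have hβ := hV.one_le
  have hm : 0 ≤ M.shapeMax V := (hV.nonneg (Nat.zero_le _) M.s0).trans
    (M.le_shapeMax V (Nat.zero_le _) M.s0)
  have hB : Δ ≤ β * M.shapeMax V := by
    have h1 := hV.optValue_le_mul_shapeMax hh.le s
    have h2 := M.r_nonneg s a
    have h3 : 0 ≤ β * ∑ y, M.P s a y * V (h' + 1) y :=
      mul_nonneg (by linarith) (M.expect_nonneg s a fun y => hV.nonneg hh y)
    rw [Qup_eq] at hgap
    linarith
  have hone : 1 ≤ (β * M.shapeMax V) ^ 2 * confLog S A δ T / Δ ^ 2 := by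
    rw [le_div_iff₀ (by positivity), one_mul]
    have := pow_le_pow_left₀ hΔ.le hB 2
    nlinarith
  have key : ∀ n ≤ T, (visits st (actions st pol) (n + 1) h' s a : ℝ) ≤
      1297 * ((β * M.shapeMax V) ^ 2 * confLog S A δ T / Δ ^ 2) := by
    intro n
    induction n with
    | zero =>
      intro _
      have : visits st (actions st pol) (0 + 1) h' s a = 0 := by simp [visits]
      rw [this, Nat.cast_zero]
      linarith
    | succ n ih =>
      intro hn
      rw [visits_succ st (actions st pol) (by omega : 1 ≤ n + 1)]
      split_ifs with hv
      · obtain ⟨h1, h2⟩ := hv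
        simp only [actions] at h2
        rw [h1] at h2
        have h3 := hg.visits_le_of_gap hV hδ hδ1 (by omega : 1 ≤ n + 1) hh hΔ (s := s)
          (by rw [h2]; exact hgap)
        rw [h2] at h3
        have h4 : 1296 * (β * M.shapeMax V) ^ 2 * confLog S A δ (n + 1) / Δ ^ 2 ≤
            1296 * ((β * M.shapeMax V) ^ 2 * confLog S A δ T / Δ ^ 2) := by
          rw [← mul_div_assoc, ← mul_assoc]
          gcongr
          exact confLog_mono M hδ (by omega) hn
        push_cast
        linarith
      · rw [add_zero]
        exact ih (by omega)
  refine (key T le_rfl).trans (le_of_eq ?_)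
  ring

/-- The realized stopped costs, bounded by the widths at the pairs visited before stopping and by
`B = β Ṽ^max` for each stop. -/
theorem GoodEvent.sum_stoppedSum_le [Nonempty A] (hg : M.GoodEvent β V δ st pol)
    (hV : M.IsShaping β V) (hδ : 0 < δ) (hδ1 : δ < 1) {W : ℝ} (hW : 0 ≤ W) (D : Set (S × A))
    {T : ℕ} (hl : 1 ≤ confLog S A δ T) :
    ∑ t ∈ Finset.Icc 1 T, stoppedSum D (1 + 1 / M.H)
      (M.episodeCost β V δ W D st (actions st pol) t) (st t) (actions st pol t) M.H 0 ≤
    3 * (∑ k ∈ M.avoidTriples D,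
        ∑ j ∈ Finset.range (visits st (actions st pol) (T + 1) k.1 k.2.1 k.2.2),
        (40 * (β * M.shapeMax V) * Real.sqrt (confLog S A δ T) / Real.sqrt (j + 1) +
          32 * (β * M.shapeMax V + (M.avoidStates D).ncard * M.H * W) * confLog S A δ T /
            (j + 1)) +
      β * M.shapeMax V * ∑ k ∈ M.exitTriples D,
        (visits st (actions st pol) (T + 1) k.1 k.2.1 k.2.2 : ℝ)) := by
  classical
  have : Nonempty S := ⟨M.s0⟩
  have hβ := hV.one_le
  have hm : 0 ≤ M.shapeMax V := (hV.nonneg (Nat.zero_le _) M.s0).trans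
    (M.le_shapeMax V (Nat.zero_le _) M.s0)
  have hB : 0 ≤ β * M.shapeMax V := by positivity
  set B := β * M.shapeMax V with hBdef
  set e := B + (M.avoidStates D).ncard * M.H * W with he
  have hBe : B ≤ e := by
    have : 0 ≤ (M.avoidStates D).ncard * M.H * W := by positivity
    linarith
  have he0 : 0 ≤ e := hB.trans hBe
  set φ : ℕ → ℝ := fun j => 40 * B * Real.sqrt (confLog S A δ T) / Real.sqrt (j + 1) +
    32 * e * confLog S A δ T / (j + 1) with hφ
  have hφ0 : ∀ j, 0 ≤ φ j := fun j => by
    simp only [hφ]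
    positivity
  set ac := actions st pol with hac
  have h1 := sum_sum_visits st ac (H := M.H) (M.avoidTriples D)
    (fun k hk => (mem_avoidTriples.1 hk).1) φ T
  have h2 := sum_sum_visits st ac (H := M.H) (M.exitTriples D)
    (fun k hk => (mem_exitTriples.1 hk).1.1) (fun _ => 1) T
  simp only [Finset.sum_const, Finset.card_range, nsmul_eq_mul, mul_one] at h2
  rw [← h1, ← h2, Finset.mul_sum, ← Finset.sum_add_distrib, Finset.mul_sum]
  refine Finset.sum_le_sum fun t ht => ?_
  obtain ⟨ht1, ht2⟩ := Finset.mem_Icc.1 ht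
  have hlt := confLog_mono M hδ ht1 ht2
  have hlt0 := confLog_nonneg (S := S) (A := A) hδ hδ1 ht1
  have hc0 : ∀ h s a, 0 ≤ M.episodeCost β V δ W D st ac t h s a :=
    stepCost_nonneg hB he0 hlt0 _
  refine (stoppedSum_le_sum (by simp) hc0 _ _ _ _).trans ?_
  rw [zero_add, Nat.Ico_zero_eq_range, Finset.mul_sum _ _ B, ← Finset.sum_add_distrib]
  refine mul_le_mul (one_add_inv_pow_le M.H) (Finset.sum_le_sum fun h hh => ?_)
    (Finset.sum_nonneg fun h _ => ?_) (by norm_num)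
  · have hh' : h < M.H := Finset.mem_range.1 hh
    have hn1 : 0 ≤ if (h, st t h, ac t h) ∈ M.avoidTriples D then
        φ (visits st ac t h (st t h) (ac t h)) else 0 := by
      split_ifs
      · exact hφ0 _
      · exact le_rfl
    have hn2 : 0 ≤ B * if (h, st t h, ac t h) ∈ M.exitTriples D then (1 : ℝ) else 0 := by
      split_ifs <;> simp [hB]
    by_cases halive : ∀ j, 0 ≤ j → j < h → (st t j, ac t j) ∉ D
    · rw [if_pos halive]
      have hmem : st t h ∈ M.avoidReach D h :=
        hg.mem_avoidReach ht1 hh'.le fun j hj => halive j (Nat.zero_le _) hj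
      by_cases hD : (st t h, ac t h) ∈ D
      · rw [if_pos (mem_exitTriples.2 ⟨⟨hh', hmem⟩, hD⟩), mul_one]
        have := stepCost_le (D := D) (B := B) (e := e) (l := confLog S A δ t) (visits st ac t) h
          (st t h) (ac t h)
        unfold episodeCost
        linarith
      · rw [if_pos (mem_avoidTriples.2 ⟨hh', hmem⟩)]
        have := stepCost_le_width hB hBe hlt hl (visits st ac t) (h := h) hD
        unfold episodeCost
        simp only [hφ]
        linarith
    · rw [if_neg halive]
      linarith
  · split_ifs
    · exact hc0 _ _ _
    · exact le_rfl

end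

section

variable {S A : Type*} [Fintype S] [Fintype A]

/-! ### The regret bound on the good event -/

theorem sqrt_mul_sqrt_le {l L m T H : ℝ} (hl : 0 ≤ l) (hlL : l ≤ 2 * L) (hm : 0 ≤ m) (hT : 0 ≤ T)
    (hH : 1 ≤ H) : Real.sqrt l * Real.sqrt (m * (T * H)) ≤ 2 * H * Real.sqrt (m * T * L) := by
  have hL : 0 ≤ L := by linarith
  have h0 : Real.sqrt ((2 * H) ^ 2 * (m * T * L)) = 2 * H * Real.sqrt (m * T * L) := by
    rw [Real.sqrt_mul (sq_nonneg _), Real.sqrt_sq (by positivity)]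
  rw [← Real.sqrt_mul hl, ← h0]
  refine Real.sqrt_le_sqrt ?_
  have h1 : 0 ≤ m * T := by positivity
  have h2 : l * H ≤ 2 * L * H := mul_le_mul_of_nonneg_right hlL (by linarith)
  have h3 : 2 * L * H ≤ 4 * H ^ 2 * L := by
    have : 0 ≤ L * H := by positivity
    nlinarith
  have h4 := mul_le_mul_of_nonneg_left (h2.trans h3) h1
  linarith

theorem steps_mul_le {B H L l n a g : ℝ} (hB : 0 ≤ B) (hH : 0 ≤ H) (hL : 0 ≤ L) (hlL : l ≤ 2 * L)
    (hHn : H ≤ n) (ha : 1 ≤ a) (hg : 1 / 2 ≤ g) : H * B * l ≤ 4 * (B * L * (n * a * g)) := by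
  have hn : 0 ≤ n := hH.trans hHn
  have h1 : n ≤ n * a := le_mul_of_one_le_right hn ha
  have h2 : n * a * (1 / 2) ≤ n * a * g := mul_le_mul_of_nonneg_left hg (hn.trans h1)
  have h3 : H ≤ 2 * (n * a * g) := by linarith
  have h4 := mul_le_mul_of_nonneg_left h3 (mul_nonneg hB hL)
  have h5 := mul_le_mul_of_nonneg_left hlL (mul_nonneg hH hB)
  linarith

theorem lower_order_le {B H L l m n a g w : ℝ} (hB : 0 ≤ B) (hH : 1 ≤ H)
    (hl : 0 ≤ l) (hlL : l ≤ 2 * L) (hm : 0 ≤ m) (hmn : m ≤ n) (ha : 0 ≤ a) (hg : 0 ≤ g)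
    (hw : 0 ≤ w) :
    32 * (B + m * H * (w * B)) * l * (n * a) * g ≤
      64 * (B * L * (w * n ^ 2 * a * H ^ 2 * g + n * a * g)) := by
  have hn : 0 ≤ n := hm.trans hmn
  have hH2 : H ≤ H ^ 2 := by nlinarith
  calc 32 * (B + m * H * (w * B)) * l * (n * a) * g
      ≤ 32 * (B + n * H ^ 2 * (w * B)) * (2 * L) * (n * a) * g := by gcongr
    _ = _ := by ring

theorem confLog_le_two_mul_logFactor [Nonempty A] (M : EpisodicMDP S A) (V : ℕ → S → ℝ) {δ : ℝ}
    (hδ : 0 < δ) (hδ6 : δ < 1 / 6) {T : ℕ} (hT : 1 ≤ T) :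
    1 ≤ M.logFactor V δ T ∧ 1 ≤ confLog S A δ T ∧ confLog S A δ T ≤ 2 * M.logFactor V δ T := by
  have : Nonempty S := ⟨M.s0⟩
  have hS : (1 : ℝ) ≤ Fintype.card S := by exact_mod_cast Fintype.card_pos
  have hA : (1 : ℝ) ≤ Fintype.card A := by exact_mod_cast Fintype.card_pos
  have hT' : (1 : ℝ) ≤ T := by exact_mod_cast hT
  set q : ℝ := Fintype.card S * Fintype.card A * T / δ with hq
  have hq6 : 6 ≤ q := by
    rw [hq, le_div_iff₀ hδ]
    have h1 : 1 ≤ (Fintype.card S : ℝ) * Fintype.card A := by nlinarith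
    nlinarith
  have hlogq : 1 ≤ Real.log q := by
    rw [Real.le_log_iff_exp_le (by linarith)]
    linarith [Real.exp_one_lt_d9]
  have h1 : M.logFactor V δ T = Real.log (max 1 (M.shapeMax V) * q) := by
    unfold logFactor
    congr 1
    rw [hq]
    ring
  have h2 : confLog S A δ T = Real.log 2 + Real.log q := by
    rw [← Real.log_mul two_ne_zero (by linarith)]
    unfold confLog
    congr 1
    rw [hq]
    ring
  have h3 : Real.log q ≤ M.logFactor V δ T := by
    rw [h1]
    exact Real.log_le_log (by linarith) (le_mul_of_one_le_left (by linarith) (le_max_left _ _))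
  have h4 := Real.log_two_lt_d9
  have h5 := Real.log_two_gt_d9
  refine ⟨by linarith, by linarith, by linarith⟩

variable {M : EpisodicMDP S A} {β : ℝ} {V : ℕ → S → ℝ} {δ : ℝ} {st : ℕ → ℕ → S}
  {pol : ℕ → ℕ → S → A}

/-- The regret is bounded by the confidence widths along the realized trajectories, stopped at the
first pair of `D`. -/
theorem GoodEvent.regret_le [Nonempty A] (hg : M.GoodEvent β V δ st pol)
    (hV : M.IsShaping β V) (hδ : 0 < δ) (hδ1 : δ < 1) {W : ℝ} (hW0 : 0 ≤ W)
    (hW : ∀ h < M.H, ∀ s, β * V h s - M.optValue h s ≤ W) (D : Set (S × A)) {T : ℕ}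
    (hl : 1 ≤ confLog S A δ T) (hreal : M.RealizedBound β V δ W D st pol T) :
    ∑ t ∈ Finset.Icc 1 T, (M.optValue 0 M.s0 - M.value (pol t) 0 M.s0) ≤
    6 * (∑ k ∈ M.avoidTriples D,
        ∑ j ∈ Finset.range (visits st (actions st pol) (T + 1) k.1 k.2.1 k.2.2),
        (40 * (β * M.shapeMax V) * Real.sqrt (confLog S A δ T) / Real.sqrt (j + 1) +
          32 * (β * M.shapeMax V + (M.avoidStates D).ncard * M.H * W) * confLog S A δ T /
            (j + 1)) +
      β * M.shapeMax V * ∑ k ∈ M.exitTriples D,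
        (visits st (actions st pol) (T + 1) k.1 k.2.1 k.2.2 : ℝ)) +
    18 * (M.H * (β * M.shapeMax V)) * confLog S A δ T := by
  have h1 : ∑ t ∈ Finset.Icc 1 T, (M.optValue 0 M.s0 - M.value (pol t) 0 M.s0) ≤
      ∑ t ∈ Finset.Icc 1 T, M.stoppedValue D (1 + 1 / M.H)
        (M.episodeCost β V δ W D st (actions st pol) t) (pol t) M.H 0 (st t 0) := by
    refine Finset.sum_le_sum fun t ht => ?_
    have ht1 := (Finset.mem_Icc.1 ht).1
    rw [hg.start t ht1]
    have e1 := hg.optValue_le_Vhat hV hδ hδ1 ht1 0 M.s0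
    have e0 : ∀ h < M.H, ((M.avoidReach D h).ncard : ℝ) ≤ (M.avoidStates D).ncard :=
      fun h hh => by
        have hsub : M.avoidReach D h ⊆ M.avoidStates D := fun s hs => ⟨h, hh, hs⟩
        exact_mod_cast Set.ncard_le_ncard hsub
    have e2 := hg.Vhat_sub_value_le_stoppedValue hV hδ hδ1 ht1 (D := D)
      (n := (M.avoidStates D).ncard) hW0 hW
      e0 M.H 0 (by omega) (M.start_mem_avoidReach D)
    unfold episodeCost
    linarith
  have h2 := hg.sum_stoppedSum_le hV hδ hδ1 hW0 D hl
  unfold RealizedBound at hreal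
  linarith

theorem sum_exit_visits_le [Nonempty A] (hg : M.GoodEvent β V δ st pol)
    (hV : M.IsShaping β V) (hM : M.StepIndexed) (hδ : 0 < δ) (hδ1 : δ < 1) {Δ : ℝ} (hΔ : 0 < Δ)
    {T : ℕ} (hl : 1 ≤ confLog S A δ T) :
    ∑ k ∈ M.exitTriples (M.pseudoSub β V Δ),
        (visits st (actions st pol) (T + 1) k.1 k.2.1 k.2.2 : ℝ) ≤
      (M.boundaryPseudoSub β V Δ).ncard *
        (1297 * (β * M.shapeMax V) ^ 2 * confLog S A δ T / Δ ^ 2) := by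
  refine (Finset.sum_le_card_nsmul _ _ _ fun k hk =>
    hg.visits_exit_le hV hM hδ hδ1 hΔ hl hk).trans ?_
  rw [nsmul_eq_mul]
  have h1 : ((M.exitTriples (M.pseudoSub β V Δ)).card : ℝ) ≤
      (M.boundaryPseudoSub β V Δ).ncard := by exact_mod_cast card_exitTriples_le hM β V Δ
  refine mul_le_mul_of_nonneg_right h1 ?_
  have : 0 ≤ confLog S A δ T := by linarith
  positivity

omit [Fintype S] [Fintype A] in
theorem visits_succ_le (st : ℕ → ℕ → S) (ac : ℕ → ℕ → A) (T h : ℕ) (s : S) (a : A) :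
    visits st ac (T + 1) h s a ≤ T :=
  Nat.lt_succ_iff.1 (visits_lt st ac (by omega) h s a)

/-- The bound with `B̄`: trajectories are stopped at the first pseudo-suboptimal pair, and each of
the few stops costs at most `β Ṽ^max`. -/
theorem GoodEvent.regret_le_Bbar [Nonempty A] (hg : M.GoodEvent β V δ st pol)
    (hV : M.IsShaping β V) (hM : M.StepIndexed) (hH : 0 < M.H) (hδ : 0 < δ) (hδ6 : δ < 1 / 6)
    {κ : ℝ} (hκ : 0 ≤ κ) (hW : ∀ h < M.H, ∀ s, β * V h s - M.optValue h s ≤ κ * M.shapeMax V)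
    {Δ : ℝ} (hΔ : 0 < Δ) {T : ℕ} (hT : 1 ≤ T)
    (hreal : M.RealizedBound β V δ (κ * M.shapeMax V) (M.pseudoSub β V Δ) st pol T) :
    ∑ t ∈ Finset.Icc 1 T, (M.optValue 0 M.s0 - M.value (pol t) 0 M.s0) ≤
      100000 * (M.H * β * M.shapeMax V *
        Real.sqrt ((M.pathPseudoSub β V Δ)ᶜ.ncard * Fintype.card A * T * M.logFactor V δ T) +
        β * M.shapeMax V * M.logFactor V δ T * M.Bbar β V κ T Δ) := by
  have hδ1 : δ < 1 := by linarith
  obtain ⟨hL, hl, hlL⟩ := M.confLog_le_two_mul_logFactor V hδ hδ6 hT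
  have hβ := hV.one_le
  have hm : 0 ≤ M.shapeMax V := (hV.nonneg (Nat.zero_le _) M.s0).trans
    (M.le_shapeMax V (Nat.zero_le _) M.s0)
  have hA : (1 : ℝ) ≤ Fintype.card A := by exact_mod_cast Fintype.card_pos
  have hH1 : (1 : ℝ) ≤ M.H := by exact_mod_cast hH
  have hT0 : (0 : ℝ) ≤ T := Nat.cast_nonneg _
  have hlog := log_succ_ge hT
  have hHn : (M.H : ℝ) ≤ (M.avoidStates (M.pseudoSub β V Δ)).ncard := by
    exact_mod_cast M.H_le_ncard_avoidStates hM
      (M.avoidReach_pseudoSub_nonempty hM hV.optValue_le hΔ)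
  have hreg := hg.regret_le hV hδ hδ1 (mul_nonneg hκ hm) hW (M.pseudoSub β V Δ) hl hreal
  have hexit := sum_exit_visits_le hg hV hM hδ hδ1 hΔ hl
  have hcard : ((M.avoidTriples (M.pseudoSub β V Δ)).card : ℝ) ≤
      (M.avoidStates (M.pseudoSub β V Δ)).ncard * Fintype.card A := by
    exact_mod_cast card_avoidTriples_le hM (M.pseudoSub β V Δ)
  have hvis := sum_visits_triples_le (st := st) (M.avoidTriples (M.pseudoSub β V Δ))
    (fun k hk => (mem_avoidTriples.1 hk).1) (actions st pol) T
  unfold Bbar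
  rw [compl_pathPseudoSub]
  set n : ℝ := ((M.avoidStates (M.pseudoSub β V Δ)).ncard : ℝ) with hn
  set b : ℝ := ((M.boundaryPseudoSub β V Δ).ncard : ℝ) with hb
  have hn0 : 0 ≤ n := Nat.cast_nonneg _
  have hb0 : 0 ≤ b := Nat.cast_nonneg _
  set B := β * M.shapeMax V with hBdef
  have hB : 0 ≤ B := by positivity
  set l := confLog S A δ T with hldef
  set L := M.logFactor V δ T with hLdef
  set g := Real.log (T + 1 : ℝ) with hgdef
  set a : ℝ := (Fintype.card A : ℝ) with hadef
  set H : ℝ := (M.H : ℝ) with hHdef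
  have hwidth := sum_width_le (M.avoidTriples (M.pseudoSub β V Δ))
    (fun k => visits st (actions st pol) (T + 1) k.1 k.2.1 k.2.2) hT
    (fun k _ => visits_succ_le st _ T _ _ _)
    (by positivity : 0 ≤ 40 * B * Real.sqrt l)
    (by positivity : 0 ≤ 32 * (B + n * H * (κ * M.shapeMax V)) * l) hcard hvis
  have p1 := mul_le_mul_of_nonneg_left (sqrt_mul_sqrt_le (by linarith : 0 ≤ l) hlL
    (by positivity : 0 ≤ n * a) hT0 hH1) (by positivity : 0 ≤ 480 * B)
  have hκB : κ * M.shapeMax V = κ / β * B := by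
    rw [hBdef]
    field_simp
  have p2 : 32 * (B + n * H * (κ * M.shapeMax V)) * l * (n * a) * g ≤
      64 * (B * L * (κ / β * n ^ 2 * a * H ^ 2 * g + n * a * g)) := by
    rw [hκB]
    exact lower_order_le hB hH1 (by linarith only [hl]) hlL hn0 le_rfl
      (by linarith only [hA]) (by linarith only [hlog]) (by positivity)
  have p3 : B * (b * (1297 * B ^ 2 * l / Δ ^ 2)) ≤
      2594 * (B * L * (β ^ 2 * M.shapeMax V ^ 2 * H * b / Δ ^ 2)) := by
    have e0 : β ^ 2 * M.shapeMax V ^ 2 = B ^ 2 := by rw [hBdef]; ring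
    rw [e0]
    have e1 : 0 ≤ B * b * B ^ 2 / Δ ^ 2 := by positivity
    have e2 : l ≤ 2 * L * H :=
      hlL.trans (le_mul_of_one_le_right (by linarith only [hL]) hH1)
    have e3 := mul_le_mul_of_nonneg_left e2 e1
    calc _ = 1297 * (B * b * B ^ 2 / Δ ^ 2 * l) := by ring
      _ ≤ 1297 * (B * b * B ^ 2 / Δ ^ 2 * (2 * L * H)) := by linarith only [e3]
      _ = _ := by ring
  have p4 : H * B * l ≤ 4 * (B * L * (n * a * g)) :=
    steps_mul_le hB (by linarith only [hH1]) (by linarith only [hL]) hlL hHn hA hlog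
  have p5 := mul_le_mul_of_nonneg_left hexit hB
  have q1 : 0 ≤ H * β * M.shapeMax V * Real.sqrt (n * a * T * L) := by positivity
  have q2 : 0 ≤ B * L * (β ^ 2 * M.shapeMax V ^ 2 * H * b / Δ ^ 2) := by positivity
  have q3 : 0 ≤ B * L * (κ / β * n ^ 2 * a * H ^ 2 * g) := by positivity
  have q4 : 0 ≤ B * L * (n * a * g) := by positivity
  have p1' : 480 * B * (2 * H * Real.sqrt (n * a * T * L)) =
      960 * (H * β * M.shapeMax V * Real.sqrt (n * a * T * L)) := by rw [hBdef]; ring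
  rw [p1'] at p1
  rw [← hgdef] at hwidth
  linarith only [hreg, hwidth, p1, p2, p3, p4, p5, q1, q2, q3, q4]

/-- The bound with `Ā`: trajectories are not stopped. The steps at pruned states are at most `H`
times as many as the visits of boundary pairs, and the widths are summed over them separately. -/
theorem GoodEvent.regret_le_Abar [Nonempty A] (hg : M.GoodEvent β V δ st pol)
    (hV : M.IsShaping β V) (hM : M.StepIndexed) (hH : 0 < M.H) (hδ : 0 < δ) (hδ6 : δ < 1 / 6)
    {κ : ℝ} (hκ : 0 ≤ κ) (hW : ∀ h < M.H, ∀ s, β * V h s - M.optValue h s ≤ κ * M.shapeMax V)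
    {Δ : ℝ} (hΔ : 0 < Δ) {T : ℕ} (hT : 1 ≤ T)
    (hreal : M.RealizedBound β V δ (κ * M.shapeMax V) ∅ st pol T) :
    ∑ t ∈ Finset.Icc 1 T, (M.optValue 0 M.s0 - M.value (pol t) 0 M.s0) ≤
      100000 * (M.H * β * M.shapeMax V *
        Real.sqrt ((M.pathPseudoSub β V Δ)ᶜ.ncard * Fintype.card A * T * M.logFactor V δ T) +
        β * M.shapeMax V * M.logFactor V δ T * M.Abar β V κ T Δ) := by
  classical
  have hδ1 : δ < 1 := by linarith
  obtain ⟨hL, hl, hlL⟩ := M.confLog_le_two_mul_logFactor V hδ hδ6 hT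
  have hβ := hV.one_le
  have hm : 0 ≤ M.shapeMax V := (hV.nonneg (Nat.zero_le _) M.s0).trans
    (M.le_shapeMax V (Nat.zero_le _) M.s0)
  have hA : (1 : ℝ) ≤ Fintype.card A := by exact_mod_cast Fintype.card_pos
  have hH1 : (1 : ℝ) ≤ M.H := by exact_mod_cast hH
  have hT0 : (0 : ℝ) ≤ T := Nat.cast_nonneg _
  have hlog := log_succ_ge hT
  have hHn : (M.H : ℝ) ≤ (M.avoidStates (M.pseudoSub β V Δ)).ncard := by
    exact_mod_cast M.H_le_ncard_avoidStates hM
      (M.avoidReach_pseudoSub_nonempty hM hV.optValue_le hΔ)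
  have hreg := hg.regret_le hV hδ hδ1 (mul_nonneg hκ hm) hW ∅ hl hreal
  have hexit := sum_exit_visits_le hg hV hM hδ hδ1 hΔ hl
  have hnS : ∀ D, ((M.avoidStates D).ncard : ℝ) ≤ Fintype.card S := fun D => by
    rw [← Nat.card_eq_fintype_card, ← Set.ncard_univ]
    exact_mod_cast Set.ncard_le_ncard (Set.subset_univ (M.avoidStates D))
  have hempty : M.exitTriples ∅ = ∅ := by
    ext k
    simp [mem_exitTriples]
  rw [hempty, Finset.sum_empty, mul_zero, add_zero,
    ← Finset.sum_filter_add_sum_filter_not _ (· ∈ M.avoidTriples (M.pseudoSub β V Δ))] at hreg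
  set K1 := (M.avoidTriples ∅).filter (· ∈ M.avoidTriples (M.pseudoSub β V Δ)) with hK1
  set K2 := (M.avoidTriples ∅).filter (· ∉ M.avoidTriples (M.pseudoSub β V Δ)) with hK2
  have hcard1 : (K1.card : ℝ) ≤ (M.avoidStates (M.pseudoSub β V Δ)).ncard * Fintype.card A := by
    have h1 : K1 ⊆ M.avoidTriples (M.pseudoSub β V Δ) := fun k hk => (Finset.mem_filter.1 hk).2
    exact_mod_cast (Finset.card_le_card h1).trans (card_avoidTriples_le hM (M.pseudoSub β V Δ))
  have hcard2 : (K2.card : ℝ) ≤ Fintype.card S * Fintype.card A := by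
    have h1 : (K2.card : ℝ) ≤ (M.avoidStates ∅).ncard * Fintype.card A := by
      exact_mod_cast (Finset.card_le_card (Finset.filter_subset _ _)).trans
        (card_avoidTriples_le hM ∅)
    exact h1.trans (mul_le_mul_of_nonneg_right (hnS ∅) (by linarith))
  have hvis1 := sum_visits_triples_le (st := st) K1
    (fun k hk => (mem_avoidTriples.1 (Finset.mem_filter.1 hk).1).1) (actions st pol) T
  have hvis2 := (hg.sum_visits_outside_le (M.pseudoSub β V Δ) K2
    (fun k hk => (mem_avoidTriples.1 (Finset.mem_filter.1 hk).1).1)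
    (fun k hk => (Finset.mem_filter.1 hk).2) T).trans
    (mul_le_mul_of_nonneg_left hexit (Nat.cast_nonneg _))
  have hnS1 := hnS (M.pseudoSub β V Δ)
  have hnS0 := hnS ∅
  unfold Abar
  rw [compl_pathPseudoSub]
  set n : ℝ := ((M.avoidStates (M.pseudoSub β V Δ)).ncard : ℝ) with hn
  set n0 : ℝ := ((M.avoidStates (∅ : Set (S × A))).ncard : ℝ) with hn0def
  set b : ℝ := ((M.boundaryPseudoSub β V Δ).ncard : ℝ) with hb
  have hn0 : 0 ≤ n := Nat.cast_nonneg _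
  have hn00 : 0 ≤ n0 := Nat.cast_nonneg _
  have hb0 : 0 ≤ b := Nat.cast_nonneg _
  set B := β * M.shapeMax V with hBdef
  have hB : 0 ≤ B := by positivity
  set l := confLog S A δ T with hldef
  set L := M.logFactor V δ T with hLdef
  set g := Real.log (T + 1 : ℝ) with hgdef
  set a : ℝ := (Fintype.card A : ℝ) with hadef
  set s : ℝ := (Fintype.card S : ℝ) with hsdef
  set H : ℝ := (M.H : ℝ) with hHdef
  have hs0 : 0 ≤ s := hn0.trans hnS1
  have hα : 0 ≤ 40 * B * Real.sqrt l := by positivity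
  have hγ : 0 ≤ 32 * (B + n0 * H * (κ * M.shapeMax V)) * l := by positivity
  have hwidth1 := sum_width_le K1
    (fun k => visits st (actions st pol) (T + 1) k.1 k.2.1 k.2.2) hT
    (fun k _ => visits_succ_le st _ T _ _ _) hα hγ hcard1 hvis1
  have hwidth2 := sum_width_le K2
    (fun k => visits st (actions st pol) (T + 1) k.1 k.2.1 k.2.2) hT
    (fun k _ => visits_succ_le st _ T _ _ _) hα hγ hcard2 hvis2
  have p1 := mul_le_mul_of_nonneg_left (sqrt_mul_sqrt_le (by linarith : 0 ≤ l) hlL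
    (by positivity : 0 ≤ n * a) hT0 hH1) (by positivity : 0 ≤ 480 * B)
  have hκB : κ * M.shapeMax V = κ / β * B := by
    rw [hBdef]
    field_simp
  have p2 : 32 * (B + n0 * H * (κ * M.shapeMax V)) * l * (s * a) * g ≤
      64 * (B * L * (κ / β * s ^ 2 * a * H ^ 2 * g + s * a * g)) := by
    rw [hκB]
    exact lower_order_le hB hH1 (by linarith only [hl]) hlL hn00 hnS0
      (by linarith only [hA]) (by linarith only [hlog]) (by positivity)
  have p2' : 32 * (B + n0 * H * (κ * M.shapeMax V)) * l * (n * a) * g ≤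
      32 * (B + n0 * H * (κ * M.shapeMax V)) * l * (s * a) * g := by gcongr
  have p3 : 40 * B * Real.sqrt l * Real.sqrt (s * a * (H * (b * (1297 * B ^ 2 * l / Δ ^ 2)))) ≤
      2960 * (B * L * (β * M.shapeMax V * Real.sqrt H * Real.sqrt s * Real.sqrt a *
        Real.sqrt b / Δ)) := by
    have e1 : Real.sqrt (s * a * (H * (b * (1297 * B ^ 2 * l / Δ ^ 2)))) ≤
        37 * (B / Δ) * Real.sqrt l * (Real.sqrt H * Real.sqrt s * Real.sqrt a * Real.sqrt b) := by
      refine Real.sqrt_le_iff.2 ⟨by positivity, ?_⟩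
      simp only [mul_pow, div_pow]
      rw [Real.sq_sqrt (by linarith : 0 ≤ l), Real.sq_sqrt (by linarith : 0 ≤ H),
        Real.sq_sqrt hs0, Real.sq_sqrt (by linarith : 0 ≤ a), Real.sq_sqrt hb0]
      have e2 : 0 ≤ s * a * H * b * (B ^ 2 * l / Δ ^ 2) := by positivity
      calc _ = 1297 * (s * a * H * b * (B ^ 2 * l / Δ ^ 2)) := by ring
        _ ≤ 37 ^ 2 * (s * a * H * b * (B ^ 2 * l / Δ ^ 2)) := by linarith
        _ = _ := by ring
    have e2 := mul_le_mul_of_nonneg_left e1 hα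
    have e3 : Real.sqrt l * Real.sqrt l = l := Real.mul_self_sqrt (by linarith)
    have e4 : 0 ≤ B * (B / Δ) * (Real.sqrt H * Real.sqrt s * Real.sqrt a * Real.sqrt b) := by
      positivity
    calc _ ≤ _ := e2
      _ = 1480 * (B * (B / Δ) * (Real.sqrt H * Real.sqrt s * Real.sqrt a * Real.sqrt b) *
          (Real.sqrt l * Real.sqrt l)) := by ring
      _ ≤ 1480 * (B * (B / Δ) * (Real.sqrt H * Real.sqrt s * Real.sqrt a * Real.sqrt b) *
          (2 * L)) := by
          rw [e3]
          gcongr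
      _ = _ := by rw [hBdef]; ring
  have p4 : H * B * l ≤ 4 * (B * L * (s * a * g)) :=
    steps_mul_le hB (by linarith only [hH1]) (by linarith only [hL]) hlL (hHn.trans hnS1) hA hlog
  have q1 : 0 ≤ H * β * M.shapeMax V * Real.sqrt (n * a * T * L) := by positivity
  have q2 : 0 ≤ B * L * (β * M.shapeMax V * Real.sqrt H * Real.sqrt s * Real.sqrt a *
        Real.sqrt b / Δ) := by positivity
  have q3 : 0 ≤ B * L * (κ / β * s ^ 2 * a * H ^ 2 * g) := by positivity
  have q4 : 0 ≤ B * L * (s * a * g) := by positivity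
  have p1' : 480 * B * (2 * H * Real.sqrt (n * a * T * L)) =
      960 * (H * β * M.shapeMax V * Real.sqrt (n * a * T * L)) := by rw [hBdef]; ring
  rw [p1'] at p1
  rw [← hBdef] at q2 p3
  rw [← hgdef] at hwidth1 hwidth2
  linarith only [hreg, hwidth1, hwidth2, p1, p2, p2', p3, p4, q1, q2, q3, q4]

theorem regretBound_nonneg [Nonempty A] (hV : M.IsShaping β V) (hδ : 0 < δ) (hδ6 : δ < 1 / 6)
    {κ : ℝ} (hκ : 0 ≤ κ) {Δ : ℝ} (hΔ : 0 < Δ) {T : ℕ} (hT : 1 ≤ T) :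
    0 ≤ M.regretBound β V δ κ T Δ := by
  have hL := (M.confLog_le_two_mul_logFactor V hδ hδ6 hT).1
  have hβ := hV.one_le
  have hm : 0 ≤ M.shapeMax V := (hV.nonneg (Nat.zero_le _) M.s0).trans
    (M.le_shapeMax V (Nat.zero_le _) M.s0)
  have hlog := log_succ_ge hT
  have hA : 0 ≤ M.Abar β V κ T Δ := by unfold Abar; positivity
  have hB : 0 ≤ M.Bbar β V κ T Δ := by unfold Bbar; positivity
  have := le_min hA hB
  unfold regretBound
  positivity

/-- The sets `PseudoSub_Δ` decrease in `Δ`, so a pair count determines them and there are at most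
`|S| |A| + 1` of them. This is why a union bound makes the regret bound uniform in `Δ`. -/
theorem exists_pseudoSub_family (M : EpisodicMDP S A) (β : ℝ) (V : ℕ → S → ℝ) :
    ∃ D : ℕ → Set (S × A),
      (∃ k < Fintype.card S * Fintype.card A + 1, D k = ∅) ∧
      ∀ Δ, 0 < Δ → ∃ k < Fintype.card S * Fintype.card A + 1, D k = M.pseudoSub β V Δ := by
  classical
  have hanti : ∀ Δ Δ', Δ ≤ Δ' → M.pseudoSub β V Δ' ⊆ M.pseudoSub β V Δ := by
    rintro Δ Δ' hle p ⟨h, hh, hr, hp⟩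
    exact ⟨h, hh, hr, by linarith⟩
  refine ⟨fun k => if hk : ∃ Δ, 0 < Δ ∧ (M.pseudoSub β V Δ).ncard = k then
    M.pseudoSub β V hk.choose else ∅, ⟨0, by omega, ?_⟩, fun Δ hΔ =>
      ⟨(M.pseudoSub β V Δ).ncard, ?_, ?_⟩⟩
  · simp only
    split_ifs with hk
    · exact (Set.ncard_eq_zero).1 hk.choose_spec.2
    · rfl
  · have := Set.ncard_le_ncard (Set.subset_univ (M.pseudoSub β V Δ))
    rw [Set.ncard_univ, Nat.card_eq_fintype_card, Fintype.card_prod] at this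
    omega
  · have hk : ∃ Δ', 0 < Δ' ∧ (M.pseudoSub β V Δ').ncard = (M.pseudoSub β V Δ).ncard :=
      ⟨Δ, hΔ, rfl⟩
    simp only
    rw [dif_pos hk]
    have hspec := hk.choose_spec.2
    rcases le_total Δ hk.choose with hle | hle
    · exact Set.eq_of_subset_of_ncard_le (hanti _ _ hle) hspec.ge
    · exact (Set.eq_of_subset_of_ncard_le (hanti _ _ hle) hspec.le).symm

omit [Fintype A] in
/-- The range of the empirical value function above the optimal value, in both cases for `κ`. -/
theorem shape_gap_le (hV : M.IsShaping β V) [Nonempty A] {κ : ℝ}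
    (hκ : κ = β ∨ (κ = β - 1 ∧ ∀ h < M.H, ∀ s, V h s ≤ M.optValue h s)) (h : ℕ) (hh : h < M.H)
    (s : S) : β * V h s - M.optValue h s ≤ κ * M.shapeMax V := by
  have hβ := hV.one_le
  have h1 := M.le_shapeMax V hh.le s
  rcases hκ with rfl | ⟨rfl, hle⟩
  · have h2 := M.optValue_nonneg h s
    nlinarith
  · have h2 := hle h hh s
    nlinarith

theorem ofReal_le_measure_of_compl_subset {Ω : Type*} [MeasurableSpace Ω] {μ : Measure Ω}
    [IsProbabilityMeasure μ] {δ : ℝ} (hδ : 0 < δ) {E F G : Set Ω} (hsub : Eᶜ ⊆ F ∪ G)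
    (hF : μ F ≤ ENNReal.ofReal (2 * δ)) (hG : μ G ≤ ENNReal.ofReal (2 * δ)) :
    ENNReal.ofReal (1 - 6 * δ) ≤ μ E := by
  have h1 : μ Eᶜ ≤ ENNReal.ofReal (6 * δ) := by
    refine (measure_mono hsub).trans ((measure_union_le F G).trans ((add_le_add hF hG).trans ?_))
    rw [← ENNReal.ofReal_add (by linarith) (by linarith)]
    exact ENNReal.ofReal_le_ofReal (by linarith)
  have h2 : 1 ≤ μ E + μ Eᶜ := by
    rw [← measure_univ (μ := μ), ← Set.union_compl_self E]
    exact measure_union_le _ _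
  rw [ENNReal.ofReal_sub _ (by linarith), ENNReal.ofReal_one]
  exact tsub_le_iff_right.2 (h2.trans (by gcongr))

end

end EpisodicMDP

end ShapedUCBVI

end

open ShapedUCBVI ShapedUCBVI.EpisodicMDP in
theorem theorem2 :
    ∃ C : ℝ, 0 < C ∧
      ∀ {S A : Type*} [Fintype S] [Fintype A] [Nonempty A]
        (M : ShapedUCBVI.EpisodicMDP S A) (_hM : M.StepIndexed)
        (β : ℝ) (_hβ : 1 ≤ β) (V : ℕ → S → ℝ)
        (_hV : ∀ h ≤ M.H, ∀ s, M.optValue h s ≤ β * V h s)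
        (κ : ℝ) (_hκ : κ = β ∨ (κ = β - 1 ∧ ∀ h < M.H, ∀ s, V h s ≤ M.optValue h s))
        (δ : ℝ) (_hδ : 0 < δ) (_hδ1 : δ < 1)
        {Ω : Type*} [MeasurableSpace Ω] (μ : MeasureTheory.Measure Ω)
        [MeasureTheory.IsProbabilityMeasure μ]
        (st : Ω → ℕ → ℕ → S) (pol : Ω → ℕ → ℕ → S → A)
        (_hrun : ShapedUCBVI.EpisodicMDP.IsRun μ M β V δ st pol),
        ENNReal.ofReal (1 - 6 * δ) ≤
          μ {ω | ∀ T : ℕ, 1 ≤ T → ∀ Δ : ℝ, 0 < Δ →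
            ∑ t ∈ Finset.Icc 1 T, (M.optValue 0 M.s0 - M.value (pol ω t) 0 M.s0) ≤
              C * M.regretBound β V δ κ T Δ} := by
  refine ⟨100000, by norm_num, ?_⟩
  intro S A _ _ _ M hM β hβ V hV0 κ hκ δ hδ hδ1 Ω _ μ _ st pol hrun
  have hV : M.IsShaping β V := ⟨hβ, hV0⟩
  rcases le_or_gt (1 / 6) δ with hδ6 | hδ6
  · rw [ENNReal.ofReal_of_nonpos (by linarith)]
    exact zero_le
  have hκ0 : 0 ≤ κ := by
    rcases hκ with rfl | ⟨rfl, -⟩ <;> linarith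
  have hm : 0 ≤ M.shapeMax V := (hV.nonneg (Nat.zero_le _) M.s0).trans
    (M.le_shapeMax V (Nat.zero_le _) M.s0)
  have htriv : M.optValue 0 M.s0 ≤ 0 → ENNReal.ofReal (1 - 6 * δ) ≤
      μ {ω | ∀ T : ℕ, 1 ≤ T → ∀ Δ : ℝ, 0 < Δ →
        ∑ t ∈ Finset.Icc 1 T, (M.optValue 0 M.s0 - M.value (pol ω t) 0 M.s0) ≤
          100000 * M.regretBound β V δ κ T Δ} := by
    intro h0
    refine ofReal_le_measure_of_compl_subset hδ (F := ∅) (G := ∅) ?_ (by simp) (by simp)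
    intro ω hω
    refine absurd (fun T hT Δ hΔ => ?_) hω
    have h1 := regretBound_nonneg hV hδ hδ6 hκ0 hΔ hT
    refine le_trans (Finset.sum_nonpos fun t _ => ?_) (by positivity)
    linarith [M.value_nonneg (pol ω t) 0 M.s0]
  rcases hm.eq_or_lt with hm0 | hm
  · refine htriv ?_
    have := hV.optValue_le_mul_shapeMax (Nat.zero_le _) M.s0
    rwa [← hm0, mul_zero] at this
  rcases Nat.eq_zero_or_pos M.H with hH | hH
  · exact htriv (M.optValue_of_le hH.le M.s0).le
  have hHS : M.H ≤ Fintype.card S := by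
    refine (M.H_le_ncard_avoidStates hM (M.avoidReach_pseudoSub_nonempty hM hV0 one_pos)).trans ?_
    rw [← Nat.card_eq_fintype_card, ← Set.ncard_univ]
    exact Set.ncard_le_ncard (Set.subset_univ _)
  obtain ⟨D, ⟨k0, hk0, hD0⟩, hD⟩ := exists_pseudoSub_family M β V
  refine ofReal_le_measure_of_compl_subset hδ ?_
    (hrun.measure_not_goodEvent_le hV hm hHS hδ hδ1)
    (hrun.measure_not_realizedBound_le hV hm hH hδ hδ1 (mul_nonneg hκ0 hm.le) D)
  intro ω hω
  by_contra hcon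
  simp only [Set.mem_union, Set.mem_ofPred_eq, not_or, not_not] at hcon
  obtain ⟨hg, hreal⟩ := hcon
  refine hω fun T hT Δ hΔ => ?_
  obtain ⟨k, hk, hDk⟩ := hD Δ hΔ
  have hW := shape_gap_le hV hκ
  have hA := hg.regret_le_Abar hV hM hH hδ hδ6 hκ0 hW hΔ hT (hD0 ▸ hreal T hT k0 hk0)
  have hB := hg.regret_le_Bbar hV hM hH hδ hδ6 hκ0 hW hΔ hT (hDk ▸ hreal T hT k hk)
  unfold regretBound
  rcases min_cases (M.Abar β V κ T Δ) (M.Bbar β V κ T Δ) with hmin | hmin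
  · rw [hmin.1]
    exact hA
  · rw [hmin.1]
    exact hB
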